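/- **Setting.** For $T\in\mathbb R^{d\times d\times d_3}$ ($d,d_3\ge1$) let $\widetilde T^{(j)}=\sum_k e^{-2\pi i jk/d_3}T^{(k)}$ be the frontal slices of its discrete Fourier transform along the third mode and $\sigma_{1j}\ge\dots\ge\sigma_{dj}\ge0$ the singular values of $\widetilde T^{(j)}$. Put $\|T\|_*=\frac1{d_3}\sum_{i,j}\sigma_{ij}$, let the tubal rank be $\mathrm{rank}_t(T)=\#\{i:\sigma_{ij}\ne0\text{ for some }j\}$, and for $\rho:\mathbb R\to\mathbb R$ put $\rho(T)=\frac1{d_3}\sum_{i,j}\rho(\sigma_{ij})$. $\langle\cdot,\cdot\rangle$ and $\|\cdot\|_F$ are the entrywise inner product and the Frobenius norm. *Penalty.* $\rho_\lambda:\mathbb R\to\mathbb R$ is continuous and even, $\rho_\lambda(0)=0$, it is nondecreasing and concave on $[0,\infty)$, $\rho_\lambda(x)/x$ is nonincreasing on $(0,\infty)$, $\rho_\lambda$ is differentiable off $0$ with $\lim_{t\to0^+}\rho_\lambda'(t)=\lambda C_{\rho'}$, $C_{\rho'}>0$, and $x\mapsto\rho_\lambda(x)+\frac\mu2x^2$ is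 convex, $\mu>0$. *Model.* $\nu$ is a $\sigma$-finite measure on $\mathbb R$, $w>0$, $\psi\in C^3(\mathbb R)$ and $\int e^{(y\theta-\psi(\theta))/w}\,d\nu(y)=1$ for all $\theta\in\mathbb R$; $|\psi''(s)|\le c$ for all $s$ and $|\psi'''(s)|\le|s|^{-1}$ for $|s|>1$. The pairs $(X_i,y_i)$, $i\le n$, are i.i.d.; given $X_i$, $y_i$ has density $\exp\{(y\langle X_i,B^0\rangle-\psi(\langle X_i,B^0\rangle))/w\}$ with respect to $\nu$; $\mathrm{rank}_t(B^0)=r$. The predictor is sub-Gaussian: $\|\langle X,U\rangle\|_{\psi_2}\le K$ whenever $\|U\|_F\le1$, where $\|z\|_{\psi_2}=\inf\{t>0:\mathbb E e^{z^2/t^2}\le2\}$. Let $L_n(B)=\frac1n\sum_i(-y_i\langle X_i,B\rangle+\psi(\langle X_i,B\rangle))$, $H(B)=\mathbb E[\psi''(\langle X,B\rangle)\,\mathrm{vec}(X)\mathrm{vec}(X)^{\mathsf T}]$, $\Lambda=\Lambda_{\min}(H(B^0))$ its smallest eigenvalue at $B^0$, and $\mathrm{PE}(B;B^0)=\langle L_n'(B)-L_n'(B^0),B-B^0\rangle$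 (the symmetrized Bregman divergence). A stationary point is a point $\widehat B$ with $0\in\partial(L_n+\rho_\lambda)(\widehat B)$, $\partial$ the limiting subdifferential. **Statement.** There is a numerical constant $C>0$ such that the following holds. Given $\psi,w,\nu,c,K,\mu,C_{\rho'}$ as above, $\Lambda_0$ with $3\mu<4\Lambda_0$, and any $A>0$, there are positive constants $\kappa_0,\beta_0,N$ depending only on these data (and not on $n,d,d_3,r,\lambda,B^0$, the law of $X$ or $\rho_\lambda$) such that, whenever $\Lambda\ge\Lambda_0$, $\lambda\ge\kappa_0\sqrt{dd_3/n}$ (in particular for $\lambda=\kappa\sqrt{dd_3/n}$ with any $\kappa\ge\kappa_0$), $0<\beta\le\beta_0$ and $n\ge N\max(r,1)\,dd_3/\beta^2$, with probability at least $1-d_3e^{-Ad}$ every stationary point $\widehat B$ of $L_n+\rho_\lambda$ with $\|\widehat B-B^0\|_F\le\beta$ satisfies $$\|\widehat B-B^0\|_F\le C\frac{C_{\rho'}\lambda\sqrt r}{4\Lambda-3\mu},\qquad \|\widehat B-B^0\|_*\le C\frac{C_{\rho'}\lambda r}{4\Lambda-3\mu},$$ $$\mathrm{PE}(\widehat B;B^0)\le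 C_{\rho'}^2\lambda^2r\Big(\frac{C}{4\Lambda-3\mu}+\frac{C\mu}{(4\Lambda-3\mu)^2}\Big).$$ (The probability of the complementary event is understood as outer probability.) -/

import Mathlib

open MeasureTheory ProbabilityTheory Filter Topology
open scoped ENNReal NNReal

noncomputable section

namespace TubalGLM

/-! ### Third-order tensors and their singular values in the Fourier domain -/

/-- Real tensors of size `d × d × d₃`, with the entrywise inner product; the norm of this
Euclidean space is the Frobenius norm. The entry `(a, b, k)` lies in the `k`-th frontal slice. -/
abbrev Tensor (d d₃ : ℕ) : Type := EuclideanSpace ℝ (Fin d × Fin d × Fin d₃)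

/-- The `j`-th frontal slice of the (unnormalised) discrete Fourier transform of `T` along the
third mode: `∑ₖ exp(-2πi jk/d₃) T⁽ᵏ⁾`. -/
def fourierSlice {d d₃ : ℕ} (T : Tensor d d₃) (j : Fin d₃) : Matrix (Fin d) (Fin d) ℂ :=
  Matrix.of fun a b => ∑ k : Fin d₃,
    Complex.exp (-2 * Real.pi * Complex.I * ((j : ℕ) : ℂ) * ((k : ℕ) : ℂ) / (d₃ : ℂ)) *
      ((T (a, b, k) : ℝ) : ℂ)

/-- `σ_{ij}`: the `i`-th largest singular value of the `j`-th Fourier slice, that is, the entry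
`(i, i, j)` of the Fourier transform of the f-diagonal factor of the t-SVD of `T`. -/
def tensorSingularValue {d d₃ : ℕ} (T : Tensor d d₃) (i : Fin d) (j : Fin d₃) : ℝ :=
  (Matrix.toEuclideanLin (fourierSlice T j)).singularValues (i : ℕ)

/-- The tubal rank: the number of nonzero tubes of the f-diagonal factor of the t-SVD
(a tube vanishes iff its Fourier transform does). -/
def tubalRank {d d₃ : ℕ} (T : Tensor d d₃) : ℕ :=
  Set.ncard {i : Fin d | ∃ j : Fin d₃, tensorSingularValue T i j ≠ 0}

/-- The tensor tubal nuclear norm `(1/d₃) ∑ᵢⱼ σ_{ij}`. -/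
def nuclearNorm {d d₃ : ℕ} (T : Tensor d d₃) : ℝ :=
  (1 / (d₃ : ℝ)) * ∑ i : Fin d, ∑ j : Fin d₃, tensorSingularValue T i j

/-! ### The regularizer -/

/-- The spectral regularizer `(1/d₃) ∑ᵢⱼ ρ(σ_{ij})` generated by a univariate function `ρ`. -/
def regularizer {d d₃ : ℕ} (ρ : ℝ → ℝ) (T : Tensor d d₃) : ℝ :=
  (1 / (d₃ : ℝ)) * ∑ i : Fin d, ∑ j : Fin d₃, ρ (tensorSingularValue T i j)

/-- The conditions on the univariate penalty `ρ = ρ_λ`: here `lam = λ` is the tuning parameter,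
`Cρ = C_{ρ'}` is the normalised slope at the origin, `ρ_λ'(0+) = λ C_{ρ'}`, and `μ` is the level
of weak convexity. -/
structure IsPenalty (ρ : ℝ → ℝ) (lam Cρ μ : ℝ) : Prop where
  continuous : Continuous ρ
  concave : ConcaveOn ℝ (Set.Ici 0) ρ
  even : ∀ x, ρ (-x) = ρ x
  zero : ρ 0 = 0
  mono : MonotoneOn ρ (Set.Ici 0)
  ratio_antitone : AntitoneOn (fun x => ρ x / x) (Set.Ioi 0)
  differentiable : ∀ t : ℝ, t ≠ 0 → DifferentiableAt ℝ ρ t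
  slope_zero : Tendsto (deriv ρ) (𝓝[>] (0 : ℝ)) (𝓝 (lam * Cρ))
  weakly_convex : ConvexOn ℝ Set.univ fun x => ρ x + μ / 2 * x ^ 2

/-! ### Stationary points of nonsmooth functions -/

section Stationary

variable {E : Type*} [NormedAddCommGroup E] [InnerProductSpace ℝ E]

/-- `v` is a Fréchet (regular) subgradient of `f` at `x`. -/
def IsFrechetSubgradient (f : E → ℝ) (x v : E) : Prop :=
  ∀ ε : ℝ, 0 < ε → ∀ᶠ z in 𝓝 x, f x + inner ℝ v (z - x) - ε * ‖z - x‖ ≤ f z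

/-- `v` is a limiting subgradient of `f` at `x`. -/
def IsLimitingSubgradient (f : E → ℝ) (x v : E) : Prop :=
  ∃ (xs vs : ℕ → E), Tendsto xs atTop (𝓝 x) ∧ Tendsto (fun k => f (xs k)) atTop (𝓝 (f x)) ∧
    Tendsto vs atTop (𝓝 v) ∧ ∀ k, IsFrechetSubgradient f (xs k) (vs k)

/-- `x` is a stationary (critical) point of `f`: `0 ∈ ∂f(x)` for the limiting subdifferential. -/
def IsStationaryPoint (f : E → ℝ) (x : E) : Prop :=
  IsLimitingSubgradient f x 0

end Stationary

/-! ### Generalized linear tensor model -/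

/-- `exp ((y θ - ψ θ) / w)` is, for every natural parameter `θ`, a probability density in `y`
with respect to the base measure `ν`; so `ψ` is the cumulant function of the exponential family
and `w` its dispersion. -/
def IsExponentialFamily (ψ : ℝ → ℝ) (w : ℝ) (ν : Measure ℝ) : Prop :=
  ∀ θ : ℝ, ∫⁻ y, ENNReal.ofReal (Real.exp ((y * θ - ψ θ) / w)) ∂ν = 1

/-- The joint law of `(X, y)` when `X ∼ P` and, given `X`, the response `y` has density
`exp ((y ⟨X, B₀⟩ - ψ ⟨X, B₀⟩) / w)` with respect to `ν`. -/
def glmLaw {d d₃ : ℕ} (P : Measure (Tensor d d₃)) (ν : Measure ℝ) (ψ : ℝ → ℝ) (w : ℝ)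
    (B₀ : Tensor d d₃) : Measure (Tensor d d₃ × ℝ) :=
  (P.prod ν).withDensity fun p =>
    ENNReal.ofReal (Real.exp ((p.2 * inner ℝ p.1 B₀ - ψ (inner ℝ p.1 B₀)) / w))

/-- The empirical risk
`Lₙ(B) = (1/n) ∑ᵢ (-yᵢ ⟨Xᵢ, B⟩ + ψ ⟨Xᵢ, B⟩)`. -/
def empiricalRisk {d d₃ n : ℕ} (ψ : ℝ → ℝ) (X : Fin n → Tensor d d₃) (y : Fin n → ℝ)
    (B : Tensor d d₃) : ℝ :=
  (1 / (n : ℝ)) * ∑ i : Fin n, (-(y i) * inner ℝ (X i) B + ψ (inner ℝ (X i) B))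

/-- The prediction error `⟨f'(B) - f'(B₀), B - B₀⟩` of an empirical risk `f`. -/
def predictionError {d d₃ : ℕ} (f : Tensor d d₃ → ℝ) (B B₀ : Tensor d d₃) : ℝ :=
  inner ℝ (gradient f B - gradient f B₀) (B - B₀)

/-- The expected Hessian `H(B) = 𝔼[ψ''(⟨X, B⟩) vec(X) vec(X)ᵀ]`, `X ∼ P`. -/
def expectedHessian {d d₃ : ℕ} (P : Measure (Tensor d d₃)) (ψ : ℝ → ℝ) (B : Tensor d d₃) :
    Matrix (Fin d × Fin d × Fin d₃) (Fin d × Fin d × Fin d₃) ℝ :=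
  Matrix.of fun a b => ∫ x, iteratedDeriv 2 ψ (inner ℝ x B) * (x a * x b) ∂P

/-- The smallest eigenvalue of a real symmetric matrix. -/
def smallestEigenvalue {ι : Type*} [Fintype ι] [DecidableEq ι] (A : Matrix ι ι ℝ) : ℝ :=
  sInf (spectrum ℝ A)

/-! ### Sub-Gaussian predictors -/

/-- The Orlicz norm `‖f‖_{ψ₂} = inf {t > 0 : 𝔼 exp(f²/t²) ≤ 2}`, equal to `∞` if there is no
such `t`. -/
def psi2Norm {Ω : Type*} [MeasurableSpace Ω] (P : Measure Ω) (f : Ω → ℝ) : ℝ≥0∞ :=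
  ⨅ (t : ℝ) (_ : 0 < t ∧ ∫⁻ ω, ENNReal.ofReal (Real.exp (f ω ^ 2 / t ^ 2)) ∂P ≤ 2),
    ENNReal.ofReal t

/-- The law `P` of a random tensor is sub-Gaussian with parameter `K`: every one-dimensional
marginal `⟨X, U⟩` with `‖U‖_F ≤ 1` has `ψ₂`-norm at most `K`. -/
def IsSubGaussian {d d₃ : ℕ} (P : Measure (Tensor d d₃)) (K : ℝ) : Prop :=
  ∀ U : Tensor d d₃, ‖U‖ ≤ 1 → psi2Norm P (fun x => inner ℝ x U) ≤ ENNReal.ofReal K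

end TubalGLM

end

/-! Write `Δ = B̂ - B⁰`, `a = λ C_{ρ'}` and `κ = (2K)²`. The bounds come from squeezing the
prediction error at a stationary point between an upper and a lower bound, both valid on one event
of large probability.

Upper bound (`predictionError_le_of_isStationaryPoint`). Spectral functions of even convex functions
are convex, so the regularizer plus `μ/2 ‖·‖²` is convex, and stationarity yields a basic inequality
with loss `μ/2 ‖Δ‖²`. The noise term `-⟨Lₙ'(B⁰), Δ⟩` is at most `a/16` times the nuclear norm of
`Δ`: exponential tilting makes the responses conditionally sub-Gaussian, and it suffices to test the
gradient on a dictionary of `d₃ 625^d` tensors whose convex hull contains a quarter of the nuclear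
norm ball (`exists_dictionary`, `mem_convexHull_of_nuclearNorm_le`).

Lower bound (`le_predictionError`). The prediction error is at least `(Λ - Λ₀/4) ‖Δ‖²` minus `a/16`
times the nuclear norm. If the nuclear norm exceeds `R ‖Δ‖`, the right side is nonpositive and
monotonicity of `ψ'` suffices. Otherwise `Δ/‖Δ‖` lies in `4R` times the hull of the dictionary, and
the empirical curvature must be bounded below uniformly there. Maurey's argument replaces the
direction by an average of `k` atoms (`le_empiricalCurvature_of_forall_average`), so that a union
bound over the `k`-tuples of atoms is enough. With `k` of order `n/d` and `R` of order `√(n/(d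
d₃))`, both the union bound and the requirement `R λ ≳ β` can be met.

Combination (`error_bounds`). With `r` the tubal rank of `B⁰`, Weyl's inequality shows that the
penalty of `B̂` beyond row `r` dominates that of `Δ` beyond row `2r`, so only `O(r)` rows count
against the quadratic term; this gives the Frobenius bound. The penalty may flatten, hence the
nuclear bound compares `ρ` with the chord slope `ρ(t)/t` at `t = ‖Δ‖/√r`, which cancels from both
sides. -/

noncomputable section

namespace TubalGLM

/-! ### Singular values of endomorphisms of a finite-dimensional complex inner product space -/

section SingularValues

variable {E : Type*} [NormedAddCommGroup E] [InnerProductSpace ℂ E] [FiniteDimensional ℂ E]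
  {d : ℕ}

/-- Singular value decomposition. -/
theorem exists_svd (hd : Module.finrank ℂ E = d) (T : E →ₗ[ℂ] E) :
    ∃ u v : OrthonormalBasis (Fin d) ℂ E,
      ∀ i, T (v i) = ((T.singularValues i : ℝ) : ℂ) • u i := by
  set v := T.isSymmetric_adjoint_comp_self.eigenvectorBasis hd with hv
  have hTv : ∀ i j, inner ℂ (T (v i)) (T (v j)) =
      (((T.singularValues j : ℝ) : ℂ)) ^ 2 * inner ℂ (v i) (v j) := by
    intro i j
    have h := T.isSymmetric_adjoint_comp_self.apply_eigenvectorBasis hd j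
    rw [← LinearMap.adjoint_inner_right T]
    have h' : T.adjoint (T (v j)) = ((T.singularValues j : ℝ) ^ 2 : ℂ) • v j := by
      have := T.sq_singularValues_fin hd j
      rw [← Complex.ofReal_pow, this]
      exact h
    rw [h', inner_smul_right]
  -- Eigenvectors of `T* T` have orthogonal images; normalising the nonzero ones and extending gives
  -- the left singular basis.
  set s : Set (Fin d) := {i | T.singularValues i ≠ 0} with hs
  set w : Fin d → E := fun i => (((T.singularValues i : ℝ) : ℂ))⁻¹ • T (v i) with hw
  have horth : Orthonormal ℂ (s.domRestrict w) := by
    rw [orthonormal_iff_ite]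
    rintro ⟨i, hi⟩ ⟨j, hj⟩
    have hi' : ((T.singularValues i : ℝ) : ℂ) ≠ 0 := by exact_mod_cast hi
    have hj' : ((T.singularValues j : ℝ) : ℂ) ≠ 0 := by exact_mod_cast hj
    simp only [Set.domRestrict_apply, hw, inner_smul_left, inner_smul_right, hTv,
      orthonormal_iff_ite.mp v.orthonormal, Subtype.mk.injEq]
    split_ifs with h
    · subst h
      simp only [map_inv₀, Complex.conj_ofReal, mul_one]
      field_simp
    · simp
  obtain ⟨u, hu⟩ := horth.exists_orthonormalBasis_extension_of_card_eq (by simpa using hd)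
  refine ⟨u, v, fun i => ?_⟩
  by_cases hi : T.singularValues i = 0
  · have := hTv i i
    rw [hi] at this
    simp only [Complex.ofReal_zero, ne_eq, OfNat.ofNat_ne_zero, not_false_eq_true, zero_pow,
      zero_mul, inner_self_eq_zero] at this
    rw [this, hi]; simp
  · have hi' : ((T.singularValues i : ℝ) : ℂ) ≠ 0 := by exact_mod_cast hi
    rw [hu i hi, hw]
    simp only [smul_smul]
    rw [mul_inv_cancel₀ hi', one_smul]

theorem svd_apply {T : E →ₗ[ℂ] E} {u v : OrthonormalBasis (Fin d) ℂ E}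
    (h : ∀ i, T (v i) = ((T.singularValues i : ℝ) : ℂ) • u i) (x : E) :
    T x = ∑ i, (inner ℂ (v i) x * ((T.singularValues i : ℝ) : ℂ)) • u i := by
  conv_lhs => rw [← v.sum_repr' x, map_sum]
  exact Finset.sum_congr rfl fun i _ => by rw [map_smul, h, smul_smul]

theorem svd_norm_sq {T : E →ₗ[ℂ] E} {u v : OrthonormalBasis (Fin d) ℂ E}
    (h : ∀ i, T (v i) = ((T.singularValues i : ℝ) : ℂ) • u i) (x : E) :
    ‖T x‖ ^ 2 = ∑ i : Fin d, T.singularValues i ^ 2 * ‖(inner ℂ (v i) x : ℂ)‖ ^ 2 := by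
  rw [← u.sum_sq_norm_inner_right]
  refine Finset.sum_congr rfl fun i _ => ?_
  rw [svd_apply h, u.orthonormal.inner_right_fintype]
  simp [mul_pow, mul_comm]

/-- The Hilbert–Schmidt norm in terms of the singular values. -/
theorem sum_norm_sq_eq (hd : Module.finrank ℂ E = d) (T : E →ₗ[ℂ] E)
    (e : OrthonormalBasis (Fin d) ℂ E) :
    ∑ i, ‖T (e i)‖ ^ 2 = ∑ i : Fin d, T.singularValues i ^ 2 := by
  obtain ⟨u, v, h⟩ := exists_svd hd T
  simp_rw [svd_norm_sq h]
  rw [Finset.sum_comm]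
  refine Finset.sum_congr rfl fun i _ => ?_
  rw [← Finset.mul_sum, e.sum_sq_norm_inner_left]
  simp

/-- The average of the two unistochastic matrices attached to a pair of orthonormal bases. -/
def overlap (x u y v : OrthonormalBasis (Fin d) ℂ E) : Matrix (Fin d) (Fin d) ℝ :=
  Matrix.of fun i k => (‖(inner ℂ (x i) (u k) : ℂ)‖ ^ 2 + ‖(inner ℂ (v k) (y i) : ℂ)‖ ^ 2) / 2

theorem overlap_mem {F : Type*} [NormedAddCommGroup F] [InnerProductSpace ℂ F]
    (x u y v : OrthonormalBasis (Fin d) ℂ F) :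
    overlap x u y v ∈ doublyStochastic ℝ (Fin d) := by
  rw [mem_doublyStochastic_iff_sum]
  refine ⟨fun i j => ?_, fun i => ?_, fun j => ?_⟩
  · simp only [overlap, Matrix.of_apply]; positivity
  · simp only [overlap, Matrix.of_apply]
    rw [← Finset.sum_div, Finset.sum_add_distrib, u.sum_sq_norm_inner_left,
      v.sum_sq_norm_inner_right]
    simp
  · simp only [overlap, Matrix.of_apply]
    rw [← Finset.sum_div, Finset.sum_add_distrib, x.sum_sq_norm_inner_right,
      y.sum_sq_norm_inner_left]
    simp

/-- The AM–GM inequality turns each product of two overlaps into half the sum of their squares,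
which makes the weights doubly stochastic. This is the common source of the majorization and trace
inequalities below. -/
theorem norm_inner_le_overlap {T : E →ₗ[ℂ] E} {u v : OrthonormalBasis (Fin d) ℂ E}
    (h : ∀ i, T (v i) = ((T.singularValues i : ℝ) : ℂ) • u i)
    (x y : OrthonormalBasis (Fin d) ℂ E) (i : Fin d) :
    ‖(inner ℂ (x i) (T (y i)) : ℂ)‖ ≤ ∑ k, overlap x u y v i k * T.singularValues k := by
  rw [svd_apply h, inner_sum]
  refine (norm_sum_le _ _).trans (Finset.sum_le_sum fun k _ => ?_)
  have h0 := T.singularValues_nonneg k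
  simp only [inner_smul_right, norm_mul, Complex.norm_real, Real.norm_eq_abs, abs_of_nonneg h0,
    overlap, Matrix.of_apply]
  nlinarith [two_mul_le_add_sq ‖(inner ℂ (x i) (u k) : ℂ)‖ ‖(inner ℂ (v k) (y i) : ℂ)‖]

/-- An even convex function on the line is monotone on the half-line. -/
theorem monotoneOn_of_even_convex {q : ℝ → ℝ} (hq : ConvexOn ℝ Set.univ q)
    (heven : ∀ x, q (-x) = q x) : MonotoneOn q (Set.Ici 0) := by
  intro x hx y hy hxy
  rcases eq_or_lt_of_le (show (0 : ℝ) ≤ y from hy) with h0 | h0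
  · have : x = y := le_antisymm hxy (by rw [← h0]; exact hx)
    rw [this]
  have hx' : (0 : ℝ) ≤ x := hx
  have := hq.2 (Set.mem_univ (-y)) (Set.mem_univ y)
    (show 0 ≤ (1 - x / y) / 2 by
      have : x / y ≤ 1 := by rw [div_le_one h0]; exact hxy
      linarith) (show 0 ≤ (1 + x / y) / 2 by positivity) (by ring)
  rw [heven] at this
  simp only [smul_eq_mul] at this
  have e1 : (1 - x / y) / 2 * -y + (1 + x / y) / 2 * y = x := by field_simp; ring
  rw [e1] at this
  linarith

/-- By `norm_inner_le_overlap` the diagonal entries are dominated by doubly stochastic averages of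
the singular values. Row sums equal to one give Jensen, column sums equal to one collapse the double
sum. -/
theorem sum_diag_le (hd : Module.finrank ℂ E = d) {q : ℝ → ℝ} (hq : ConvexOn ℝ Set.univ q)
    (heven : ∀ x, q (-x) = q x) (T : E →ₗ[ℂ] E) (x y : OrthonormalBasis (Fin d) ℂ E) :
    ∑ i, q ‖(inner ℂ (x i) (T (y i)) : ℂ)‖ ≤ ∑ i : Fin d, q (T.singularValues i) := by
  obtain ⟨u, v, h⟩ := exists_svd hd T
  have hW := mem_doublyStochastic_iff_sum.mp (overlap_mem x u y v)
  calc ∑ i, q ‖(inner ℂ (x i) (T (y i)) : ℂ)‖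
      ≤ ∑ i, ∑ k : Fin d, overlap x u y v i k * q (T.singularValues k) := by
        refine Finset.sum_le_sum fun i _ => ?_
        refine (monotoneOn_of_even_convex hq heven (norm_nonneg _)
          ((norm_nonneg _).trans (norm_inner_le_overlap h x y i))
          (norm_inner_le_overlap h x y i)).trans ?_
        have := hq.map_sum_le (t := Finset.univ) (w := fun k => overlap x u y v i k)
          (p := fun k : Fin d => T.singularValues k) (fun k _ => hW.1 i k) (hW.2.1 i)
          (fun _ _ => Set.mem_univ _)
        simpa using this
    _ = ∑ k : Fin d, q (T.singularValues k) := by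
        rw [Finset.sum_comm]
        refine Finset.sum_congr rfl fun k _ => ?_
        rw [← Finset.sum_mul, hW.2.2 k, one_mul]

/-- Spectral functions generated by an even convex function are convex. -/
theorem convexOn_sum_singularValues (hd : Module.finrank ℂ E = d) {q : ℝ → ℝ}
    (hq : ConvexOn ℝ Set.univ q) (heven : ∀ x, q (-x) = q x) :
    ConvexOn ℝ Set.univ fun T : E →ₗ[ℂ] E => ∑ i : Fin d, q (T.singularValues i) := by
  refine ⟨convex_univ, fun A _ B _ a b ha hb hab => ?_⟩
  set M : E →ₗ[ℂ] E := a • A + b • B with hM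
  obtain ⟨u, v, h⟩ := exists_svd hd M
  -- In the singular bases of the combination `M` its singular values are diagonal entries, and
  -- these are linear in `M`; `sum_diag_le` then handles `A` and `B` separately.
  have key : ∀ i : Fin d, q (M.singularValues i) ≤
      a * q ‖(inner ℂ (u i) (A (v i)) : ℂ)‖ + b * q ‖(inner ℂ (u i) (B (v i)) : ℂ)‖ := by
    intro i
    have h1 : (M.singularValues i : ℝ) ≤
        a * ‖(inner ℂ (u i) (A (v i)) : ℂ)‖ + b * ‖(inner ℂ (u i) (B (v i)) : ℂ)‖ := by
      have h2 : (inner ℂ (u i) (M (v i)) : ℂ) = ((M.singularValues i : ℝ) : ℂ) := by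
        rw [h i, inner_smul_right, inner_self_eq_norm_sq_to_K, u.norm_eq_one]; simp
      have h3 : (inner ℂ (u i) (M (v i)) : ℂ) =
          (a : ℂ) * inner ℂ (u i) (A (v i)) + (b : ℂ) * inner ℂ (u i) (B (v i)) := by
        simp only [hM, LinearMap.add_apply, LinearMap.smul_apply, inner_add_right,
          inner_smul_right_eq_smul, Complex.real_smul]
      calc (M.singularValues i : ℝ) = ‖(inner ℂ (u i) (M (v i)) : ℂ)‖ := by
            rw [h2, Complex.norm_real, Real.norm_eq_abs, abs_of_nonneg (M.singularValues_nonneg i)]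
        _ ≤ _ := by
            rw [h3]
            refine (norm_add_le _ _).trans ?_
            simp [abs_of_nonneg ha, abs_of_nonneg hb]
    have h0 : (0 : ℝ) ≤ M.singularValues i := M.singularValues_nonneg i
    refine (monotoneOn_of_even_convex hq heven h0 (h0.trans h1) h1).trans ?_
    simpa using hq.2 (Set.mem_univ ‖(inner ℂ (u i) (A (v i)) : ℂ)‖)
      (Set.mem_univ ‖(inner ℂ (u i) (B (v i)) : ℂ)‖) ha hb hab
  calc ∑ i : Fin d, q (M.singularValues i)
      ≤ a * ∑ i, q ‖(inner ℂ (u i) (A (v i)) : ℂ)‖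
        + b * ∑ i, q ‖(inner ℂ (u i) (B (v i)) : ℂ)‖ := by
        rw [Finset.mul_sum, Finset.mul_sum, ← Finset.sum_add_distrib]
        exact Finset.sum_le_sum fun i _ => key i
    _ ≤ _ := by
        exact add_le_add (mul_le_mul_of_nonneg_left (sum_diag_le hd hq heven A u v) ha)
          (mul_le_mul_of_nonneg_left (sum_diag_le hd hq heven B u v) hb)

/-- Birkhoff's theorem reduces to permutation matrices, for which this is the rearrangement
inequality. -/
theorem sum_doublyStochastic_le {W : Matrix (Fin d) (Fin d) ℝ}
    (hW : W ∈ doublyStochastic ℝ (Fin d)) {f g : Fin d → ℝ} (hf : Antitone f) (hg : Antitone g) :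
    ∑ i, f i * ∑ k, W i k * g k ≤ ∑ i, f i * g i := by
  obtain ⟨w, hw0, hw1, rfl⟩ := exists_eq_sum_perm_of_mem_doublyStochastic hW
  have hfg : Monovary f g := hf.monovary hg
  calc ∑ i, f i * ∑ k, (∑ τ : Equiv.Perm (Fin d), w τ • τ.permMatrix ℝ) i k * g k
      = ∑ τ : Equiv.Perm (Fin d), w τ * ∑ i, f i * g (τ i) := by
        simp only [Matrix.sum_apply, Matrix.smul_apply, smul_eq_mul, Finset.sum_mul,
          Finset.mul_sum]
        have : ∀ i : Fin d, (∑ k, ∑ τ : Equiv.Perm (Fin d),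
            f i * (w τ * τ.permMatrix ℝ i k * g k)) =
            ∑ τ : Equiv.Perm (Fin d), w τ * (f i * g (τ i)) := by
          intro i
          rw [Finset.sum_comm]
          refine Finset.sum_congr rfl fun τ _ => ?_
          rw [Finset.sum_eq_single (τ i)]
          · simp [Equiv.toPEquiv_apply, PEquiv.toMatrix_apply]; ring
          · intro k _ hk
            simp [Equiv.toPEquiv_apply, PEquiv.toMatrix_apply, Ne.symm hk]
          · simp
        simp_rw [this]
        rw [Finset.sum_comm]
    _ ≤ ∑ τ : Equiv.Perm (Fin d), w τ * ∑ i, f i * g i := by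
        refine Finset.sum_le_sum fun τ _ => mul_le_mul_of_nonneg_left ?_ (hw0 τ)
        exact hfg.sum_mul_comp_perm_le_sum_mul
    _ = _ := by rw [← Finset.sum_mul, hw1, one_mul]

/-- The Hoffman–Wielandt inequality for singular values. -/
theorem sum_sq_sub_singularValues_le (hd : Module.finrank ℂ E = d) (A B : E →ₗ[ℂ] E) :
    ∑ i : Fin d, (A.singularValues i - B.singularValues i) ^ 2 ≤
      ∑ i : Fin d, (A - B).singularValues i ^ 2 := by
  obtain ⟨u, v, h⟩ := exists_svd hd A
  obtain ⟨u', v', h'⟩ := exists_svd hd B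
  rw [← sum_norm_sq_eq hd (A - B) v]
  -- Von Neumann's trace inequality, in the singular bases of `A`; it is the only loss when `‖(A -
  -- B) vᵢ‖²` is expanded.
  have hcross : ∑ i : Fin d, A.singularValues i * ‖(inner ℂ (u i) (B (v i)) : ℂ)‖ ≤
      ∑ i : Fin d, A.singularValues i * B.singularValues i := by
    refine le_trans (Finset.sum_le_sum fun i _ => mul_le_mul_of_nonneg_left
      (norm_inner_le_overlap h' u v i) (A.singularValues_nonneg i)) ?_
    exact sum_doublyStochastic_le (overlap_mem u u' v v')
      (f := fun i : Fin d => A.singularValues i) (g := fun i : Fin d => B.singularValues i)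
      (fun i j hij => A.singularValues_antitone hij)
      (fun i j hij => B.singularValues_antitone hij)
  have hB := sum_norm_sq_eq hd B v
  have key : ∀ i : Fin d, A.singularValues i ^ 2
      - 2 * (A.singularValues i * ‖(inner ℂ (u i) (B (v i)) : ℂ)‖) + ‖B (v i)‖ ^ 2 ≤
      ‖(A - B) (v i)‖ ^ 2 := by
    intro i
    have h0 := A.singularValues_nonneg i
    rw [LinearMap.sub_apply, @norm_sub_sq ℂ, h i, inner_smul_left, norm_smul, u.norm_eq_one]
    simp only [Complex.conj_ofReal, Complex.norm_real, Real.norm_eq_abs, abs_of_nonneg h0, mul_one]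
    have : RCLike.re (((A.singularValues i : ℝ) : ℂ) * inner ℂ (u i) (B (v i))) ≤
        A.singularValues i * ‖(inner ℂ (u i) (B (v i)) : ℂ)‖ := by
      refine (RCLike.re_le_norm _).trans ?_
      simp [abs_of_nonneg h0]
    linarith
  refine le_trans ?_ (Finset.sum_le_sum fun i _ => key i)
  rw [Finset.sum_add_distrib, Finset.sum_sub_distrib, ← Finset.mul_sum, hB]
  have : ∑ i : Fin d, (A.singularValues i - B.singularValues i) ^ 2 =
      ∑ i : Fin d, A.singularValues i ^ 2 - 2 * ∑ i : Fin d, A.singularValues i * B.singularValues i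
        + ∑ i : Fin d, B.singularValues i ^ 2 := by
    rw [Finset.mul_sum, ← Finset.sum_sub_distrib, ← Finset.sum_add_distrib]
    exact Finset.sum_congr rfl fun i _ => by ring
  rw [this]
  linarith

/-- Duality between the operator norm and the nuclear norm. -/
theorem re_sum_inner_le (hd : Module.finrank ℂ E = d) (G D : E →ₗ[ℂ] E)
    (e : OrthonormalBasis (Fin d) ℂ E) {g : ℝ} (hg : ∀ x, ‖x‖ = 1 → ‖G x‖ ≤ g) :
    ∑ i, (inner ℂ (G (e i)) (D (e i)) : ℂ).re ≤ g * ∑ i : Fin d, D.singularValues i := by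
  obtain ⟨u, v, h⟩ := exists_svd hd D
  -- Polarisation shows that the Hilbert–Schmidt product does not depend on the basis, so it may be
  -- computed in the right singular basis of `D`.
  have pol : ∀ f : OrthonormalBasis (Fin d) ℂ E, 2 * ∑ i, (inner ℂ (G (f i)) (D (f i)) : ℂ).re =
      ∑ i : Fin d, (G + D).singularValues i ^ 2 - ∑ i : Fin d, G.singularValues i ^ 2
        - ∑ i : Fin d, D.singularValues i ^ 2 := by
    intro f
    rw [← sum_norm_sq_eq hd _ f, ← sum_norm_sq_eq hd _ f, ← sum_norm_sq_eq hd _ f,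
      ← Finset.sum_sub_distrib, ← Finset.sum_sub_distrib, Finset.mul_sum]
    refine Finset.sum_congr rfl fun i _ => ?_
    rw [LinearMap.add_apply, @norm_add_sq ℂ, RCLike.re_eq_complex_re]
    ring
  have heq : ∑ i, (inner ℂ (G (e i)) (D (e i)) : ℂ).re =
      ∑ i, (inner ℂ (G (v i)) (D (v i)) : ℂ).re := by
    have := pol e; have := pol v; linarith
  rw [heq, Finset.mul_sum]
  refine Finset.sum_le_sum fun i _ => ?_
  have h0 := D.singularValues_nonneg i
  rw [h i, inner_smul_right, Complex.re_ofReal_mul, mul_comm]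
  refine mul_le_mul_of_nonneg_right ?_ h0
  calc _ ≤ ‖(inner ℂ (G (v i)) (u i) : ℂ)‖ := Complex.re_le_norm _
    _ ≤ ‖G (v i)‖ * ‖u i‖ := norm_inner_le_norm _ _
    _ ≤ g := by rw [u.norm_eq_one, mul_one]; exact hg _ (v.norm_eq_one i)

/-- Weyl's inequality for a perturbation of low rank. -/
theorem singularValues_add_le_of_rank_sub_le (T S : E →ₗ[ℂ] E) {r : ℕ}
    (hr : Module.finrank ℂ (LinearMap.range (T - S)) ≤ r) (i : ℕ) :
    T.singularValues (i + r) ≤ S.singularValues i := by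
  by_cases hi : Module.finrank ℂ E ≤ i + r
  · rw [T.singularValues_of_finrank_le hi]; exact S.singularValues_nonneg i
  push Not at hi
  obtain ⟨d, hd⟩ : ∃ d, Module.finrank ℂ E = d := ⟨_, rfl⟩
  rw [hd] at hi
  obtain ⟨u, v, h⟩ := exists_svd hd T
  obtain ⟨u', v', h'⟩ := exists_svd hd S
  let emb : Fin (i + r + 1) → Fin d := fun k => ⟨k, by omega⟩
  let emb' : Fin i → Fin d := fun k => ⟨k, by omega⟩
  have hemb : Function.Injective emb := fun a b hab => by
    simpa [emb, Fin.ext_iff] using hab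
  let Φ : (Fin (i + r + 1) → ℂ) →ₗ[ℂ] E := Fintype.linearCombination ℂ fun k => v (emb k)
  -- Dimension count: among combinations of the top `i + r + 1` right singular vectors of `T`, at
  -- most `r + i` conditions are imposed, namely `T = S` and orthogonality to the top `i` right
  -- singular vectors of `S`. A nonzero solution compares the two singular values.
  let Ψ : (Fin (i + r + 1) → ℂ) →ₗ[ℂ] LinearMap.range (T - S) × (Fin i → ℂ) :=
    LinearMap.prod ((T - S).rangeRestrict ∘ₗ Φ)
      (LinearMap.pi fun l => (innerₛₗ ℂ (v' (emb' l))) ∘ₗ Φ)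
  have hker : LinearMap.ker Ψ ≠ ⊥ := by
    apply LinearMap.ker_ne_bot_of_finrank_lt
    simp only [Module.finrank_prod, Module.finrank_fintype_fun_eq_card, Fintype.card_fin]
    omega
  obtain ⟨c, hc, hc0⟩ := Submodule.exists_mem_ne_zero_of_ne_bot hker
  have hc' : Ψ c = 0 := hc
  have h1 : (T - S) (Φ c) = 0 := by
    have := congrArg Prod.fst hc'
    simpa [Ψ, Subtype.ext_iff] using this
  have h2 : ∀ l, (inner ℂ (v' (emb' l)) (Φ c) : ℂ) = 0 := by
    intro l
    have := congrFun (congrArg Prod.snd hc') l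
    simpa [Ψ] using this
  have hΦ : Φ c = ∑ k, c k • v (emb k) := by simp [Φ, Fintype.linearCombination_apply]
  have hne : Φ c ≠ 0 := by
    intro h0
    apply hc0
    have hli : LinearIndependent ℂ fun k => v (emb k) :=
      v.orthonormal.linearIndependent.comp emb hemb
    rw [hΦ] at h0
    funext k
    exact (Fintype.linearIndependent_iff.mp hli) c h0 k
  have hTS : T (Φ c) = S (Φ c) := by
    rw [LinearMap.sub_apply, sub_eq_zero] at h1; exact h1
  have hlow : T.singularValues (i + r) ^ 2 * ‖Φ c‖ ^ 2 ≤ ‖T (Φ c)‖ ^ 2 := by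
    rw [svd_norm_sq h, ← v.sum_sq_norm_inner_right (Φ c), Finset.mul_sum]
    refine Finset.sum_le_sum fun k _ => ?_
    by_cases hk : (k : ℕ) ≤ i + r
    · have := T.singularValues_antitone hk
      have := T.singularValues_nonneg (i + r)
      gcongr
    · have : (inner ℂ (v k) (Φ c) : ℂ) = 0 := by
        rw [hΦ, inner_sum]
        refine Finset.sum_eq_zero fun l _ => ?_
        rw [inner_smul_right, orthonormal_iff_ite.mp v.orthonormal, if_neg, mul_zero]
        intro hkl
        apply hk
        rw [hkl]
        simp only [emb]; omega
      simp [this]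
  have hup : ‖S (Φ c)‖ ^ 2 ≤ S.singularValues i ^ 2 * ‖Φ c‖ ^ 2 := by
    rw [svd_norm_sq h', ← v'.sum_sq_norm_inner_right (Φ c), Finset.mul_sum]
    refine Finset.sum_le_sum fun k _ => ?_
    by_cases hk : i ≤ (k : ℕ)
    · have := S.singularValues_antitone hk
      have := S.singularValues_nonneg k
      gcongr
    · have : (inner ℂ (v' k) (Φ c) : ℂ) = 0 := h2 ⟨k, by omega⟩
      simp [this]
  rw [hTS] at hlow
  have hpos : 0 < ‖Φ c‖ ^ 2 := by positivity
  have := le_of_mul_le_mul_right (hlow.trans hup) hpos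
  exact (sq_le_sq₀ (T.singularValues_nonneg _) (S.singularValues_nonneg i)).mp this

end SingularValues

/-! ### Fourier slices of tensors -/

section Slices

variable {d d₃ : ℕ}

theorem fourierSlice_add (S T : Tensor d d₃) (j : Fin d₃) :
    fourierSlice (S + T) j = fourierSlice S j + fourierSlice T j := by
  ext a b
  simp [fourierSlice, mul_add, Finset.sum_add_distrib]

theorem fourierSlice_smul (c : ℝ) (T : Tensor d d₃) (j : Fin d₃) :
    fourierSlice (c • T) j = c • fourierSlice T j := by
  ext a b
  simp only [fourierSlice, Matrix.of_apply, Matrix.smul_apply, Finset.smul_sum, PiLp.smul_apply,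
    smul_eq_mul, Complex.ofReal_mul, Complex.real_smul]
  exact Finset.sum_congr rfl fun k _ => by ring

/-- The `j`-th Fourier slice as an endomorphism of `ℂᵈ`, depending linearly on the tensor. -/
def sliceMap (j : Fin d₃) :
    Tensor d d₃ →ₗ[ℝ] (EuclideanSpace ℂ (Fin d) →ₗ[ℂ] EuclideanSpace ℂ (Fin d)) where
  toFun T := Matrix.toEuclideanLin (fourierSlice T j)
  map_add' S T := by rw [fourierSlice_add, map_add]
  map_smul' c T := by
    rw [fourierSlice_smul, RingHom.id_apply]
    ext x
    simp [Matrix.toEuclideanLin, Matrix.toLpLin_apply, Matrix.smul_mulVec]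

theorem tensorSingularValue_eq (T : Tensor d d₃) (i : Fin d) (j : Fin d₃) :
    tensorSingularValue T i j = (sliceMap j T).singularValues i := rfl

theorem tensorSingularValue_nonneg (T : Tensor d d₃) (i : Fin d) (j : Fin d₃) :
    0 ≤ tensorSingularValue T i j := LinearMap.singularValues_nonneg _ _

/-- Orthogonality of characters: a geometric sum over a `d₃`-th root of unity. -/
theorem sum_exp_eq (k l : Fin d₃) :
    ∑ j : Fin d₃, (starRingEnd ℂ)
        (Complex.exp (-2 * Real.pi * Complex.I * ((j : ℕ) : ℂ) * ((k : ℕ) : ℂ) / (d₃ : ℂ))) *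
      Complex.exp (-2 * Real.pi * Complex.I * ((j : ℕ) : ℂ) * ((l : ℕ) : ℂ) / (d₃ : ℂ)) =
    if k = l then (d₃ : ℂ) else 0 := by
  have hd : (d₃ : ℂ) ≠ 0 := by
    have := k.pos
    exact_mod_cast this.ne'
  set z : ℂ := Complex.exp (2 * Real.pi * Complex.I * (((k : ℕ) : ℂ) - ((l : ℕ) : ℂ)) / d₃) with hz
  have hterm : ∀ j : Fin d₃, (starRingEnd ℂ)
        (Complex.exp (-2 * Real.pi * Complex.I * ((j : ℕ) : ℂ) * ((k : ℕ) : ℂ) / (d₃ : ℂ))) *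
      Complex.exp (-2 * Real.pi * Complex.I * ((j : ℕ) : ℂ) * ((l : ℕ) : ℂ) / (d₃ : ℂ)) =
      z ^ (j : ℕ) := by
    intro j
    rw [hz, ← Complex.exp_nat_mul, ← Complex.exp_conj, ← Complex.exp_add]
    congr 1
    simp only [map_div₀, map_mul, map_neg, Complex.conj_I, Complex.conj_ofReal, map_natCast,
      map_ofNat]
    ring
  simp_rw [hterm]
  rw [Fin.sum_univ_eq_sum_range (fun j => z ^ j)]
  split_ifs with h
  · have : z = 1 := by rw [hz, h]; simp
    simp [this]
  · have hz1 : z ≠ 1 := by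
      intro h1
      rw [hz, Complex.exp_eq_one_iff] at h1
      obtain ⟨n, hn⟩ := h1
      have hpi : (2 * Real.pi * Complex.I : ℂ) ≠ 0 := Complex.two_pi_I_ne_zero
      have h2 : ((k : ℕ) : ℂ) - ((l : ℕ) : ℂ) = n * d₃ := by
        rw [div_eq_iff hd] at hn
        apply mul_left_cancel₀ hpi
        rw [hn]; ring
      have h3 : ((k : ℕ) : ℤ) - ((l : ℕ) : ℤ) = n * d₃ := by exact_mod_cast h2
      apply h
      have hk := k.isLt
      have hl := l.isLt
      have : n = 0 := by
        by_contra hn0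
        rcases lt_or_gt_of_ne hn0 with h' | h'
        · nlinarith
        · nlinarith
      rw [this] at h3
      ext; omega
    have hzd : z ^ d₃ = 1 := by
      rw [hz, ← Complex.exp_nat_mul, Complex.exp_eq_one_iff]
      refine ⟨((k : ℕ) : ℤ) - ((l : ℕ) : ℤ), ?_⟩
      push_cast
      field_simp
    rw [geom_sum_eq hz1, hzd]; simp

theorem sliceMap_basisFun_apply (T : Tensor d d₃) (j : Fin d₃) (a b : Fin d) :
    sliceMap j T (EuclideanSpace.basisFun (Fin d) ℂ b) a = fourierSlice T j a b := by
  simp [sliceMap, Matrix.toEuclideanLin, Matrix.toLpLin_apply]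

/-- Parseval's identity for the Fourier transform along the third mode. -/
theorem sum_inner_sliceMap (G D : Tensor d d₃) :
    ∑ j, ∑ b, (inner ℂ (sliceMap j G (EuclideanSpace.basisFun (Fin d) ℂ b))
      (sliceMap j D (EuclideanSpace.basisFun (Fin d) ℂ b)) : ℂ).re = d₃ * inner ℝ G D := by
  have key : ∀ a b : Fin d, ∑ j, (starRingEnd ℂ) (fourierSlice G j a b) * fourierSlice D j a b =
      ((d₃ * ∑ k, G (a, b, k) * D (a, b, k) : ℝ) : ℂ) := by
    intro a b
    simp only [fourierSlice, Matrix.of_apply, map_sum, map_mul, Complex.conj_ofReal,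
      Finset.sum_mul_sum]
    rw [Finset.sum_comm]
    have h1 : ∀ k : Fin d₃, (∑ j : Fin d₃, ∑ l : Fin d₃, (starRingEnd ℂ)
        (Complex.exp (-2 * Real.pi * Complex.I * ((j : ℕ) : ℂ) * ((k : ℕ) : ℂ) / (d₃ : ℂ))) *
          ((G (a, b, k) : ℝ) : ℂ) *
      (Complex.exp (-2 * Real.pi * Complex.I * ((j : ℕ) : ℂ) * ((l : ℕ) : ℂ) / (d₃ : ℂ)) *
          ((D (a, b, l) : ℝ) : ℂ))) = d₃ * (G (a, b, k) * D (a, b, k)) := by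
      intro k
      rw [Finset.sum_comm]
      have h2 : ∀ l : Fin d₃, (∑ j : Fin d₃, (starRingEnd ℂ)
          (Complex.exp (-2 * Real.pi * Complex.I * ((j : ℕ) : ℂ) * ((k : ℕ) : ℂ) / (d₃ : ℂ))) *
            ((G (a, b, k) : ℝ) : ℂ) *
        (Complex.exp (-2 * Real.pi * Complex.I * ((j : ℕ) : ℂ) * ((l : ℕ) : ℂ) / (d₃ : ℂ)) *
            ((D (a, b, l) : ℝ) : ℂ))) =
          (if k = l then (d₃ : ℂ) else 0) * (G (a, b, k) * D (a, b, l)) := by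
        intro l
        rw [← sum_exp_eq, Finset.sum_mul]
        exact Finset.sum_congr rfl fun j _ => by ring
      simp_rw [h2]
      simp
    rw [Finset.sum_congr rfl fun k _ => h1 k, ← Finset.mul_sum]
    push_cast
    rfl
  have h1 : ∀ (j : Fin d₃) (b : Fin d),
      (inner ℂ (sliceMap j G (EuclideanSpace.basisFun (Fin d) ℂ b))
      (sliceMap j D (EuclideanSpace.basisFun (Fin d) ℂ b)) : ℂ).re =
      ∑ a, ((starRingEnd ℂ) (fourierSlice G j a b) * fourierSlice D j a b).re := by
    intro j b
    rw [PiLp.inner_apply, Complex.re_sum]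
    refine Finset.sum_congr rfl fun a _ => ?_
    rw [sliceMap_basisFun_apply, sliceMap_basisFun_apply, RCLike.inner_apply, mul_comm]
  simp_rw [h1]
  rw [PiLp.inner_apply, Fintype.sum_prod_type, Finset.mul_sum, Finset.sum_comm]
  have h2 : ∀ b : Fin d, ∑ j : Fin d₃, ∑ a, ((starRingEnd ℂ) (fourierSlice G j a b) *
      fourierSlice D j a b).re = ∑ a, d₃ * ∑ k, G (a, b, k) * D (a, b, k) := by
    intro b
    rw [Finset.sum_comm]
    refine Finset.sum_congr rfl fun a _ => ?_
    rw [← Complex.re_sum, key, Complex.ofReal_re]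
  simp_rw [h2]
  rw [Finset.sum_comm]
  refine Finset.sum_congr rfl fun a _ => ?_
  rw [Fintype.sum_prod_type, Finset.mul_sum]
  refine Finset.sum_congr rfl fun b _ => ?_
  congr 1
  exact Finset.sum_congr rfl fun k _ => by simp [mul_comm]

theorem finrank_euclidean : Module.finrank ℂ (EuclideanSpace ℂ (Fin d)) = d := by simp

/-- The Frobenius norm in terms of the singular values of the Fourier slices. -/
theorem sum_sq_tensorSingularValue (T : Tensor d d₃) :
    ∑ i, ∑ j, tensorSingularValue T i j ^ 2 = d₃ * ‖T‖ ^ 2 := by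
  rw [← real_inner_self_eq_norm_sq, ← sum_inner_sliceMap, Finset.sum_comm]
  refine Finset.sum_congr rfl fun j _ => ?_
  simp_rw [tensorSingularValue_eq]
  rw [← sum_norm_sq_eq finrank_euclidean _ (EuclideanSpace.basisFun (Fin d) ℂ)]
  refine Finset.sum_congr rfl fun b _ => ?_
  rw [inner_self_eq_norm_sq_to_K]
  norm_cast

theorem sum_sq_sub_tensorSingularValue_le (S T : Tensor d d₃) :
    ∑ i, ∑ j, (tensorSingularValue S i j - tensorSingularValue T i j) ^ 2 ≤ d₃ * ‖S - T‖ ^ 2 := by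
  rw [← sum_sq_tensorSingularValue, Finset.sum_comm,
    Finset.sum_comm (f := fun i j => tensorSingularValue (S - T) i j ^ 2)]
  refine Finset.sum_le_sum fun j _ => ?_
  have h := sum_sq_sub_singularValues_le finrank_euclidean (sliceMap j S) (sliceMap j T)
  rw [← map_sub] at h
  exact h

theorem inner_le_of_forall_norm_le (G D : Tensor d d₃) {g : ℝ}
    (hg : ∀ j, ∀ x : EuclideanSpace ℂ (Fin d), ‖x‖ = 1 → ‖sliceMap j G x‖ ≤ g) :
    inner ℝ G D ≤ g * nuclearNorm D := by
  rcases Nat.eq_zero_or_pos d₃ with h0 | h0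
  · subst h0
    simp [nuclearNorm, PiLp.inner_apply]
  have h0' : (0 : ℝ) < d₃ := by exact_mod_cast h0
  have h1 : d₃ * inner ℝ G D ≤ g * ∑ i, ∑ j, tensorSingularValue D i j := by
    rw [← sum_inner_sliceMap, Finset.sum_comm (γ := Fin d) (α := Fin d₃), Finset.mul_sum]
    refine Finset.sum_le_sum fun j _ => ?_
    exact re_sum_inner_le finrank_euclidean _ _ _ (hg j)
  rw [nuclearNorm, one_div, ← mul_assoc, mul_comm g, mul_assoc, ← div_eq_inv_mul,
    le_div_iff₀ h0', mul_comm]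
  exact h1

/-- Spectral regularizers generated by weakly convex functions are weakly convex. -/
theorem convexOn_regularizer {ρ : ℝ → ℝ} {μ : ℝ} (hd₃ : 1 ≤ d₃) (heven : ∀ x, ρ (-x) = ρ x)
    (hρ : ConvexOn ℝ Set.univ fun x => ρ x + μ / 2 * x ^ 2) :
    ConvexOn ℝ Set.univ fun T : Tensor d d₃ => regularizer ρ T + μ / 2 * ‖T‖ ^ 2 := by
  have h0' : (0 : ℝ) < d₃ := by exact_mod_cast hd₃
  have h1 : (fun T : Tensor d d₃ => regularizer ρ T + μ / 2 * ‖T‖ ^ 2) =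
      fun T : Tensor d d₃ => (1 / (d₃ : ℝ)) • ∑ j, ∑ i : Fin d,
        (ρ ((sliceMap j T).singularValues i) + μ / 2 * (sliceMap j T).singularValues i ^ 2) := by
    funext T
    have := sum_sq_tensorSingularValue T
    simp only [regularizer, smul_eq_mul, Finset.sum_add_distrib, ← Finset.mul_sum,
      ← tensorSingularValue_eq]
    rw [Finset.sum_comm (γ := Fin d₃), Finset.sum_comm (γ := Fin d₃), this]
    field_simp
  rw [h1]
  refine ConvexOn.smul (by positivity) ?_
  have h2 : ∀ j : Fin d₃, ConvexOn ℝ Set.univ fun T : Tensor d d₃ => ∑ i : Fin d,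
      (ρ ((sliceMap j T).singularValues i) + μ / 2 * (sliceMap j T).singularValues i ^ 2) := by
    intro j
    refine ⟨convex_univ, fun A _ B _ a b ha hb hab => ?_⟩
    have := (convexOn_sum_singularValues (E := EuclideanSpace ℂ (Fin d)) finrank_euclidean hρ
      (fun x => by simp [heven])).2 (Set.mem_univ (sliceMap j A)) (Set.mem_univ (sliceMap j B))
      ha hb hab
    rw [← map_smul, ← map_smul, ← map_add] at this
    exact this
  refine ⟨convex_univ, fun A _ B _ a b ha hb hab => ?_⟩
  simp only [smul_eq_mul, Finset.mul_sum]
  rw [← Finset.sum_add_distrib]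
  refine Finset.sum_le_sum fun j _ => ?_
  have := (h2 j).2 (Set.mem_univ A) (Set.mem_univ B) ha hb hab
  simpa [Finset.mul_sum] using this

theorem tensorSingularValue_antitone (T : Tensor d d₃) (j : Fin d₃) {i i' : Fin d} (h : i ≤ i') :
    tensorSingularValue T i' j ≤ tensorSingularValue T i j :=
  LinearMap.singularValues_antitone _ h

theorem tensorSingularValue_eq_zero_of_tubalRank_le (T : Tensor d d₃) (i : Fin d) (j : Fin d₃)
    (h : tubalRank T ≤ i) : tensorSingularValue T i j = 0 := by
  by_contra hne
  have hsub : Set.Iic i ⊆ {i : Fin d | ∃ j : Fin d₃, tensorSingularValue T i j ≠ 0} := by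
    intro k hk
    refine ⟨j, fun h0 => hne ?_⟩
    exact le_antisymm (h0 ▸ tensorSingularValue_antitone T j hk) (tensorSingularValue_nonneg T i j)
  have := Set.ncard_le_ncard hsub (Set.toFinite _)
  rw [Set.ncard_eq_toFinset_card', Set.toFinset_Iic, Fin.card_Iic] at this
  unfold tubalRank at h
  omega

theorem finrank_range_sliceMap_le (T : Tensor d d₃) (j : Fin d₃) :
    Module.finrank ℂ (LinearMap.range (sliceMap j T)) ≤ tubalRank T := by
  rw [← LinearMap.singularValues_eq_zero_iff_le_finrank_range]
  by_cases h : tubalRank T < d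
  · exact tensorSingularValue_eq_zero_of_tubalRank_le T ⟨tubalRank T, h⟩ j le_rfl
  · exact LinearMap.singularValues_of_finrank_le _ (by rw [finrank_euclidean]; omega)

/-- Weyl's inequality applies slicewise because every Fourier slice of `B₀` has rank at most its
tubal rank. -/
theorem tensorSingularValue_sub_le (B B₀ : Tensor d d₃) (j : Fin d₃) (i : Fin d)
    (h : (i : ℕ) + tubalRank B₀ < d) :
    tensorSingularValue (B - B₀) ⟨i + tubalRank B₀, h⟩ j ≤ tensorSingularValue B i j := by
  refine singularValues_add_le_of_rank_sub_le (sliceMap j (B - B₀)) (sliceMap j B) ?_ i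
  rw [map_sub, sub_sub_cancel_left, LinearMap.range_neg]
  exact finrank_range_sliceMap_le B₀ j

theorem nuclearNorm_nonneg (T : Tensor d d₃) : 0 ≤ nuclearNorm T := by
  unfold nuclearNorm
  have := fun i j => tensorSingularValue_nonneg T i j
  exact mul_nonneg (by positivity) (Finset.sum_nonneg fun i _ => Finset.sum_nonneg fun j _ => this i j)

end Slices

/-! ### A finite dictionary generating the nuclear norm ball -/

section Dictionary

variable {d d₃ : ℕ}

/-- A maximal 1-separated subset of the ball of radius 2, scaled by one half. The packing bound is
`5` to the real dimension `2d`. -/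
theorem exists_finset_half_net (d : ℕ) : ∃ N : Finset (EuclideanSpace ℂ (Fin d)),
    N.card ≤ 25 ^ d ∧ (∀ x ∈ N, ‖x‖ ≤ 1) ∧ ∀ x, ‖x‖ ≤ 1 → ∃ y ∈ N, ‖x - y‖ ≤ 1 / 2 := by
  classical
  set p : ℕ → Prop := fun m => ∃ s : Finset (EuclideanSpace ℂ (Fin d)), s.card = m ∧
    (∀ x ∈ s, ‖x‖ ≤ 2) ∧ ∀ x ∈ s, ∀ y ∈ s, x ≠ y → 1 ≤ ‖x - y‖ with hp
  have hbound : ∀ m, p m → m ≤ 25 ^ d := by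
    rintro m ⟨s, rfl, h1, h2⟩
    have := Besicovitch.card_le_of_separated s h1 h2
    rw [finrank_real_of_complex, finrank_euclidean, pow_mul] at this
    simpa using this
  have hex : p (Nat.findGreatest p (25 ^ d)) :=
    Nat.findGreatest_spec (m := 0) (Nat.zero_le _) ⟨∅, by simp⟩
  obtain ⟨s, hs, h1, h2⟩ := hex
  refine ⟨s.image fun x => (1 / 2 : ℝ) • x, ?_, ?_, ?_⟩
  · exact Finset.card_image_le.trans (hs ▸ Nat.findGreatest_le _)
  · intro x hx
    obtain ⟨y, hy, rfl⟩ := Finset.mem_image.mp hx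
    rw [norm_smul, Real.norm_eq_abs, abs_of_pos (by norm_num : (0 : ℝ) < 1 / 2)]
    linarith [h1 y hy]
  · intro x hx
    by_contra! hcon
    have hfar : ∀ y ∈ s, 1 ≤ ‖(2 : ℝ) • x - y‖ := by
      intro y hy
      have := hcon _ (Finset.mem_image_of_mem _ hy)
      have h3 : (2 : ℝ) • x - y = (2 : ℝ) • (x - (1 / 2 : ℝ) • y) := by
        rw [smul_sub, smul_smul]; norm_num
      rw [h3, norm_smul, Real.norm_eq_abs, abs_of_pos (by norm_num : (0 : ℝ) < 2)]
      linarith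
    have hnot : (2 : ℝ) • x ∉ s := by
      intro hmem
      have := hfar _ hmem
      simp at this
      linarith
    have hp' : p (s.card + 1) := by
      refine ⟨insert ((2 : ℝ) • x) s, Finset.card_insert_of_notMem hnot, ?_, ?_⟩
      · intro y hy
        rcases Finset.mem_insert.mp hy with rfl | hy
        · rw [norm_smul, Real.norm_eq_abs, abs_of_pos (by norm_num : (0 : ℝ) < 2)]; linarith
        · exact h1 y hy
      · intro y hy z hz hyz
        rcases Finset.mem_insert.mp hy with rfl | hy <;> rcases Finset.mem_insert.mp hz with rfl | hz
        · exact absurd rfl hyz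
        · exact hfar z hz
        · rw [norm_sub_rev]; exact hfar y hy
        · exact h2 y hy z hz hyz
    have := Nat.le_findGreatest (hbound _ hp') hp'
    omega

/-- The tensor representing the functional `G ↦ Re ⟨v, G̃⁽ʲ⁾ u⟩`. -/
def atom (j : Fin d₃) (u v : EuclideanSpace ℂ (Fin d)) : Tensor d d₃ :=
  WithLp.toLp 2 fun x => ((starRingEnd ℂ) (v x.1) *
    (Complex.exp (-2 * Real.pi * Complex.I * ((j : ℕ) : ℂ) * ((x.2.2 : ℕ) : ℂ) / (d₃ : ℂ)) *
      u x.2.1)).re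

theorem inner_atom (G : Tensor d d₃) (j : Fin d₃) (u v : EuclideanSpace ℂ (Fin d)) :
    inner ℝ G (atom j u v) = (inner ℂ v (sliceMap j G u) : ℂ).re := by
  have h1 : ∀ a, sliceMap j G u a = ∑ b, fourierSlice G j a b * u b := by
    intro a
    simp [sliceMap, Matrix.toEuclideanLin, Matrix.toLpLin_apply, Matrix.mulVec, dotProduct]
  rw [PiLp.inner_apply, PiLp.inner_apply, Fintype.sum_prod_type, Complex.re_sum]
  refine Finset.sum_congr rfl fun a _ => ?_
  rw [RCLike.inner_apply, h1, Finset.sum_mul, Complex.re_sum, Fintype.sum_prod_type]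
  refine Finset.sum_congr rfl fun b _ => ?_
  simp only [fourierSlice, Matrix.of_apply]
  rw [Finset.sum_mul, Finset.sum_mul, Complex.re_sum]
  refine Finset.sum_congr rfl fun k _ => ?_
  simp only [atom, RCLike.inner_apply, conj_trivial]
  rw [mul_comm, ← Complex.re_ofReal_mul]
  congr 1
  ring

theorem norm_atom_sq_le (j : Fin d₃) (u v : EuclideanSpace ℂ (Fin d)) :
    ‖atom j u v‖ ^ 2 ≤ d₃ * (‖v‖ ^ 2 * ‖u‖ ^ 2) := by
  rw [EuclideanSpace.norm_sq_eq, EuclideanSpace.norm_sq_eq v, EuclideanSpace.norm_sq_eq u,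
    Finset.sum_mul_sum, Finset.mul_sum, Fintype.sum_prod_type]
  refine Finset.sum_le_sum fun a _ => ?_
  rw [Finset.mul_sum, Fintype.sum_prod_type]
  refine Finset.sum_le_sum fun b _ => ?_
  have : ∀ k : Fin d₃, ‖atom j u v (a, b, k)‖ ^ 2 ≤ ‖v a‖ ^ 2 * ‖u b‖ ^ 2 := by
    intro k
    rw [← mul_pow]
    refine pow_le_pow_left₀ (norm_nonneg _) ?_ 2
    simp only [atom]
    rw [Real.norm_eq_abs]
    refine (Complex.abs_re_le_norm _).trans ?_
    have he : ‖Complex.exp (-2 * Real.pi * Complex.I * ((j : ℕ) : ℂ) * ((k : ℕ) : ℂ) /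
        (d₃ : ℂ))‖ = 1 := by
      have : -2 * Real.pi * Complex.I * ((j : ℕ) : ℂ) * ((k : ℕ) : ℂ) / (d₃ : ℂ) =
          ((-2 * Real.pi * (j : ℕ) * (k : ℕ) / d₃ : ℝ) : ℂ) * Complex.I := by
        push_cast; ring
      rw [this, Complex.norm_exp_ofReal_mul_I]
    rw [norm_mul, norm_mul, he, RCLike.norm_conj, one_mul]
  calc _ ≤ ∑ _k : Fin d₃, ‖v a‖ ^ 2 * ‖u b‖ ^ 2 := Finset.sum_le_sum fun k _ => this k
    _ = _ := by simp

/-- The atoms run over a frequency and a pair of net points, whence `d₃ · 25^d · 25^d`. Each of the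
two half-nets costs a factor 2 in the operator norm of a slice, and operator–nuclear duality gives
the constant 4. -/
theorem exists_dictionary (d d₃ : ℕ) : ∃ 𝒜 : Finset (Tensor d d₃),
    (1 ≤ d₃ → 𝒜.Nonempty) ∧ 𝒜.card ≤ d₃ * 625 ^ d ∧ (∀ a ∈ 𝒜, ‖a‖ ^ 2 ≤ d₃) ∧
    ∀ (G D : Tensor d d₃) (α : ℝ), (∀ a ∈ 𝒜, inner ℝ G a ≤ α) →
      inner ℝ G D ≤ 4 * α * nuclearNorm D := by
  classical
  obtain ⟨N, hcard, hN1, hN⟩ := exists_finset_half_net d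
  refine ⟨(Finset.univ ×ˢ N ×ˢ N).image fun x : Fin d₃ × _ × _ => atom x.1 x.2.1 x.2.2,
    ?_, ?_, ?_, ?_⟩
  · intro h
    obtain ⟨y, hy, -⟩ := hN 0 (by simp)
    exact ⟨_, Finset.mem_image_of_mem _ (show ((⟨0, h⟩ : Fin d₃), y, y) ∈ _ by simp [hy])⟩
  · refine Finset.card_image_le.trans ?_
    rw [Finset.card_product, Finset.card_product, Finset.card_univ, Fintype.card_fin]
    refine Nat.mul_le_mul le_rfl ((Nat.mul_le_mul hcard hcard).trans ?_)
    rw [← mul_pow]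
    norm_num
  · intro a ha
    obtain ⟨⟨j, u, v⟩, hx, rfl⟩ := Finset.mem_image.mp ha
    simp only [Finset.mem_product, Finset.mem_univ, true_and] at hx
    refine (norm_atom_sq_le j u v).trans ?_
    have h1 : ‖v‖ ^ 2 ≤ 1 := pow_le_one₀ (norm_nonneg _) (hN1 v hx.2)
    have h2 : ‖u‖ ^ 2 ≤ 1 := pow_le_one₀ (norm_nonneg _) (hN1 u hx.1)
    have h3 : ‖v‖ ^ 2 * ‖u‖ ^ 2 ≤ 1 := mul_le_one₀ h1 (by positivity) h2
    exact mul_le_of_le_one_right (by positivity) h3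
  · intro G D α hα
    refine inner_le_of_forall_norm_le G D fun j x hx => ?_
    have hα' : ∀ u ∈ N, ∀ v ∈ N, (inner ℂ v (sliceMap j G u) : ℂ).re ≤ α := by
      intro u hu v hv
      rw [← inner_atom]
      exact hα _ (Finset.mem_image_of_mem (fun x : Fin d₃ × _ × _ => atom x.1 x.2.1 x.2.2)
        (show (j, u, v) ∈ _ by simp [hu, hv]))
    have hu2 : ∀ u ∈ N, ‖sliceMap j G u‖ ≤ 2 * α := by
      intro u hu
      set w := sliceMap j G u with hw
      obtain ⟨v, hv, hvw⟩ := hN (((‖w‖⁻¹ : ℝ) : ℂ) • w) (by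
        rw [norm_smul, Complex.norm_real, norm_inv, norm_norm]
        exact inv_mul_le_one)
      have h1 := hα' u hu v hv
      rw [← hw] at h1
      have h2 : (inner ℂ (((‖w‖⁻¹ : ℝ) : ℂ) • w) w : ℂ).re = ‖w‖ := by
        rw [inner_smul_left, inner_self_eq_norm_sq_to_K, Complex.conj_ofReal]
        rcases eq_or_ne ‖w‖ 0 with h0 | h0
        · simp [h0]
        · rw [Complex.re_ofReal_mul]
          rw [show ((RCLike.ofReal ‖w‖ : ℂ) ^ 2).re = ‖w‖ ^ 2 by norm_cast]
          field_simp
      have h3 : (inner ℂ (((‖w‖⁻¹ : ℝ) : ℂ) • w - v) w : ℂ).re ≤ 1 / 2 * ‖w‖ :=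
        (Complex.re_le_norm _).trans ((norm_inner_le_norm _ _).trans
          (mul_le_mul_of_nonneg_right hvw (norm_nonneg _)))
      rw [inner_sub_left, Complex.sub_re, h2] at h3
      linarith
    set T := (sliceMap j G).toContinuousLinearMap with hT
    have hall : ∀ x, ‖x‖ ≤ 1 → ‖T x‖ ≤ 2 * α + ‖T‖ / 2 := by
      intro x hx
      obtain ⟨y, hy, hxy⟩ := hN x hx
      have h1 : T x = T y + T (x - y) := by rw [← map_add]; congr 1; abel
      rw [h1]
      refine (norm_add_le _ _).trans (add_le_add (hu2 y hy) ?_)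
      refine (T.le_opNorm _).trans ?_
      have := mul_le_mul_of_nonneg_left hxy (norm_nonneg T)
      linarith
    have h0 : 0 ≤ 2 * α + ‖T‖ / 2 := (norm_nonneg _).trans (hall 0 (by simp))
    have hS : ‖T‖ ≤ 2 * α + ‖T‖ / 2 := by
      refine T.opNorm_le_bound h0 fun z => ?_
      rcases eq_or_ne z 0 with rfl | hz
      · simp
      · have hz' : 0 < ‖z‖ := norm_pos_iff.mpr hz
        have := hall (((‖z‖⁻¹ : ℝ) : ℂ) • z) (by
          rw [norm_smul, Complex.norm_real, norm_inv, norm_norm, inv_mul_cancel₀ hz'.ne'])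
        rw [map_smul, norm_smul, Complex.norm_real, norm_inv, norm_norm] at this
        rwa [inv_mul_le_iff₀ hz', mul_comm] at this
    have := hall x hx.le
    change ‖T x‖ ≤ _
    linarith

/-- Hahn–Banach: a functional separating the point from the hull would contradict the dual estimate
satisfied by the dictionary. -/
theorem mem_convexHull_of_nuclearNorm_le {𝒜 : Finset (Tensor d d₃)}
    (h𝒜 : ∀ (G D : Tensor d d₃) (α : ℝ), (∀ a ∈ 𝒜, inner ℝ G a ≤ α) →
      inner ℝ G D ≤ 4 * α * nuclearNorm D) {D : Tensor d d₃} {R : ℝ} (hR : 0 < R)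
    (hD : nuclearNorm D ≤ R) (hne : 𝒜.Nonempty) :
    (4 * R)⁻¹ • D ∈ convexHull ℝ (𝒜 : Set (Tensor d d₃)) := by
  by_contra hnot
  obtain ⟨f, α, h1, h2⟩ := geometric_hahn_banach_closed_point (convex_convexHull ℝ (𝒜 : Set (Tensor d d₃)))
    (𝒜.finite_toSet.isClosed_convexHull ℝ) hnot
  set G := (InnerProductSpace.toDual ℝ (Tensor d d₃)).symm f with hG
  have hf : ∀ x, f x = inner ℝ G x := fun x => by
    rw [hG, InnerProductSpace.toDual_symm_apply]
  have hα : ∀ a ∈ 𝒜, inner ℝ G a ≤ α := fun a ha =>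
    (hf a ▸ h1 a (subset_convexHull ℝ _ ha)).le
  have h3 := h𝒜 G D α hα
  rw [hf, inner_smul_right] at h2
  -- The sign of `α` is needed to replace the nuclear norm of `D` by `R`; a negative `α` would force
  -- `G = 0`, on which every atom pairs to zero.
  have hα0 : 0 ≤ α := by
    by_contra hneg
    push Not at hneg
    obtain ⟨a, ha⟩ := hne
    have h4 := h𝒜 G G α hα
    rw [real_inner_self_eq_norm_sq] at h4
    have h5 : ‖G‖ ^ 2 ≤ 0 := h4.trans
      (mul_nonpos_of_nonpos_of_nonneg (by linarith) (nuclearNorm_nonneg G))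
    have h6 : G = 0 := by
      rw [← norm_eq_zero]; exact pow_eq_zero_iff two_ne_zero |>.mp (le_antisymm h5 (by positivity))
    have := hα a ha
    rw [h6, inner_zero_left] at this
    linarith
  have h9 : inner ℝ G D ≤ 4 * α * R := h3.trans (by gcongr)
  have : (4 * R)⁻¹ * inner ℝ G D ≤ (4 * R)⁻¹ * (4 * α * R) := by gcongr
  have h10 : (4 * R)⁻¹ * (4 * α * R) = α := by field_simp
  linarith

end Dictionary

/-! ### The univariate penalty -/

section Penalty

variable {ρ : ℝ → ℝ} {lam Cρ μ : ℝ}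

theorem IsPenalty.nonneg (h : IsPenalty ρ lam Cρ μ) {x : ℝ} (hx : 0 ≤ x) : 0 ≤ ρ x := by
  have := h.mono (Set.mem_Ici.mpr le_rfl) (Set.mem_Ici.mpr hx) hx
  rwa [h.zero] at this

theorem IsPenalty.subadditive (h : IsPenalty ρ lam Cρ μ) {x y : ℝ} (hx : 0 ≤ x) (hy : 0 ≤ y) :
    ρ (x + y) ≤ ρ x + ρ y := by
  rcases hx.eq_or_lt with rfl | hx
  · simp [h.zero]
  rcases hy.eq_or_lt with rfl | hy
  · simp [h.zero]
  have h1 := h.ratio_antitone (Set.mem_Ioi.mpr hx) (Set.mem_Ioi.mpr (add_pos hx hy))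
    (le_add_of_nonneg_right hy.le)
  have h2 := h.ratio_antitone (Set.mem_Ioi.mpr hy) (Set.mem_Ioi.mpr (add_pos hx hy))
    (le_add_of_nonneg_left hx.le)
  simp only at h1 h2
  rw [le_div_iff₀ hx] at h1
  rw [le_div_iff₀ hy] at h2
  have : ρ (x + y) = ρ (x + y) / (x + y) * x + ρ (x + y) / (x + y) * y := by
    have := (add_pos hx hy).ne'
    field_simp
  linarith

theorem IsPenalty.sub_le (h : IsPenalty ρ lam Cρ μ) {x y : ℝ} (hx : 0 ≤ x) (hy : 0 ≤ y) :
    ρ x - ρ y ≤ ρ |x - y| := by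
  rcases le_total x y with hxy | hxy
  · have := h.mono (Set.mem_Ici.mpr hx) (Set.mem_Ici.mpr hy) hxy
    have := h.nonneg (abs_nonneg (x - y))
    linarith
  · rw [abs_of_nonneg (sub_nonneg.mpr hxy)]
    have := h.subadditive hy (sub_nonneg.mpr hxy)
    rw [add_sub_cancel] at this
    linarith

/-- The limit of the derivative at `0+` is the right derivative at `0`. Monotone ratios then give
the tangent as an upper bound, and weak convexity gives it as a lower bound up to `μ/2 x²`. -/
theorem IsPenalty.tendsto_ratio (h : IsPenalty ρ lam Cρ μ) :
    Tendsto (fun s => ρ s / s) (𝓝[>] 0) (𝓝 (lam * Cρ)) := by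
  have h1 : HasDerivWithinAt ρ (lam * Cρ) (Set.Ici 0) 0 :=
    hasDerivWithinAt_Ici_of_tendsto_deriv (s := Set.Ioi 0)
      (fun t ht => (h.differentiable t (ne_of_gt ht)).differentiableWithinAt)
      h.continuous.continuousWithinAt self_mem_nhdsWithin h.slope_zero
  rw [hasDerivWithinAt_iff_tendsto_slope] at h1
  have h2 : Set.Ici (0 : ℝ) \ {0} = Set.Ioi 0 := by
    ext x; simp [lt_iff_le_and_ne, eq_comm]
  rw [h2] at h1
  refine h1.congr fun s => ?_
  rw [slope_def_field, h.zero, sub_zero, sub_zero]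

theorem IsPenalty.le_mul (h : IsPenalty ρ lam Cρ μ) {x : ℝ} (hx : 0 ≤ x) :
    ρ x ≤ lam * Cρ * x := by
  rcases hx.eq_or_lt with rfl | hx
  · simp [h.zero]
  rw [← div_le_iff₀ hx]
  refine ge_of_tendsto h.tendsto_ratio ?_
  filter_upwards [Ioc_mem_nhdsGT hx] with s hs
  exact h.ratio_antitone hs.1 hx hs.2

theorem IsPenalty.mul_le (h : IsPenalty ρ lam Cρ μ) {x : ℝ} (hx : 0 ≤ x) :
    lam * Cρ * x ≤ ρ x + μ / 2 * x ^ 2 := by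
  rcases hx.eq_or_lt with rfl | hx
  · simp [h.zero]
  rw [← le_div_iff₀ hx]
  have h1 : Tendsto (fun s => ρ s / s + μ / 2 * s) (𝓝[>] 0) (𝓝 (lam * Cρ + μ / 2 * 0)) :=
    h.tendsto_ratio.add ((tendsto_id.mono_left nhdsWithin_le_nhds).const_mul _)
  rw [mul_zero, add_zero] at h1
  refine le_of_tendsto h1 ?_
  filter_upwards [Ioc_mem_nhdsGT hx] with s hs
  have h2 := h.weakly_convex.2 (Set.mem_univ x) (Set.mem_univ 0) (show 0 ≤ s / x by
    have := hs.1; positivity) (show 0 ≤ 1 - s / x by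
      rw [sub_nonneg, div_le_one hx]; exact hs.2) (by ring)
  simp only [smul_eq_mul, mul_zero, add_zero, h.zero, ne_eq, OfNat.ofNat_ne_zero,
    not_false_eq_true, zero_pow] at h2
  have h3 : s / x * x = s := by field_simp
  rw [h3] at h2
  have hs0 := hs.1
  have h4 : ρ s / s + μ / 2 * s = (ρ s + μ / 2 * s ^ 2) / s := by field_simp
  rw [h4, div_le_iff₀ hs0]
  calc _ ≤ _ := h2
    _ = _ := by ring

/-- With `IsPenalty.ratio_mul_le`, this compares `ρ` with a line of slope `ρ t / t` in place of the
slope at zero, which a flattening penalty does not keep. The scale `t` is chosen in `error_bounds`.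
-/
theorem IsPenalty.le_ratio_mul (h : IsPenalty ρ lam Cρ μ) {t x : ℝ} (ht : 0 < t) (hx : 0 ≤ x) :
    ρ x ≤ ρ t / t * (t + x) := by
  have h0 : 0 ≤ ρ t / t := div_nonneg (h.nonneg ht.le) ht.le
  rcases le_total x t with hxt | hxt
  · have h1 := h.mono (Set.mem_Ici.mpr hx) (Set.mem_Ici.mpr ht.le) hxt
    have h2 : ρ t / t * t = ρ t := by field_simp
    nlinarith [mul_nonneg h0 hx]
  · have hx' : 0 < x := ht.trans_le hxt
    have h1 := h.ratio_antitone (Set.mem_Ioi.mpr ht) (Set.mem_Ioi.mpr hx') hxt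
    simp only at h1
    rw [div_le_iff₀ hx'] at h1
    nlinarith [mul_nonneg h0 ht.le]

theorem IsPenalty.ratio_mul_le (h : IsPenalty ρ lam Cρ μ) {t x : ℝ} (ht : 0 < t) (hx : 0 ≤ x) :
    ρ t / t * (x - x ^ 2 / t) ≤ ρ x := by
  have h0 : 0 ≤ ρ t / t := div_nonneg (h.nonneg ht.le) ht.le
  rcases hx.eq_or_lt with rfl | hx'
  · simp [h.zero]
  rcases le_total x t with hxt | hxt
  · have h1 := h.ratio_antitone (Set.mem_Ioi.mpr hx') (Set.mem_Ioi.mpr ht) hxt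
    simp only at h1
    rw [le_div_iff₀ hx'] at h1
    have : 0 ≤ x ^ 2 / t := by positivity
    nlinarith [mul_nonneg h0 this]
  · have h1 : x - x ^ 2 / t ≤ 0 := by
      rw [sub_nonpos, le_div_iff₀ ht]; nlinarith
    exact (mul_nonpos_of_nonneg_of_nonpos h0 h1).trans (h.nonneg hx)

end Penalty

/-! ### First-order condition at stationary points of weakly convex composite functions -/

section Stationary

variable {E : Type*} [NormedAddCommGroup E] [InnerProductSpace ℝ E] [CompleteSpace E]

/-- Move from `x` a small step `t` towards `z`: the Fréchet inequality bounds the change from below,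
differentiability of `L` and convexity of `R + μ/2 ‖·‖²` bound it from above. Each of the two
first-order errors is at most `t ε / 2`. -/
theorem inner_le_of_isFrechetSubgradient {L R : E → ℝ} {g x v : E} {μ : ℝ}
    (hL : HasGradientAt L g x) (hR : ConvexOn ℝ Set.univ fun z => R z + μ / 2 * ‖z‖ ^ 2)
    (hv : IsFrechetSubgradient (fun z => L z + R z) x v) (hμ : 0 ≤ μ) (z : E) :
    inner ℝ v (z - x) ≤ inner ℝ g (z - x) + R z - R x + μ / 2 * ‖z - x‖ ^ 2 := by
  refine le_of_forall_pos_le_add fun ε hε => ?_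
  set D := z - x with hD
  set e : ℝ := ε / (2 * (‖D‖ + 1)) with he
  have he0 : 0 < e := by positivity
  have h1 := hv e he0
  have h2 := (hasGradientAt_iff_hasFDerivAt.mp hL).isLittleO.def he0
  have hlim : Tendsto (fun t : ℝ => x + t • D) (𝓝[>] 0) (𝓝 x) := by
    have : Continuous fun t : ℝ => x + t • D := by fun_prop
    have h := this.tendsto 0
    rw [zero_smul, add_zero] at h
    exact h.mono_left nhdsWithin_le_nhds
  have h3 := (hlim.eventually h1).and ((hlim.eventually h2).and
    (Ioc_mem_nhdsGT (zero_lt_one (α := ℝ))))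
  obtain ⟨t, ht1, ht2, ht0, htle⟩ := h3.exists
  simp only [add_sub_cancel_left] at ht1 ht2
  rw [InnerProductSpace.toDual_apply_apply, norm_smul, Real.norm_eq_abs, Real.norm_eq_abs,
    abs_of_pos ht0, inner_smul_right] at ht2
  rw [norm_smul, Real.norm_eq_abs, abs_of_pos ht0, inner_smul_right] at ht1
  have ht3 := (le_abs_self _).trans ht2
  have ht4 := hR.2 (Set.mem_univ x) (Set.mem_univ z) (show 0 ≤ 1 - t by linarith) ht0.le (by ring)
  simp only [smul_eq_mul] at ht4
  have e1 : (1 - t) • x + t • z = x + t • D := by rw [hD, smul_sub, sub_smul, one_smul]; abel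
  have e2 : z = x + D := by rw [hD]; abel
  rw [e1] at ht4
  have e3 : ‖x + t • D‖ ^ 2 = ‖x‖ ^ 2 + 2 * t * inner ℝ x D + t ^ 2 * ‖D‖ ^ 2 := by
    rw [norm_add_sq_real, inner_smul_right, norm_smul, mul_pow, Real.norm_eq_abs, sq_abs]; ring
  have e4 : ‖z‖ ^ 2 = ‖x‖ ^ 2 + 2 * inner ℝ x D + ‖D‖ ^ 2 := by
    conv_lhs => rw [e2, norm_add_sq_real]
  rw [e3, e4] at ht4
  have h5 : e * ‖D‖ ≤ ε / 2 := by
    rw [he, div_mul_eq_mul_div, div_le_div_iff₀ (by positivity) (by norm_num)]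
    nlinarith [norm_nonneg D]
  have h6 : t * inner ℝ v D ≤ t * (inner ℝ g D + R z - R x + μ / 2 * ‖D‖ ^ 2 + ε) := by
    have h7 : 0 ≤ μ / 2 * (t ^ 2 * ‖D‖ ^ 2) := by positivity
    have h8 : t * (e * ‖D‖) ≤ t * (ε / 2) := mul_le_mul_of_nonneg_left h5 ht0.le
    nlinarith
  exact le_of_mul_le_mul_left h6 ht0

theorem inner_gradient_le_of_isStationaryPoint {L R : E → ℝ} {g : E → E} {x : E} {μ : ℝ}
    (hL : ∀ z, HasGradientAt L (g z) z) (hg : Continuous g)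
    (hR : ConvexOn ℝ Set.univ fun z => R z + μ / 2 * ‖z‖ ^ 2)
    (hx : IsStationaryPoint (fun z => L z + R z) x) (hμ : 0 ≤ μ) (z : E) :
    inner ℝ (g x) (x - z) ≤ R z - R x + μ / 2 * ‖x - z‖ ^ 2 := by
  obtain ⟨xs, vs, h1, h2, h3, h4⟩ := hx
  have hLc : Continuous L := continuous_iff_continuousAt.mpr fun z => (hL z).continuousAt
  -- Convergence of the values of `L + R`, part of the definition of a limiting subgradient,
  -- replaces continuity of `R`.
  have hRx : Tendsto (fun k => R (xs k)) atTop (𝓝 (R x)) := by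
    have := h2.sub ((hLc.tendsto x).comp h1)
    simpa using this
  have hlim1 : Tendsto (fun k => inner ℝ (vs k) (z - xs k)) atTop (𝓝 (inner ℝ (0 : E) (z - x))) :=
    h3.inner (tendsto_const_nhds.sub h1)
  have hlim2 : Tendsto (fun k => inner ℝ (g (xs k)) (z - xs k) + R z - R (xs k)
      + μ / 2 * ‖z - xs k‖ ^ 2) atTop
      (𝓝 (inner ℝ (g x) (z - x) + R z - R x + μ / 2 * ‖z - x‖ ^ 2)) := by
    have ha : Tendsto (fun k => z - xs k) atTop (𝓝 (z - x)) := tendsto_const_nhds.sub h1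
    have hb := ((hg.tendsto x).comp h1).inner (𝕜 := ℝ) ha
    exact ((hb.add_const _).sub hRx).add ((ha.norm.pow 2).const_mul _)
  have := le_of_tendsto_of_tendsto' hlim1 hlim2 fun k =>
    inner_le_of_isFrechetSubgradient (hL _) hR (h4 k) hμ z
  rw [inner_zero_left, ← neg_sub x z, inner_neg_right, norm_neg] at this
  linarith

end Stationary

/-! ### Deterministic error bounds -/

section Deterministic

variable {d d₃ : ℕ}

/-- The contribution of the first `m` rows of an array to its normalised sum. -/
def headMean (m : ℕ) (f : Fin d → Fin d₃ → ℝ) : ℝ :=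
  (1 / (d₃ : ℝ)) * ∑ x : Fin d × Fin d₃ with (x.1 : ℕ) < m, f x.1 x.2

/-- The contribution of the rows from the `m`-th on to the normalised sum of an array. -/
def tailMean (m : ℕ) (f : Fin d → Fin d₃ → ℝ) : ℝ :=
  (1 / (d₃ : ℝ)) * ∑ x : Fin d × Fin d₃ with ¬ (x.1 : ℕ) < m, f x.1 x.2

theorem headMean_add_tailMean (m : ℕ) (f : Fin d → Fin d₃ → ℝ) :
    headMean m f + tailMean m f = (1 / (d₃ : ℝ)) * ∑ i, ∑ j, f i j := by
  rw [headMean, tailMean, ← mul_add, Finset.sum_filter_add_sum_filter_not,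
    Fintype.sum_prod_type]

theorem headMean_mono (m : ℕ) {f g : Fin d → Fin d₃ → ℝ} (h : ∀ i j, f i j ≤ g i j) :
    headMean m f ≤ headMean m g :=
  mul_le_mul_of_nonneg_left (Finset.sum_le_sum fun x _ => h x.1 x.2) (by positivity)

theorem tailMean_mono (m : ℕ) {f g : Fin d → Fin d₃ → ℝ} (h : ∀ i j, f i j ≤ g i j) :
    tailMean m f ≤ tailMean m g :=
  mul_le_mul_of_nonneg_left (Finset.sum_le_sum fun x _ => h x.1 x.2) (by positivity)

theorem headMean_mul (m : ℕ) (a : ℝ) (f : Fin d → Fin d₃ → ℝ) :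
    headMean m (fun i j => a * f i j) = a * headMean m f := by
  rw [headMean, headMean, ← Finset.mul_sum]; ring

theorem card_head_le (m : ℕ) :
    (Finset.univ.filter fun x : Fin d × Fin d₃ => (x.1 : ℕ) < m).card ≤ m * d₃ := by
  have h1 : (Finset.univ.filter fun x : Fin d × Fin d₃ => (x.1 : ℕ) < m) =
      (Finset.univ.filter fun i : Fin d => (i : ℕ) < m) ×ˢ Finset.univ := by
    ext x; simp
  rw [h1, Finset.card_product, Finset.card_univ, Fintype.card_fin]
  refine Nat.mul_le_mul_right _ ?_
  calc _ ≤ (Finset.range m).card := by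
        refine Finset.card_le_card_of_injOn (fun i : Fin d => (i : ℕ)) ?_
          (fun i _ j _ h => Fin.ext h)
        intro i hi
        simpa using hi
    _ = m := Finset.card_range m

theorem headMean_const_le (hd₃ : 1 ≤ d₃) (m : ℕ) {t : ℝ} (ht : 0 ≤ t) :
    headMean (d := d) (d₃ := d₃) m (fun _ _ => t) ≤ m * t := by
  have h0' : (0 : ℝ) < d₃ := by exact_mod_cast hd₃
  have h : ((Finset.univ.filter fun x : Fin d × Fin d₃ => (x.1 : ℕ) < m).card : ℝ) ≤ m * d₃ := by
    exact_mod_cast card_head_le m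
  rw [headMean, Finset.sum_const, nsmul_eq_mul, one_div, inv_mul_le_iff₀ h0']
  nlinarith

theorem headMean_le_sqrt (hd₃ : 1 ≤ d₃) (m : ℕ) {f : Fin d → Fin d₃ → ℝ} {s : ℝ} (hs : 0 ≤ s)
    (hf : ∑ i, ∑ j, f i j ^ 2 ≤ d₃ * s ^ 2) : headMean m f ≤ Real.sqrt m * s := by
  have h0' : (0 : ℝ) < d₃ := by exact_mod_cast hd₃
  have h : ((Finset.univ.filter fun x : Fin d × Fin d₃ => (x.1 : ℕ) < m).card : ℝ) ≤ m * d₃ := by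
    exact_mod_cast card_head_le m
  rw [headMean, one_div, inv_mul_le_iff₀ h0']
  refine le_of_sq_le_sq ?_ (by positivity)
  refine (sq_sum_le_card_mul_sum_sq).trans ?_
  have h2 : ∑ x : Fin d × Fin d₃ with (x.1 : ℕ) < m, f x.1 x.2 ^ 2 ≤ d₃ * s ^ 2 := by
    refine le_trans (Finset.sum_le_sum_of_subset_of_nonneg (Finset.subset_univ _)
      fun x _ _ => sq_nonneg _) ?_
    rwa [Fintype.sum_prod_type]
  rw [mul_pow, mul_pow, Real.sq_sqrt (Nat.cast_nonneg m)]
  calc _ ≤ (m * d₃ : ℝ) * (d₃ * s ^ 2) := by gcongr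
    _ = _ := by ring

/-- Near zero `ρ x ≥ λ C_{ρ'} x - μ/2 x²`, which is positive for `0 < x ≤ λ C_{ρ'}/μ`; monotonicity
does the rest. It allows division by `ρ t / t`. -/
theorem IsPenalty.pos {ρ : ℝ → ℝ} {lam Cρ μ : ℝ} (h : IsPenalty ρ lam Cρ μ)
    (ha : 0 < lam * Cρ) (hμ : 0 < μ) {t : ℝ} (ht : 0 < t) : 0 < ρ t := by
  refine lt_of_le_of_ne (h.nonneg ht.le) fun h0 => ?_
  set x := min t (lam * Cρ / μ) with hx
  have hx0 : 0 < x := lt_min ht (by positivity)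
  have h1 := h.mono (Set.mem_Ici.mpr hx0.le) (Set.mem_Ici.mpr ht.le) (min_le_left _ _)
  have h2 := h.mul_le hx0.le
  have h3 : x ≤ lam * Cρ / μ := min_le_right _ _
  rw [le_div_iff₀ hμ] at h3
  nlinarith

theorem regularizer_eq (ρ : ℝ → ℝ) (T : Tensor d d₃) (m : ℕ) :
    regularizer ρ T = headMean m (fun i j => ρ (tensorSingularValue T i j)) +
      tailMean m (fun i j => ρ (tensorSingularValue T i j)) :=
  (headMean_add_tailMean m _).symm

/-- Shifting the row index down by the tubal rank is injective on the rows from `2r` on and lands in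
the rows from `r` on, where Weyl's inequality compares the entries. -/
theorem tailMean_sub_le {ρ : ℝ → ℝ} {lam Cρ μ : ℝ} (h : IsPenalty ρ lam Cρ μ)
    (B B₀ : Tensor d d₃) :
    tailMean (2 * tubalRank B₀) (fun i j => ρ (tensorSingularValue (B - B₀) i j)) ≤
      tailMean (tubalRank B₀) (fun i j => ρ (tensorSingularValue B i j)) := by
  set r := tubalRank B₀ with hr
  refine mul_le_mul_of_nonneg_left ?_ (by positivity)
  let sh : Fin d × Fin d₃ → Fin d × Fin d₃ :=
    fun x => (⟨(x.1 : ℕ) - r, by have := x.1.isLt; omega⟩, x.2)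
  have hinj : Set.InjOn sh
      (Finset.univ.filter fun x : Fin d × Fin d₃ => ¬ (x.1 : ℕ) < 2 * r : Finset _) := by
    rintro ⟨a, b⟩ hx ⟨a', b'⟩ hy hxy
    simp only [Finset.coe_filter, Finset.mem_univ, true_and, Set.mem_ofPred_eq] at hx hy
    simp only [sh, Prod.mk.injEq, Fin.mk.injEq] at hxy
    refine Prod.ext (Fin.ext ?_) hxy.2
    have := hxy.1
    simp only at this ⊢
    omega
  calc _ ≤ ∑ x : Fin d × Fin d₃ with ¬ (x.1 : ℕ) < 2 * r,
        ρ (tensorSingularValue B (sh x).1 (sh x).2) := by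
        refine Finset.sum_le_sum fun x hx => ?_
        simp only [Finset.mem_filter, Finset.mem_univ, true_and] at hx
        refine h.mono (tensorSingularValue_nonneg _ _ _) (tensorSingularValue_nonneg _ _ _) ?_
        have hlt : ((sh x).1 : ℕ) + tubalRank B₀ < d := by
          have := x.1.isLt; simp only [sh]; omega
        have h1 := tensorSingularValue_sub_le B B₀ x.2 (sh x).1 hlt
        have h2 : (⟨((sh x).1 : ℕ) + tubalRank B₀, hlt⟩ : Fin d) = x.1 := by
          ext; simp only [sh]; omega
        rwa [h2] at h1
    _ = ∑ x ∈ (Finset.univ.filter fun x : Fin d × Fin d₃ => ¬ (x.1 : ℕ) < 2 * r).image sh,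
        ρ (tensorSingularValue B x.1 x.2) := by
        rw [Finset.sum_image hinj]
    _ ≤ _ := by
        refine Finset.sum_le_sum_of_subset_of_nonneg ?_
          fun x _ _ => h.nonneg (tensorSingularValue_nonneg _ _ _)
        intro y hy
        obtain ⟨x, hx, rfl⟩ := Finset.mem_image.mp hy
        simp only [Finset.mem_filter, Finset.mem_univ, true_and, sh] at hx ⊢
        omega

/-- The decomposability step: beyond its tubal rank `B₀` contributes nothing, and on the leading
rows subadditivity of `ρ` bounds the difference. -/
theorem regularizer_sub_le {ρ : ℝ → ℝ} {lam Cρ μ : ℝ} (h : IsPenalty ρ lam Cρ μ)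
    (B B₀ : Tensor d d₃) :
    regularizer ρ B₀ - regularizer ρ B ≤
      headMean (tubalRank B₀)
        (fun i j => ρ |tensorSingularValue B i j - tensorSingularValue B₀ i j|) -
      tailMean (2 * tubalRank B₀) (fun i j => ρ (tensorSingularValue (B - B₀) i j)) := by
  have h1 := tailMean_sub_le h B B₀
  rw [regularizer_eq ρ B₀ (tubalRank B₀), regularizer_eq ρ B (tubalRank B₀)]
  have h2 : tailMean (tubalRank B₀) (fun i j => ρ (tensorSingularValue B₀ i j)) = 0 := by
    rw [tailMean, Finset.sum_eq_zero, mul_zero]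
    intro x hx
    simp only [Finset.mem_filter, Finset.mem_univ, true_and, not_lt] at hx
    rw [tensorSingularValue_eq_zero_of_tubalRank_le B₀ x.1 x.2 hx, h.zero]
  have h3 : headMean (tubalRank B₀) (fun i j => ρ (tensorSingularValue B₀ i j)) ≤
      headMean (tubalRank B₀) (fun i j => ρ (tensorSingularValue B i j)) +
      headMean (tubalRank B₀)
        (fun i j => ρ |tensorSingularValue B i j - tensorSingularValue B₀ i j|) := by
    rw [headMean, headMean, headMean, ← mul_add, ← Finset.sum_add_distrib]
    refine mul_le_mul_of_nonneg_left (Finset.sum_le_sum fun x _ => ?_) (by positivity)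
    have := h.sub_le (tensorSingularValue_nonneg B₀ x.1 x.2) (tensorSingularValue_nonneg B x.1 x.2)
    rw [abs_sub_comm] at this
    linarith
  linarith

theorem nuclearNorm_zero : nuclearNorm (0 : Tensor d d₃) = 0 := by
  have h1 : ∀ i j, tensorSingularValue (0 : Tensor d d₃) i j = 0 := by
    intro i j
    rw [tensorSingularValue_eq, map_zero, LinearMap.singularValues_zero]; rfl
  simp [nuclearNorm, h1]

theorem error_bounds {ρ : ℝ → ℝ} {lam Cρ μ Λ Λ₀ PE : ℝ} (hd₃ : 1 ≤ d₃)
    (h : IsPenalty ρ lam Cρ μ) (hlam : 0 < lam) (hCρ : 0 < Cρ) (hμ : 0 < μ)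
    (hΛ₀ : 3 * μ < 4 * Λ₀) (hΛ : Λ₀ ≤ Λ) (B B₀ : Tensor d d₃) {r : ℕ} (hr : tubalRank B₀ = r)
    (hup : PE ≤ regularizer ρ B₀ - regularizer ρ B + μ / 2 * ‖B - B₀‖ ^ 2 +
      1 / 16 * (lam * Cρ) * nuclearNorm (B - B₀))
    (hlow : (Λ - Λ₀ / 4) * ‖B - B₀‖ ^ 2 - 1 / 16 * (lam * Cρ) * nuclearNorm (B - B₀) ≤ PE) :
    ‖B - B₀‖ ≤ 100 * (Cρ * lam * Real.sqrt r) / (4 * Λ - 3 * μ) ∧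
    nuclearNorm (B - B₀) ≤ 100 * (Cρ * lam * r) / (4 * Λ - 3 * μ) ∧
    PE ≤ Cρ ^ 2 * lam ^ 2 * r *
      (100 / (4 * Λ - 3 * μ) + 100 * μ / (4 * Λ - 3 * μ) ^ 2) := by
  set a := lam * Cρ with ha
  have ha0 : 0 < a := by positivity
  set s := ‖B - B₀‖ with hs
  have hs0 : 0 ≤ s := norm_nonneg _
  set q := Real.sqrt r with hq
  have hq0 : 0 ≤ q := Real.sqrt_nonneg _
  have hqq : q * q = r := Real.mul_self_sqrt (Nat.cast_nonneg r)
  have hreg := regularizer_sub_le h B B₀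
  rw [hr] at hreg
  set top := headMean r
    (fun i j => ρ |tensorSingularValue B i j - tensorSingularValue B₀ i j|) with htop
  set tail := tailMean (2 * r) (fun i j => ρ (tensorSingularValue (B - B₀) i j)) with htail
  set rtop := headMean (2 * r) (fun i j => ρ (tensorSingularValue (B - B₀) i j)) with hrtop
  set nTop := headMean (2 * r) (fun i j => tensorSingularValue (B - B₀) i j) with hnTop
  set nTail := tailMean (2 * r) (fun i j => tensorSingularValue (B - B₀) i j) with hnTail
  have hN : nuclearNorm (B - B₀) = nTop + nTail :=
    (headMean_add_tailMean (2 * r) fun i j => tensorSingularValue (B - B₀) i j).symm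
  set N := nuclearNorm (B - B₀) with hNdef
  have h0' : (0 : ℝ) < d₃ := by exact_mod_cast hd₃
  have hsq : ∑ i, ∑ j, tensorSingularValue (B - B₀) i j ^ 2 = d₃ * s ^ 2 :=
    sum_sq_tensorSingularValue _
  have hsq2 : ∑ i, ∑ j, |tensorSingularValue B i j - tensorSingularValue B₀ i j| ^ 2 ≤
      d₃ * s ^ 2 := by
    simp_rw [sq_abs]; exact sum_sq_sub_tensorSingularValue_le B B₀
  have hsqrt2 : Real.sqrt ((2 * r : ℕ) : ℝ) ≤ 2 * q := by
    rw [Real.sqrt_le_left (by positivity), mul_pow, sq q, hqq]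
    push_cast
    have : (0 : ℝ) ≤ r := Nat.cast_nonneg r
    linarith
  have hhead : headMean r
      (fun i j => |tensorSingularValue B i j - tensorSingularValue B₀ i j|) ≤ q * s :=
    headMean_le_sqrt hd₃ r hs0 hsq2
  have hnTop_le : nTop ≤ 2 * q * s :=
    (headMean_le_sqrt hd₃ (2 * r) hs0 hsq.le).trans (by gcongr)
  have htail0 : 0 ≤ tail := by
    refine mul_nonneg (by positivity) (Finset.sum_nonneg fun x _ => ?_)
    exact h.nonneg (tensorSingularValue_nonneg _ _ _)
  have hrtop0 : 0 ≤ rtop := by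
    refine mul_nonneg (by positivity) (Finset.sum_nonneg fun x _ => ?_)
    exact h.nonneg (tensorSingularValue_nonneg _ _ _)
  have htop1 : top ≤ a * (q * s) := by
    refine (headMean_mono r (g := fun i j => a *
      |tensorSingularValue B i j - tensorSingularValue B₀ i j|)
      fun i j => h.le_mul (abs_nonneg _)).trans ?_
    rw [headMean_mul]
    gcongr
  have hrtop1 : rtop ≤ a * (2 * q * s) := by
    refine (headMean_mono (2 * r) (g := fun i j => a * tensorSingularValue (B - B₀) i j)
      fun i j => h.le_mul (tensorSingularValue_nonneg _ _ _)).trans ?_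
    rw [headMean_mul]
    gcongr
  -- Weak convexity trades the nuclear norm for the penalty, so the small multiples of `N` in `hup`
  -- and `hlow` can be absorbed.
  have haN : a * N ≤ rtop + tail + μ / 2 * s ^ 2 := by
    have h1 : a * N ≤ regularizer ρ (B - B₀) + μ / 2 * s ^ 2 := by
      have h2 : μ / 2 * s ^ 2 = (1 / (d₃ : ℝ)) * (μ / 2 *
          ∑ i, ∑ j, tensorSingularValue (B - B₀) i j ^ 2) := by
        rw [hsq]; field_simp
      rw [h2, hNdef, nuclearNorm, regularizer, ← mul_add, mul_left_comm]
      refine mul_le_mul_of_nonneg_left ?_ (by positivity)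
      simp only [Finset.mul_sum]
      rw [← Finset.sum_add_distrib]
      refine Finset.sum_le_sum fun i _ => ?_
      rw [← Finset.sum_add_distrib]
      exact Finset.sum_le_sum fun j _ => h.mul_le (tensorSingularValue_nonneg _ _ _)
    rwa [regularizer_eq ρ (B - B₀) (2 * r)] at h1
  have hΓ : 0 < 4 * Λ - 3 * μ := by linarith
  set Γ := 4 * Λ - 3 * μ with hΓdef
  have hmain : Γ / 8 * s ^ 2 + 7 / 8 * tail ≤ top + 1 / 8 * rtop := by
    have h1 : (Λ - Λ₀ / 4) * s ^ 2 ≤ top - tail + μ / 2 * s ^ 2 + 1 / 8 * (a * N) := by linarith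
    have h2 : (Λ - Λ₀ / 4) * s ^ 2 ≤ top - tail + μ / 2 * s ^ 2 +
      1 / 8 * (rtop + tail + μ / 2 * s ^ 2) := by linarith
    -- Since `Λ ≥ Λ₀`, the difference of the coefficients is at least `Λ₀/4 - 3μ/16`, which is
    -- positive precisely because `3μ < 4Λ₀`.
    have h3 : Γ / 8 * s ^ 2 ≤ (Λ - Λ₀ / 4 - μ / 2 - μ / 16) * s ^ 2 := by
      refine mul_le_mul_of_nonneg_right ?_ (sq_nonneg s)
      rw [hΓdef]; linarith
    linarith
  have hfrob : s ≤ 10 * (a * q) / Γ := by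
    rcases hs0.eq_or_lt with h0 | h0
    · rw [← h0]; positivity
    rw [le_div_iff₀ hΓ]
    have h1 : Γ / 8 * s ^ 2 ≤ 5 / 4 * (a * q) * s := by linarith
    have h2 : (s * Γ) * s ≤ (10 * (a * q)) * s := by linarith
    exact le_of_mul_le_mul_right h2 h0
  have hnuc : N ≤ 6 * q * s := by
    rcases hs0.eq_or_lt with h0 | h0
    · have : B - B₀ = 0 := norm_eq_zero.mp (hs ▸ h0.symm)
      rw [hNdef, this, nuclearNorm_zero, ← h0]; simp
    have hq' : 0 < q := by
      refine lt_of_le_of_ne hq0 fun hq0' => ?_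
      rw [← hq0'] at hfrob
      simp at hfrob
      linarith
    -- At this scale `r t` and `s²/t` both equal `q s`, so all error terms of the two chord
    -- comparisons are multiples of `√r ‖Δ‖`.
    set t := s / q with ht
    have ht0 : 0 < t := by positivity
    set a' := ρ t / t with ha'
    have ha'0 : 0 < a' := div_pos (h.pos ha0 hμ ht0) ht0
    have hrt : (r : ℝ) * t = q * s := by rw [ht, ← hqq]; field_simp
    have hst : s ^ 2 / t = q * s := by rw [ht]; field_simp
    have hadd : ∀ (m : ℕ) (f : Fin d → Fin d₃ → ℝ), headMean m (fun i j => a' * (t + f i j)) =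
        a' * (headMean (d := d) (d₃ := d₃) m (fun _ _ => t) + headMean m f) := by
      intro m f
      rw [headMean_mul]
      congr 1
      rw [headMean, headMean, headMean, ← mul_add, ← Finset.sum_add_distrib]
    have htop2 : top ≤ a' * (q * s + q * s) := by
      refine (headMean_mono r fun i j => h.le_ratio_mul ht0 (abs_nonneg _)).trans ?_
      rw [hadd]
      have := headMean_const_le (d := d) hd₃ r ht0.le
      rw [hrt] at this
      gcongr
    have hrtop2 : rtop ≤ a' * (2 * (q * s) + 2 * q * s) := by
      refine (headMean_mono (2 * r) fun i j =>
        h.le_ratio_mul ht0 (tensorSingularValue_nonneg _ _ _)).trans ?_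
      rw [hadd]
      have := headMean_const_le (d := d) hd₃ (2 * r) ht0.le
      push_cast at this
      rw [mul_assoc, hrt] at this
      gcongr
    have htail2 : a' * (nTail - q * s) ≤ tail := by
      have h1 : tailMean (2 * r) (fun i j => a' * (tensorSingularValue (B - B₀) i j -
          tensorSingularValue (B - B₀) i j ^ 2 / t)) ≤ tail :=
        tailMean_mono (2 * r) fun i j => h.ratio_mul_le ht0 (tensorSingularValue_nonneg _ _ _)
      refine le_trans ?_ h1
      have h2 : tailMean (2 * r) (fun i j => a' * (tensorSingularValue (B - B₀) i j -
          tensorSingularValue (B - B₀) i j ^ 2 / t)) = a' * (nTail -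
          (1 / (d₃ : ℝ)) * (∑ x : Fin d × Fin d₃ with ¬ (x.1 : ℕ) < 2 * r,
            tensorSingularValue (B - B₀) x.1 x.2 ^ 2) / t) := by
        rw [hnTail, tailMean, tailMean, ← Finset.mul_sum, Finset.sum_sub_distrib,
          ← Finset.sum_div]
        ring
      rw [h2]
      refine mul_le_mul_of_nonneg_left ?_ ha'0.le
      have h3 : (1 / (d₃ : ℝ)) * (∑ x : Fin d × Fin d₃ with ¬ (x.1 : ℕ) < 2 * r,
            tensorSingularValue (B - B₀) x.1 x.2 ^ 2) / t ≤ q * s := by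
        rw [← hst]
        refine div_le_div_of_nonneg_right ?_ ht0.le
        rw [one_div, inv_mul_le_iff₀ h0', ← hsq, ← Fintype.sum_prod_type
          (f := fun x : Fin d × Fin d₃ => tensorSingularValue (B - B₀) x.1 x.2 ^ 2)]
        exact Finset.sum_le_sum_of_subset_of_nonneg (Finset.subset_univ _)
          fun x _ _ => sq_nonneg _
      linarith
    have h4 : a' * (7 / 8 * (nTail - q * s)) ≤ a' * (5 / 2 * (q * s)) := by
      have : 0 ≤ Γ / 8 * s ^ 2 := by positivity
      linarith
    have h5 := le_of_mul_le_mul_left h4 ha'0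
    have : 0 ≤ q * s := by positivity
    linarith
  have hPE : PE ≤ 2 * (a * q * s) + μ * s ^ 2 := by
    have h1 : PE ≤ top - tail + μ / 2 * s ^ 2 + 1 / 16 * (rtop + tail + μ / 2 * s ^ 2) := by
      linarith
    have h2 : 0 ≤ a * (q * s) := by positivity
    have h3 : 0 ≤ μ * s ^ 2 := by positivity
    linarith
  refine ⟨hfrob.trans ?_, hnuc.trans ?_, hPE.trans ?_⟩
  · refine div_le_div_of_nonneg_right ?_ hΓ.le
    have : 0 ≤ a * q := by positivity
    rw [ha] at this ⊢
    linarith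
  · calc 6 * q * s ≤ 6 * q * (10 * (a * q) / Γ) := by gcongr
      _ = 60 * (a * (q * q)) / Γ := by ring
      _ ≤ _ := by
        rw [hqq, ha]
        refine div_le_div_of_nonneg_right ?_ hΓ.le
        have : 0 ≤ lam * Cρ * r := by positivity
        linarith
  · calc 2 * (a * q * s) + μ * s ^ 2
        ≤ 2 * (a * q * (10 * (a * q) / Γ)) + μ * (10 * (a * q) / Γ) ^ 2 := by gcongr
      _ = a ^ 2 * (q * q) * (20 / Γ + 100 * μ / Γ ^ 2) := by field_simp; ring
      _ ≤ a ^ 2 * (q * q) * (100 / Γ + 100 * μ / Γ ^ 2) := by gcongr; norm_num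
      _ = _ := by rw [hqq, ha]; ring

end Deterministic

/-! ### Exponential moment bounds -/

section Chernoff

variable {Ω S : Type*} [MeasurableSpace Ω] [MeasurableSpace S] {Pr : Measure Ω}
  {n : ℕ}

/-- Chernoff's bound for i.i.d. samples. -/
theorem measure_sum_ge_le {Z : Fin n → Ω → S} {𝔏 : Measure S} (hind : iIndepFun Z Pr)
    (hlaw : ∀ i, HasLaw (Z i) 𝔏 Pr) {f : S → ℝ} (hf : Measurable f) {b : ℝ}
    (hb : ∫⁻ z, ENNReal.ofReal (Real.exp (f z)) ∂𝔏 ≤ ENNReal.ofReal (Real.exp b)) (s : ℝ) :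
    Pr {ω | s ≤ ∑ i, f (Z i ω)} ≤ ENNReal.ofReal (Real.exp (n * b - s)) := by
  set W : Fin n → Ω → ℝ≥0∞ := fun i ω => ENNReal.ofReal (Real.exp (f ((hlaw i).aemeasurable.mk _ ω)))
    with hW
  have hg : Measurable fun z => ENNReal.ofReal (Real.exp (f z)) := by fun_prop
  have hWm : ∀ i, Measurable (W i) := fun i => hg.comp (hlaw i).aemeasurable.measurable_mk
  have hWind : iIndepFun W Pr :=
    (hind.congr fun i => (hlaw i).aemeasurable.ae_eq_mk).comp _ fun _ => hg
  have hae : ∀ᵐ ω ∂Pr, ∀ i, Z i ω = (hlaw i).aemeasurable.mk _ ω :=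
    ae_all_iff.mpr fun i => (hlaw i).aemeasurable.ae_eq_mk
  have h1 : ∫⁻ ω, ∏ i, W i ω ∂Pr ≤ ENNReal.ofReal (Real.exp (n * b)) := by
    rw [lintegral_prod_eq_prod_lintegral_of_indepFun Finset.univ W hWind hWm]
    have h2 : ∀ i, ∫⁻ ω, W i ω ∂Pr ≤ ENNReal.ofReal (Real.exp b) := by
      intro i
      have : ∫⁻ ω, W i ω ∂Pr = ∫⁻ z, ENNReal.ofReal (Real.exp (f z)) ∂𝔏 := by
        rw [← (hlaw i).lintegral_comp hg.aemeasurable]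
        refine lintegral_congr_ae ?_
        filter_upwards [(hlaw i).aemeasurable.ae_eq_mk] with ω hω
        rw [hW, hω]
      rw [this]; exact hb
    refine (Finset.prod_le_prod' fun i _ => h2 i).trans ?_
    rw [Finset.prod_const, Finset.card_univ, Fintype.card_fin, ← ENNReal.ofReal_pow
      (Real.exp_pos _).le, ← Real.exp_nat_mul]
  have h3 : Pr {ω | s ≤ ∑ i, f (Z i ω)} ≤
      Pr {ω | ENNReal.ofReal (Real.exp s) ≤ ∏ i, W i ω} := by
    refine measure_mono_ae ?_
    filter_upwards [hae] with ω hω hs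
    change ENNReal.ofReal (Real.exp s) ≤ ∏ i, W i ω
    have : ∏ i, W i ω = ENNReal.ofReal (Real.exp (∑ i, f (Z i ω))) := by
      rw [Real.exp_sum, ENNReal.ofReal_prod_of_nonneg fun i _ => (Real.exp_pos _).le]
      exact Finset.prod_congr rfl fun i _ => by rw [hW, hω i]
    rw [this]
    exact ENNReal.ofReal_le_ofReal (Real.exp_le_exp.mpr hs)
  refine h3.trans ((meas_ge_le_lintegral_div
    (Finset.measurable_prod _ fun i _ => hWm i).aemeasurable
    (by simp [Real.exp_pos]) ENNReal.ofReal_ne_top).trans ?_)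
  rw [Real.exp_sub, ENNReal.ofReal_div_of_pos (Real.exp_pos s)]
  gcongr

end Chernoff

theorem exp_le_one_add_add_sq (x : ℝ) : Real.exp x ≤ 1 + x + x ^ 2 * Real.exp |x| := by
  have h1 : Real.exp x - 1 ≤ x * Real.exp x := by
    have := Real.add_one_le_exp (-x)
    have h2 : Real.exp x * Real.exp (-x) = 1 := by rw [← Real.exp_add]; simp
    nlinarith [Real.exp_pos x]
  have h3 := Real.add_one_le_exp x
  rcases le_total 0 x with hx | hx
  · rw [abs_of_nonneg hx]; nlinarith [mul_le_mul_of_nonneg_left h1 hx]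
  · have h4 : 1 ≤ Real.exp |x| := Real.one_le_exp (abs_nonneg x)
    have h5 : x * (Real.exp x - 1) ≤ x ^ 2 := by nlinarith
    nlinarith [mul_le_mul_of_nonneg_left h4 (sq_nonneg x)]

/-- One half of the exponent in `exp |z|` absorbs `z²`, the other absorbs `exp |θ z|`. -/
theorem exp_mul_le {θ : ℝ} (hθ0 : 0 ≤ θ) (hθ : θ ≤ 1 / 2) (z : ℝ) :
    Real.exp (θ * z) ≤ 1 + θ * z + 8 * θ ^ 2 * Real.exp |z| := by
  refine (exp_le_one_add_add_sq _).trans ?_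
  have h1 : |θ * z| ≤ |z| / 2 := by
    rw [abs_mul, abs_of_nonneg hθ0]
    nlinarith [abs_nonneg z]
  have h2 : Real.exp |θ * z| ≤ Real.exp (|z| / 2) := Real.exp_le_exp.mpr h1
  have h3 : z ^ 2 ≤ 8 * Real.exp (|z| / 2) := by
    have := Real.quadratic_le_exp_of_nonneg (show 0 ≤ |z| / 2 by positivity)
    have h4 : |z| ^ 2 = z ^ 2 := sq_abs z
    nlinarith [abs_nonneg z]
  have h5 : Real.exp |z| = Real.exp (|z| / 2) * Real.exp (|z| / 2) := by
    rw [← Real.exp_add]; congr 1; ring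
  calc 1 + θ * z + (θ * z) ^ 2 * Real.exp |θ * z|
      ≤ 1 + θ * z + (θ ^ 2 * (8 * Real.exp (|z| / 2))) * Real.exp (|z| / 2) := by
        rw [mul_pow]; gcongr
    _ = _ := by rw [h5]; ring

/-- A Bernstein-type moment bound without boundedness: the second-order term of `exp_mul_le` is
integrated against the exponential moment of the envelope `Y`. -/
theorem lintegral_exp_neg_mul_le {S : Type*} [MeasurableSpace S] {P : Measure S}
    [IsProbabilityMeasure P] {Z Y : S → ℝ} (hZ : Measurable Z) (hY : Measurable Y)
    (hZY : ∀ x, |Z x| ≤ Y x) (hexp : ∫⁻ x, ENNReal.ofReal (Real.exp (Y x)) ∂P ≤ 2) {m θ : ℝ}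
    (hm : m ≤ ∫ x, Z x ∂P) (hθ0 : 0 ≤ θ) (hθ : θ ≤ 1 / 2) :
    ∫⁻ x, ENNReal.ofReal (Real.exp (-(θ * Z x))) ∂P ≤
      ENNReal.ofReal (Real.exp (-(θ * m) + 16 * θ ^ 2)) := by
  have hYint : Integrable (fun x => Real.exp (Y x)) P := by
    refine ⟨by fun_prop, ?_⟩
    rw [hasFiniteIntegral_iff_ofReal (ae_of_all _ fun x => (Real.exp_pos _).le)]
    exact hexp.trans_lt (by simp)
  have hY2 : ∫ x, Real.exp (Y x) ∂P ≤ 2 := by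
    rw [integral_eq_lintegral_of_nonneg_ae (ae_of_all _ fun x => (Real.exp_pos _).le)
      (by fun_prop)]
    exact ENNReal.toReal_le_of_le_ofReal (by norm_num) (by simpa using hexp)
  have hZint : Integrable Z P := by
    refine hYint.mono' (by fun_prop) (ae_of_all _ fun x => ?_)
    have := Real.add_one_le_exp (Y x)
    rw [Real.norm_eq_abs]; linarith [hZY x]
  have hpt : ∀ x, Real.exp (-(θ * Z x)) ≤ 1 + θ * (-Z x) + 8 * θ ^ 2 * Real.exp (Y x) := by
    intro x
    have := exp_mul_le hθ0 hθ (-Z x)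
    rw [abs_neg] at this
    rw [← mul_neg]
    refine this.trans ?_
    have := Real.exp_le_exp.mpr (hZY x)
    gcongr
  have hint : Integrable (fun x => 1 + θ * (-Z x) + 8 * θ ^ 2 * Real.exp (Y x)) P :=
    ((integrable_const _).add (hZint.neg.const_mul _)).add (hYint.const_mul _)
  have hint' : Integrable (fun x => Real.exp (-(θ * Z x))) P :=
    hint.mono' (by fun_prop) (ae_of_all _ fun x => by
      rw [Real.norm_eq_abs, abs_of_pos (Real.exp_pos _)]; exact hpt x)
  rw [← ofReal_integral_eq_lintegral_ofReal hint' (ae_of_all _ fun x => (Real.exp_pos _).le)]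
  refine ENNReal.ofReal_le_ofReal ?_
  have h1 : ∫ x, (1 + θ * (-Z x) + 8 * θ ^ 2 * Real.exp (Y x)) ∂P =
      1 + θ * (-∫ x, Z x ∂P) + 8 * θ ^ 2 * ∫ x, Real.exp (Y x) ∂P := by
    have i1 : Integrable (fun x => θ * (-Z x)) P := hZint.neg.const_mul _
    have i2 : Integrable (fun x => 1 + θ * (-Z x)) P := (integrable_const _).add i1
    rw [integral_add i2 (hYint.const_mul _), integral_add (integrable_const _) i1,
      integral_const_mul, integral_const_mul, integral_neg]
    simp
  calc _ ≤ _ := integral_mono hint' hint hpt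
    _ = _ := h1
    _ ≤ (-(θ * m) + 16 * θ ^ 2) + 1 := by
      have h2 : θ * m ≤ θ * ∫ x, Z x ∂P := mul_le_mul_of_nonneg_left hm hθ0
      have h3 : θ ^ 2 * ∫ x, Real.exp (Y x) ∂P ≤ θ ^ 2 * 2 :=
        mul_le_mul_of_nonneg_left hY2 (sq_nonneg θ)
      linarith
    _ ≤ _ := Real.add_one_le_exp _

/-! ### Sub-Gaussian predictors -/

section SubGaussian

variable {d d₃ : ℕ} {P : Measure (Tensor d d₃)} {K : ℝ}

/-- The infimum defining the `ψ₂`-norm need not be attained; doubling `K` leaves room for an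
admissible `t < 2K`. -/
theorem IsSubGaussian.lintegral_exp_le (h : IsSubGaussian P K) (hK : 0 < K) {v : Tensor d d₃}
    {b : ℝ} (hb : 0 < b) (hv : ‖v‖ ≤ b) :
    ∫⁻ x, ENNReal.ofReal (Real.exp (inner ℝ x v ^ 2 / ((2 * K) ^ 2 * b ^ 2))) ∂P ≤ 2 := by
  have h1 := h (b⁻¹ • v) (by
    rw [norm_smul, norm_inv, Real.norm_eq_abs, abs_of_pos hb, inv_mul_le_iff₀ hb]; simpa)
  have h2 : psi2Norm P (fun x => inner ℝ x (b⁻¹ • v)) < ENNReal.ofReal (2 * K) :=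
    h1.trans_lt ((ENNReal.ofReal_lt_ofReal_iff (by positivity)).mpr (by linarith))
  unfold psi2Norm at h2
  obtain ⟨t, ht⟩ := iInf_lt_iff.mp h2
  obtain ⟨⟨ht0, hle⟩, htK⟩ := iInf_lt_iff.mp ht
  rw [ENNReal.ofReal_lt_ofReal_iff (by positivity)] at htK
  refine le_trans (lintegral_mono fun x => ENNReal.ofReal_le_ofReal (Real.exp_le_exp.mpr ?_)) hle
  simp only
  rw [inner_smul_right, show (b⁻¹ * inner ℝ x v) ^ 2 / t ^ 2 =
    inner ℝ x v ^ 2 / (t ^ 2 * b ^ 2) by field_simp]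
  gcongr

theorem IsSubGaussian.integrable_exp (h : IsSubGaussian P K) (hK : 0 < K) {v : Tensor d d₃}
    {b : ℝ} (hb : 0 < b) (hv : ‖v‖ ≤ b) :
    Integrable (fun x => Real.exp (inner ℝ x v ^ 2 / ((2 * K) ^ 2 * b ^ 2))) P ∧
    ∫ x, Real.exp (inner ℝ x v ^ 2 / ((2 * K) ^ 2 * b ^ 2)) ∂P ≤ 2 := by
  have h1 := h.lintegral_exp_le hK hb hv
  have hm : Measurable fun x : Tensor d d₃ =>
    Real.exp (inner ℝ x v ^ 2 / ((2 * K) ^ 2 * b ^ 2)) := by fun_prop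
  constructor
  · refine ⟨hm.aestronglyMeasurable, ?_⟩
    rw [hasFiniteIntegral_iff_ofReal (ae_of_all _ fun x => (Real.exp_pos _).le)]
    exact h1.trans_lt (by simp)
  · rw [integral_eq_lintegral_of_nonneg_ae (ae_of_all _ fun x => (Real.exp_pos _).le)
      hm.aestronglyMeasurable]
    exact ENNReal.toReal_le_of_le_ofReal (by norm_num) (by simpa using h1)

variable [IsProbabilityMeasure P]

/-- Convexity gives `exp (s z) ≤ 1 - s + s exp z`, whose mean is at most `1 + s ≤ exp s`. -/
theorem IsSubGaussian.lintegral_exp_mul_le (h : IsSubGaussian P K) (hK : 0 < K) {v : Tensor d d₃}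
    {b : ℝ} (hb : 0 < b) (hv : ‖v‖ ≤ b) {s : ℝ} (hs0 : 0 ≤ s) (hs1 : s ≤ 1) :
    ∫⁻ x, ENNReal.ofReal (Real.exp (s * (inner ℝ x v ^ 2 / ((2 * K) ^ 2 * b ^ 2)))) ∂P ≤
      ENNReal.ofReal (Real.exp s) := by
  have hpt : ∀ z : ℝ, Real.exp (s * z) ≤ (1 - s) + s * Real.exp z := by
    intro z
    have := convexOn_exp.2 (Set.mem_univ z) (Set.mem_univ 0) hs0 (show 0 ≤ 1 - s by linarith)
      (by ring)
    simp only [smul_eq_mul, mul_zero, add_zero, Real.exp_zero, mul_one] at this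
    linarith
  calc _ ≤ ∫⁻ x, (ENNReal.ofReal (1 - s) + ENNReal.ofReal s *
        ENNReal.ofReal (Real.exp (inner ℝ x v ^ 2 / ((2 * K) ^ 2 * b ^ 2)))) ∂P := by
        refine lintegral_mono fun x => ?_
        simp only
        rw [← ENNReal.ofReal_mul hs0, ← ENNReal.ofReal_add (by linarith)
          (mul_nonneg hs0 (Real.exp_pos _).le)]
        exact ENNReal.ofReal_le_ofReal (hpt _)
    _ = ENNReal.ofReal (1 - s) + ENNReal.ofReal s * ∫⁻ x,
        ENNReal.ofReal (Real.exp (inner ℝ x v ^ 2 / ((2 * K) ^ 2 * b ^ 2))) ∂P := by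
        rw [lintegral_add_left measurable_const, lintegral_const_mul' _ _ ENNReal.ofReal_ne_top]
        simp
    _ ≤ ENNReal.ofReal (1 - s) + ENNReal.ofReal s * ENNReal.ofReal 2 := by
        gcongr
        simpa using h.lintegral_exp_le hK hb hv
    _ = ENNReal.ofReal (s + 1) := by
        rw [← ENNReal.ofReal_mul hs0, ← ENNReal.ofReal_add (by linarith) (by positivity)]
        congr 1; ring
    _ ≤ _ := ENNReal.ofReal_le_ofReal (Real.add_one_le_exp s)

theorem IsSubGaussian.moments (h : IsSubGaussian P K) (hK : 0 < K) {v : Tensor d d₃}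
    {b : ℝ} (hb : 0 < b) (hv : ‖v‖ ≤ b) :
    Integrable (fun x => inner ℝ x v ^ 2) P ∧ Integrable (fun x => inner ℝ x v ^ 4) P ∧
    ∫ x, inner ℝ x v ^ 2 ∂P ≤ (2 * K) ^ 2 * b ^ 2 ∧
    ∫ x, inner ℝ x v ^ 4 ∂P ≤ 2 * ((2 * K) ^ 2 * b ^ 2) ^ 2 := by
  obtain ⟨h1, h2⟩ := h.integrable_exp hK hb hv
  set k : ℝ := (2 * K) ^ 2 * b ^ 2 with hk
  have hk0 : 0 < k := by positivity
  have hpt : ∀ x : Tensor d d₃, 1 + inner ℝ x v ^ 2 / k + (inner ℝ x v ^ 2 / k) ^ 2 / 2 ≤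
      Real.exp (inner ℝ x v ^ 2 / k) := fun x =>
    Real.quadratic_le_exp_of_nonneg (by positivity)
  have hb2 : ∀ x : Tensor d d₃, inner ℝ x v ^ 2 ≤
      k * (Real.exp (inner ℝ x v ^ 2 / k) - 1) := by
    intro x
    have := hpt x
    rw [← div_le_iff₀' hk0]
    nlinarith [sq_nonneg (inner ℝ x v ^ 2 / k)]
  have hb4 : ∀ x : Tensor d d₃, inner ℝ x v ^ 4 ≤
      2 * k ^ 2 * (Real.exp (inner ℝ x v ^ 2 / k) - 1) := by
    intro x
    have h3 := hpt x
    have h4 : inner ℝ x v ^ 4 = 2 * k ^ 2 * ((inner ℝ x v ^ 2 / k) ^ 2 / 2) := by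
      field_simp
    rw [h4]
    have : 0 ≤ inner ℝ x v ^ 2 / k := by positivity
    gcongr
    linarith
  have hint : Integrable (fun x : Tensor d d₃ => Real.exp (inner ℝ x v ^ 2 / k) - 1) P :=
    h1.sub (integrable_const _)
  have hval : ∫ x : Tensor d d₃, (Real.exp (inner ℝ x v ^ 2 / k) - 1) ∂P ≤ 1 := by
    rw [integral_sub h1 (integrable_const _)]; simp; linarith
  have i2 : Integrable (fun x : Tensor d d₃ => inner ℝ x v ^ 2) P := by
    refine (hint.const_mul k).mono' (by fun_prop) (ae_of_all _ fun x => ?_)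
    rw [Real.norm_eq_abs, abs_of_nonneg (by positivity)]
    exact hb2 x
  have i4 : Integrable (fun x : Tensor d d₃ => inner ℝ x v ^ 4) P := by
    refine (hint.const_mul (2 * k ^ 2)).mono' (by fun_prop) (ae_of_all _ fun x => ?_)
    rw [Real.norm_eq_abs, abs_of_nonneg (by positivity)]
    exact hb4 x
  refine ⟨i2, i4, ?_, ?_⟩
  · refine (integral_mono i2 (hint.const_mul k) hb2).trans ?_
    rw [integral_const_mul]
    nlinarith
  · refine (integral_mono i4 (hint.const_mul (2 * k ^ 2)) hb4).trans ?_
    rw [integral_const_mul]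
    have : 0 < 2 * k ^ 2 := by positivity
    nlinarith

end SubGaussian

/-! ### The cumulant function -/

section Cumulant

theorem abs_sub_le_of_hasDerivAt {f f' : ℝ → ℝ} {K : ℝ} (hf : ∀ s, HasDerivAt f (f' s) s)
    (hK : ∀ s, |f' s| ≤ K) (a b : ℝ) : |f b - f a| ≤ K * |b - a| :=
  convex_univ.norm_image_sub_le_of_norm_hasDerivWithin_le
    (fun x _ => (hf x).hasDerivWithinAt) (fun x _ => hK x) (Set.mem_univ a) (Set.mem_univ b)

theorem abs_sub_sub_mul_le {f f' : ℝ → ℝ} {K : ℝ} (hf : ∀ s, HasDerivAt f (f' s) s)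
    (hK : ∀ s t, |f' s - f' t| ≤ K * |s - t|) (hK0 : 0 ≤ K) (a h : ℝ) :
    |f (a + h) - f a - f' a * h| ≤ K * h ^ 2 := by
  have h1 : ∀ x ∈ Set.uIcc a (a + h),
      HasDerivWithinAt (fun s => f s - f' a * s) (f' x - f' a) (Set.uIcc a (a + h)) x := by
    intro x _
    have := (hf x).sub ((hasDerivAt_id x).const_mul (f' a))
    simp only [mul_one] at this
    exact this.hasDerivWithinAt
  have h2 : ∀ x ∈ Set.uIcc a (a + h), ‖f' x - f' a‖ ≤ K * |h| := by
    intro x hx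
    refine (hK x a).trans (mul_le_mul_of_nonneg_left ?_ hK0)
    have := Set.abs_sub_left_of_mem_uIcc hx
    rwa [add_sub_cancel_left] at this
  have := (convex_uIcc a (a + h)).norm_image_sub_le_of_norm_hasDerivWithin_le h1 h2
    Set.left_mem_uIcc Set.right_mem_uIcc
  rw [Real.norm_eq_abs, Real.norm_eq_abs, add_sub_cancel_left, mul_assoc, ← sq, sq_abs] at this
  calc _ = |f (a + h) - f' a * (a + h) - (f a - f' a * a)| := by congr 1; ring
    _ ≤ _ := this

variable {ψ : ℝ → ℝ} {c : ℝ}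

theorem hasDerivAt_cumulant (hψ : ContDiff ℝ 3 ψ) (s : ℝ) : HasDerivAt ψ (deriv ψ s) s :=
  ((hψ.differentiable (by norm_num)) s).hasDerivAt

theorem hasDerivAt_deriv_cumulant (hψ : ContDiff ℝ 3 ψ) (s : ℝ) :
    HasDerivAt (deriv ψ) (iteratedDeriv 2 ψ s) s := by
  have h := (hψ.differentiable_iteratedDeriv 1 (by norm_num)) s
  have h2 := h.hasDerivAt
  rw [← iteratedDeriv_succ, iteratedDeriv_one] at h2
  exact h2

theorem hasDerivAt_iteratedDeriv_two (hψ : ContDiff ℝ 3 ψ) (s : ℝ) :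
    HasDerivAt (iteratedDeriv 2 ψ) (iteratedDeriv 3 ψ s) s := by
  have h := (hψ.differentiable_iteratedDeriv 2 (by norm_num)) s
  have h2 := h.hasDerivAt
  rwa [← iteratedDeriv_succ] at h2

theorem continuous_iteratedDeriv_two (hψ : ContDiff ℝ 3 ψ) : Continuous (iteratedDeriv 2 ψ) :=
  hψ.continuous_iteratedDeriv 2 (by norm_num)

theorem continuous_deriv_cumulant (hψ : ContDiff ℝ 3 ψ) : Continuous (deriv ψ) :=
  continuous_iff_continuousAt.mpr fun s => (hasDerivAt_deriv_cumulant hψ s).continuousAt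

theorem exists_bound_iteratedDeriv_three (hψ : ContDiff ℝ 3 ψ)
    (h3 : ∀ s : ℝ, 1 < |s| → |iteratedDeriv 3 ψ s| ≤ |s|⁻¹) :
    ∃ M, 0 < M ∧ ∀ s, |iteratedDeriv 3 ψ s| ≤ M := by
  obtain ⟨M, hM⟩ := (isCompact_Icc (a := (-1 : ℝ)) (b := 1)).exists_bound_of_continuousOn
    (hψ.continuous_iteratedDeriv 3 le_rfl).continuousOn
  refine ⟨max M 1, by positivity, fun s => ?_⟩
  rcases le_or_gt |s| 1 with hs | hs
  · exact (hM s (abs_le.mp hs)).trans (le_max_left _ _)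
  · exact ((h3 s hs).trans (inv_le_one_of_one_le₀ hs.le)).trans (le_max_right _ _)

/-- Integrate the convexity inequality for `exp` applied to two log-densities: all three densities
have mass one, so the exponential of the scaled convexity gap is at most `1`. -/
theorem IsExponentialFamily.convexOn {w : ℝ} {ν : Measure ℝ} (h : IsExponentialFamily ψ w ν)
    (hw : 0 < w) : ConvexOn ℝ Set.univ ψ := by
  refine ⟨convex_univ, fun x _ z _ a b ha hb hab => ?_⟩
  simp only [smul_eq_mul]
  have hpt : ∀ y : ℝ, ENNReal.ofReal (Real.exp ((ψ (a * x + b * z) - (a * ψ x + b * ψ z)) / w)) *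
      ENNReal.ofReal (Real.exp ((y * (a * x + b * z) - ψ (a * x + b * z)) / w)) ≤
      ENNReal.ofReal a * ENNReal.ofReal (Real.exp ((y * x - ψ x) / w)) +
      ENNReal.ofReal b * ENNReal.ofReal (Real.exp ((y * z - ψ z) / w)) := by
    intro y
    rw [← ENNReal.ofReal_mul (Real.exp_pos _).le, ← Real.exp_add, ← ENNReal.ofReal_mul ha,
      ← ENNReal.ofReal_mul hb, ← ENNReal.ofReal_add (by positivity) (by positivity)]
    refine ENNReal.ofReal_le_ofReal ?_
    have := convexOn_exp.2 (Set.mem_univ ((y * x - ψ x) / w)) (Set.mem_univ ((y * z - ψ z) / w))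
      ha hb hab
    simp only [smul_eq_mul] at this
    refine le_trans (le_of_eq ?_) this
    congr 1
    ring
  have hm : ∀ u v : ℝ, Measurable fun y : ℝ => ENNReal.ofReal (Real.exp ((y * u - v) / w)) :=
    fun u v => by fun_prop
  have := lintegral_mono (μ := ν) hpt
  rw [lintegral_const_mul _ (hm _ _), h, lintegral_add_left ((hm _ _).const_mul _),
    lintegral_const_mul _ (hm _ _), lintegral_const_mul _ (hm _ _), h, h, mul_one, mul_one, mul_one,
    ← ENNReal.ofReal_add ha hb, hab, ENNReal.ofReal_le_ofReal_iff zero_le_one,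
    Real.exp_le_one_iff, div_le_iff₀ hw, zero_mul] at this
  linarith

theorem IsExponentialFamily.deriv_mono {w : ℝ} {ν : Measure ℝ} (h : IsExponentialFamily ψ w ν)
    (hw : 0 < w) (hψ : ContDiff ℝ 3 ψ) : Monotone (deriv ψ) := by
  have := (h.convexOn hw).monotoneOn_deriv
    (fun x _ => (hasDerivAt_cumulant hψ x).differentiableAt)
  exact monotoneOn_univ.mp this

end Cumulant

/-! ### The generalized linear model -/

section Model

variable {d d₃ : ℕ} {P : Measure (Tensor d d₃)} {ν : Measure ℝ} [SigmaFinite ν] {ψ : ℝ → ℝ}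
  {w c : ℝ} {B₀ : Tensor d d₃}

theorem measurable_density (hψ : Continuous ψ) : Measurable fun p : Tensor d d₃ × ℝ =>
    ENNReal.ofReal (Real.exp ((p.2 * inner ℝ p.1 B₀ - ψ (inner ℝ p.1 B₀)) / w)) := by
  fun_prop

theorem lintegral_glmLaw [SFinite P] (hψ : Continuous ψ) {f : Tensor d d₃ × ℝ → ℝ≥0∞}
    (hf : Measurable f) : ∫⁻ p, f p ∂(glmLaw P ν ψ w B₀) = ∫⁻ x, ∫⁻ y,
      ENNReal.ofReal (Real.exp ((y * inner ℝ x B₀ - ψ (inner ℝ x B₀)) / w)) * f (x, y) ∂ν ∂P := by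
  rw [glmLaw, lintegral_withDensity_eq_lintegral_mul _ (measurable_density hψ) hf,
    lintegral_prod _ ((measurable_density hψ).mul hf).aemeasurable]
  rfl

theorem lintegral_glmLaw_fst [SFinite P] (hψ : Continuous ψ) (hfam : IsExponentialFamily ψ w ν)
    {f : Tensor d d₃ → ℝ≥0∞} (hf : Measurable f) :
    ∫⁻ p, f p.1 ∂(glmLaw P ν ψ w B₀) = ∫⁻ x, f x ∂P := by
  rw [lintegral_glmLaw (f := fun p => f p.1) hψ (hf.comp measurable_fst)]
  refine lintegral_congr fun x => ?_
  have hm : Measurable fun y : ℝ =>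
    ENNReal.ofReal (Real.exp ((y * inner ℝ x B₀ - ψ (inner ℝ x B₀)) / w)) := by fun_prop
  dsimp only
  rw [lintegral_mul_const _ hm, hfam, one_mul]

/-- The centred response is conditionally sub-Gaussian. -/
theorem lintegral_glmLaw_exp_le [SFinite P] (hψ : ContDiff ℝ 3 ψ) (hw : 0 < w) (hc : 0 < c)
    (hfam : IsExponentialFamily ψ w ν) (hψ2 : ∀ s, |iteratedDeriv 2 ψ s| ≤ c) (a : Tensor d d₃)
    (t : ℝ) :
    ∫⁻ p, ENNReal.ofReal (Real.exp (t * ((p.2 - deriv ψ (inner ℝ p.1 B₀)) * inner ℝ p.1 a)))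
      ∂(glmLaw P ν ψ w B₀) ≤
    ∫⁻ x, ENNReal.ofReal (Real.exp (c * w * t ^ 2 * inner ℝ x a ^ 2)) ∂P := by
  have hdc := continuous_deriv_cumulant hψ
  rw [lintegral_glmLaw hψ.continuous (by fun_prop)]
  refine lintegral_mono fun x => ?_
  set θ := inner ℝ x B₀ with hθ
  set τ := t * inner ℝ x a with hτ
  have hlip : ∀ s s', |deriv ψ s - deriv ψ s'| ≤ c * |s - s'| := fun s s' =>
    abs_sub_le_of_hasDerivAt (hasDerivAt_deriv_cumulant hψ) hψ2 s' s
  have htay := (abs_le.mp (abs_sub_sub_mul_le (hasDerivAt_cumulant hψ) hlip hc.le θ (w * τ))).2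
  -- Exponential tilting: the product is the density at the shifted parameter `θ + w τ`, up to a
  -- factor bounded by second-order Taylor expansion of `ψ`.
  have hpt : ∀ y : ℝ, ENNReal.ofReal (Real.exp ((y * θ - ψ θ) / w)) *
      ENNReal.ofReal (Real.exp (t * ((y - deriv ψ θ) * inner ℝ x a))) ≤
      ENNReal.ofReal (Real.exp (c * w * t ^ 2 * inner ℝ x a ^ 2)) *
        ENNReal.ofReal (Real.exp ((y * (θ + w * τ) - ψ (θ + w * τ)) / w)) := by
    intro y
    rw [← ENNReal.ofReal_mul (Real.exp_pos _).le, ← ENNReal.ofReal_mul (Real.exp_pos _).le,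
      ← Real.exp_add, ← Real.exp_add]
    refine ENNReal.ofReal_le_ofReal (Real.exp_le_exp.mpr ?_)
    have h1 : c * w * t ^ 2 * inner ℝ x a ^ 2 = c * (w * τ) ^ 2 / w := by
      rw [hτ]; field_simp
    have h2 : t * ((y - deriv ψ θ) * inner ℝ x a) = (y - deriv ψ θ) * (w * τ) / w := by
      rw [hτ]; field_simp
    rw [h1, h2, ← add_div, ← add_div]
    refine div_le_div_of_nonneg_right ?_ hw.le
    linarith
  refine (lintegral_mono hpt).trans ?_
  have hm : Measurable fun y : ℝ =>
    ENNReal.ofReal (Real.exp ((y * (θ + w * τ) - ψ (θ + w * τ)) / w)) := by fun_prop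
  rw [lintegral_const_mul _ hm, hfam, mul_one]

end Model

/-! ### The empirical risk -/

section Risk

variable {d d₃ n : ℕ} {ψ : ℝ → ℝ}

theorem hasGradientAt_empiricalRisk (hψ : ContDiff ℝ 3 ψ) (X : Fin n → Tensor d d₃)
    (y : Fin n → ℝ) (B : Tensor d d₃) :
    HasGradientAt (empiricalRisk ψ X y)
      ((1 / (n : ℝ)) • ∑ i, (deriv ψ (inner ℝ (X i) B) - y i) • X i) B := by
  rw [hasGradientAt_iff_hasFDerivAt]
  have h1 : ∀ i, HasFDerivAt (fun B : Tensor d d₃ => -(y i) * inner ℝ (X i) B +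
      ψ (inner ℝ (X i) B)) ((deriv ψ (inner ℝ (X i) B) - y i) • innerSL ℝ (X i)) B := by
    intro i
    have h2 : HasFDerivAt (fun B : Tensor d d₃ => (inner ℝ (X i) B : ℝ)) (innerSL ℝ (X i)) B :=
      (innerSL ℝ (X i)).hasFDerivAt
    have h3 := (h2.const_mul (-(y i))).add
      ((hasDerivAt_cumulant hψ (inner ℝ (X i) B)).comp_hasFDerivAt B h2)
    exact h3.congr_fderiv (by rw [← add_smul]; congr 1; ring)
  have h4 := (HasFDerivAt.fun_sum fun i (_ : i ∈ Finset.univ) => h1 i).const_mul (1 / (n : ℝ))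
  refine h4.congr_fderiv (ContinuousLinearMap.ext fun z => ?_)
  rw [InnerProductSpace.toDual_apply_apply, inner_smul_left, sum_inner]
  simp [inner_smul_left]

theorem predictionError_eq (hψ : ContDiff ℝ 3 ψ) (X : Fin n → Tensor d d₃)
    (y : Fin n → ℝ) (B B₀ : Tensor d d₃) :
    predictionError (empiricalRisk ψ X y) B B₀ = (1 / (n : ℝ)) * ∑ i,
      (deriv ψ (inner ℝ (X i) B₀ + inner ℝ (X i) (B - B₀)) - deriv ψ (inner ℝ (X i) B₀)) *
        inner ℝ (X i) (B - B₀) := by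
  rw [predictionError, (hasGradientAt_empiricalRisk hψ X y B).gradient,
    (hasGradientAt_empiricalRisk hψ X y B₀).gradient, ← smul_sub, ← Finset.sum_sub_distrib,
    inner_smul_left, sum_inner]
  simp only [conj_trivial]
  congr 1
  refine Finset.sum_congr rfl fun i _ => ?_
  rw [← sub_smul, inner_smul_left, ← inner_add_right, add_sub_cancel]
  simp

end Risk

/-! ### The smallest eigenvalue of the expected Hessian -/

section Hessian

/-- Subtracting the infimum of the spectrum times the identity leaves a matrix with nonnegative
eigenvalues. -/
theorem smallestEigenvalue_mul_le {ι : Type*} [Fintype ι] [DecidableEq ι] {A : Matrix ι ι ℝ}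
    (hA : A.IsHermitian) (v : ι → ℝ) :
    smallestEigenvalue A * (v ⬝ᵥ v) ≤ v ⬝ᵥ (A.mulVec v) := by
  set l := smallestEigenvalue A with hl
  have hB : (A - algebraMap ℝ (Matrix ι ι ℝ) l).IsHermitian := by
    refine hA.sub ?_
    rw [Matrix.algebraMap_eq_diagonal]
    exact Matrix.isHermitian_diagonal _
  have hpos : (A - algebraMap ℝ (Matrix ι ι ℝ) l).PosSemidef := by
    rw [hB.posSemidef_iff_eigenvalues_nonneg]
    intro i
    have h1 : hB.eigenvalues i ∈ spectrum ℝ (A - algebraMap ℝ (Matrix ι ι ℝ) l) := by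
      rw [hB.spectrum_real_eq_range_eigenvalues]; exact ⟨i, rfl⟩
    rw [← spectrum.sub_singleton_eq] at h1
    obtain ⟨z, hz, l', hl', he⟩ := Set.mem_sub.mp h1
    rw [Set.mem_singleton_iff] at hl'
    have : l ≤ z := csInf_le A.finite_real_spectrum.bddBelow hz
    rw [← he, hl']
    simpa using this
  have := hpos.dotProduct_mulVec_nonneg v
  rw [Matrix.sub_mulVec, dotProduct_sub] at this
  simp only [star_trivial, Algebra.algebraMap_eq_smul_one, Matrix.smul_mulVec, Matrix.one_mulVec,
    dotProduct_smul, smul_eq_mul] at this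
  linarith

variable {d d₃ : ℕ} {P : Measure (Tensor d d₃)} [IsProbabilityMeasure P] {K c : ℝ} {ψ : ℝ → ℝ}

theorem smallestEigenvalue_expectedHessian_mul_le (hP : IsSubGaussian P K) (hK : 0 < K)
    (hψ : ContDiff ℝ 3 ψ) (hψ2 : ∀ s, |iteratedDeriv 2 ψ s| ≤ c) (B₀ v : Tensor d d₃) :
    smallestEigenvalue (expectedHessian P ψ B₀) * ‖v‖ ^ 2 ≤
      ∫ x, iteratedDeriv 2 ψ (inner ℝ x B₀) * inner ℝ x v ^ 2 ∂P := by
  have hc2 := continuous_iteratedDeriv_two hψ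
  have hA : (expectedHessian P ψ B₀).IsHermitian := by
    ext a b
    simp [expectedHessian, mul_comm (_ : ℝ) (_ : ℝ)]
  have hcoord : ∀ a, Integrable (fun x : Tensor d d₃ => x a ^ 2) P := by
    intro a
    have := (hP.moments hK zero_lt_one (v := EuclideanSpace.single a (1 : ℝ)) (by simp)).1
    refine this.congr (ae_of_all _ fun x => ?_)
    simp only
    rw [EuclideanSpace.inner_single_right]
    simp
  have hc0 : 0 ≤ c := (abs_nonneg _).trans (hψ2 0)
  have hint : ∀ a b, Integrable (fun x : Tensor d d₃ =>
      iteratedDeriv 2 ψ (inner ℝ x B₀) * (x a * x b)) P := by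
    intro a b
    refine (((hcoord a).add (hcoord b)).const_mul c).mono'
      (Continuous.aestronglyMeasurable (by fun_prop)) (ae_of_all _ fun x => ?_)
    rw [Real.norm_eq_abs, abs_mul]
    refine mul_le_mul (hψ2 _) ?_ (abs_nonneg _) hc0
    rw [abs_le]
    constructor <;> simp only [Pi.add_apply] <;> nlinarith [sq_nonneg (x a + x b), sq_nonneg (x a - x b)]
  have h1 := smallestEigenvalue_mul_le hA v.ofLp
  have h2 : v.ofLp ⬝ᵥ v.ofLp = ‖v‖ ^ 2 := by
    rw [EuclideanSpace.norm_sq_eq]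
    simp [dotProduct, sq]
  rw [h2] at h1
  refine h1.trans (le_of_eq ?_)
  have h3 : ∀ x : Tensor d d₃, iteratedDeriv 2 ψ (inner ℝ x B₀) * inner ℝ x v ^ 2 =
      ∑ a, ∑ b, v a * v b * (iteratedDeriv 2 ψ (inner ℝ x B₀) * (x a * x b)) := by
    intro x
    have h4 : (inner ℝ x v : ℝ) = ∑ a, x a * v a := by
      rw [PiLp.inner_apply]; exact Finset.sum_congr rfl fun a _ => by simp [mul_comm]
    conv_lhs => rw [h4]
    rw [sq, Finset.sum_mul_sum, Finset.mul_sum]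
    refine Finset.sum_congr rfl fun a _ => ?_
    rw [Finset.mul_sum]
    refine Finset.sum_congr rfl fun b _ => by ring
  simp_rw [h3]
  rw [integral_finsetSum _ fun a _ => integrable_finsetSum _ fun b _ =>
    (hint a b).const_mul _]
  simp only [dotProduct, Matrix.mulVec, expectedHessian, Matrix.of_apply]
  refine Finset.sum_congr rfl fun a _ => ?_
  rw [integral_finsetSum _ fun b _ => (hint a b).const_mul _, Finset.mul_sum]
  refine Finset.sum_congr rfl fun b _ => ?_
  rw [integral_const_mul]
  ring

end Hessian

/-! ### Sparsification of convex combinations -/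

/-- Derandomised Maurey sampling: a point of the convex hull of `𝒜` can be replaced by an average
of `k` elements of `𝒜` without increasing a function of bounded upper curvature by much. -/
theorem exists_sum_le_of_mem_convexHull {E : Type*} [NormedAddCommGroup E] [InnerProductSpace ℝ E]
    {𝒜 : Set E} {m : E} (hm : m ∈ convexHull ℝ 𝒜) {Ψ q : E → ℝ}
    (hΨ : ∀ x, ∃ g : E, ∀ z, Ψ (x + z) ≤ Ψ x + inner ℝ g z + q z) {t B : ℝ} (ht : 0 ≤ t)
    (hB : ∀ a ∈ 𝒜, q (t • (a - m)) ≤ B) (x : E) (k : ℕ) :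
    ∃ f : Fin k → E, (∀ i, f i ∈ 𝒜) ∧ Ψ (x + t • ∑ i, (f i - m)) ≤ Ψ x + k * B := by
  induction k with
  | zero => exact ⟨Fin.elim0, fun i => i.elim0, by simp⟩
  | succ k ih =>
    obtain ⟨f, hf, hle⟩ := ih
    obtain ⟨g, hg⟩ := hΨ (x + t • ∑ i, (f i - m))
    -- The linear term has average zero over a representation of `m`, so some atom makes it
    -- nonpositive; each greedy step then costs only `q`.
    obtain ⟨a, ha, hga⟩ := ((innerₗ E g).concaveOn convex_univ).exists_le_of_mem_convexHull
      (Set.subset_univ 𝒜) hm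
    simp only [innerₗ_apply_apply] at hga
    refine ⟨Fin.snoc f a, fun i => ?_, ?_⟩
    · refine Fin.lastCases ?_ (fun j => ?_) i
      · simpa using ha
      · simpa using hf j
    · have h1 : x + t • ∑ i, ((Fin.snoc f a : Fin (k + 1) → E) i - m) =
          (x + t • ∑ i, (f i - m)) + t • (a - m) := by
        rw [Fin.sum_univ_castSucc]
        simp only [Fin.snoc_castSucc, Fin.snoc_last]
        rw [smul_add, add_assoc]
      rw [h1]
      refine (hg _).trans ?_
      have h2 : inner ℝ g (t • (a - m)) ≤ 0 := by
        rw [inner_smul_right, inner_sub_right]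
        exact mul_nonpos_of_nonneg_of_nonpos ht (by linarith)
      have := hB a ha
      push_cast
      linarith

/-! ### Restricted curvature of the empirical risk -/

section Curvature

/-- A lower bound for the curvature of `ψ` at `b` in direction `h`, whose subtracted part is
convex in `h` and grows at most quadratically. -/
def curvature (ψ : ℝ → ℝ) (c m T b h : ℝ) : ℝ :=
  iteratedDeriv 2 ψ b * h ^ 2 - m * h ^ 2 - 8 * c * max (|h| - T / 2) 0 ^ 2

variable {ψ : ℝ → ℝ} {c m T M : ℝ}

theorem abs_curvature_le (hc : 0 ≤ c) (hm : 0 ≤ m) (hT : 0 ≤ T)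
    (hψ2 : ∀ s, |iteratedDeriv 2 ψ s| ≤ c) (b h : ℝ) :
    |curvature ψ c m T b h| ≤ (9 * c + m) * h ^ 2 := by
  have h1 : max (|h| - T / 2) 0 ^ 2 ≤ h ^ 2 := by
    rw [← sq_abs h]
    exact pow_le_pow_left₀ (le_max_right _ _) (max_le (by linarith) (abs_nonneg h)) 2
  have h2 := abs_le.mp (hψ2 b)
  have h3 : 0 ≤ h ^ 2 := sq_nonneg h
  have h4 : 0 ≤ max (|h| - T / 2) 0 ^ 2 := sq_nonneg _
  unfold curvature
  rw [abs_le]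
  constructor <;> nlinarith [mul_le_mul_of_nonneg_left h1 hc, mul_nonneg hc h4,
    mul_nonneg hm h3, mul_le_mul_of_nonneg_right h2.1 h3, mul_le_mul_of_nonneg_right h2.2 h3]

/-- For `|h| ≤ T` the Taylor remainder is controlled by `ψ'''` and absorbed by `m h²`. For `|h| > T`
only the bound on `ψ''` is used, and `|h| ≤ 2 (|h| - T/2)` lets the squared hinge absorb the error.
-/
theorem sq_mul_curvature_le (hψ : ContDiff ℝ 3 ψ) (hc : 0 ≤ c)
    (hψ2 : ∀ s, |iteratedDeriv 2 ψ s| ≤ c) (hM : 0 ≤ M) (hψ3 : ∀ s, |iteratedDeriv 3 ψ s| ≤ M)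
    (hm : 0 ≤ m) {s : ℝ} (hs : 0 ≤ s) (hsm : M * s * T ≤ m) (b h : ℝ) :
    s ^ 2 * curvature ψ c m T b h ≤ (deriv ψ (b + s * h) - deriv ψ b) * (s * h) := by
  have hsh : 0 ≤ s * |h| := mul_nonneg hs (abs_nonneg h)
  have habs : |s * h| = s * |h| := by rw [abs_mul, abs_of_nonneg hs]
  set δ := deriv ψ (b + s * h) - deriv ψ b - iteratedDeriv 2 ψ b * (s * h) with hδ
  have hkey : -(|δ| * (s * |h|)) ≤ δ * (s * h) := by
    have := neg_abs_le (δ * (s * h))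
    rwa [abs_mul, habs] at this
  have hexp : (deriv ψ (b + s * h) - deriv ψ b) * (s * h) =
      iteratedDeriv 2 ψ b * (s ^ 2 * h ^ 2) + δ * (s * h) := by rw [hδ]; ring
  rw [hexp]
  unfold curvature
  have hmax0 : 0 ≤ max (|h| - T / 2) 0 := le_max_right _ _
  rcases le_or_gt |h| T with hT | hT
  · have h1 : |δ| ≤ M * (s * h) ^ 2 := abs_sub_sub_mul_le (hasDerivAt_deriv_cumulant hψ)
      (fun x y => abs_sub_le_of_hasDerivAt (hasDerivAt_iteratedDeriv_two hψ) hψ3 y x) hM b (s * h)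
    have h2 : |δ| * (s * |h|) ≤ s ^ 2 * (m * h ^ 2) := by
      calc |δ| * (s * |h|) ≤ M * (s * h) ^ 2 * (s * T) := by gcongr
        _ = (M * s * T) * (s ^ 2 * h ^ 2) := by ring
        _ ≤ m * (s ^ 2 * h ^ 2) := by gcongr
        _ = _ := by ring
    have h3 : 0 ≤ s ^ 2 * (8 * c * max (|h| - T / 2) 0 ^ 2) := by positivity
    linarith
  · have h1 : |δ| ≤ 2 * c * (s * |h|) := by
      have h2 := abs_sub_le_of_hasDerivAt (hasDerivAt_deriv_cumulant hψ) hψ2 b (b + s * h)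
      rw [add_sub_cancel_left, habs] at h2
      have h3 : |iteratedDeriv 2 ψ b * (s * h)| ≤ c * (s * |h|) := by
        rw [abs_mul, habs]; exact mul_le_mul_of_nonneg_right (hψ2 b) hsh
      have := abs_sub (deriv ψ (b + s * h) - deriv ψ b) (iteratedDeriv 2 ψ b * (s * h))
      linarith
    have h2 : |h| ≤ 2 * max (|h| - T / 2) 0 := by
      have := le_max_left (|h| - T / 2) 0
      linarith
    have h3 : |δ| * (s * |h|) ≤ s ^ 2 * (8 * c * max (|h| - T / 2) 0 ^ 2) := by
      calc |δ| * (s * |h|) ≤ 2 * c * (s * |h|) * (s * |h|) := by gcongr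
        _ = 2 * c * s ^ 2 * |h| ^ 2 := by ring
        _ ≤ 2 * c * s ^ 2 * (2 * max (|h| - T / 2) 0) ^ 2 := by gcongr
        _ = _ := by ring
    have h4 : 0 ≤ s ^ 2 * (m * h ^ 2) := by positivity
    linarith

/-- The subtracted squared hinge is convex, hence lies above its tangent, and only the quadratic
part contributes upper curvature. This one-sided bound is what Maurey's argument requires, and why a
hinge is preferred to a sharp cutoff. -/
theorem exists_curvature_add_le (hc : 0 ≤ c) (hm : 0 ≤ m)
    (hψ2 : ∀ s, |iteratedDeriv 2 ψ s| ≤ c) (b h : ℝ) :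
    ∃ l, ∀ z, curvature ψ c m T b (h + z) ≤ curvature ψ c m T b h + l * z + c * z ^ 2 := by
  set p := max (|h| - T / 2) 0 with hp
  have hp0 : 0 ≤ p := le_max_right _ _
  set σ : ℝ := ((SignType.sign h : SignType) : ℝ) with hσ
  refine ⟨2 * (iteratedDeriv 2 ψ b - m) * h - 8 * c * (2 * p * σ), fun z => ?_⟩
  have h1 : p ^ 2 + 2 * p * σ * z ≤ max (|h + z| - T / 2) 0 ^ 2 := by
    set p' := max (|h + z| - T / 2) 0 with hp'
    have hσz : |h| + σ * z ≤ |h + z| := by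
      have h3 : σ * h = |h| := sign_mul_self h
      have h4 : |σ| ≤ 1 := by
        rcases lt_trichotomy h 0 with h' | h' | h' <;> simp [hσ, h']
      calc |h| + σ * z = σ * (h + z) := by rw [← h3]; ring
        _ ≤ |σ * (h + z)| := le_abs_self _
        _ = |σ| * |h + z| := abs_mul _ _
        _ ≤ 1 * |h + z| := by gcongr
        _ = _ := one_mul _
    have h3 : |h + z| - T / 2 ≤ p' := le_max_left _ _
    rcases hp0.eq_or_lt with h0 | h0
    · rw [← h0]; simpa using sq_nonneg p'
    · have h4 : p = |h| - T / 2 := by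
        rcases max_choice (|h| - T / 2) 0 with h' | h'
        · exact h'
        · rw [← hp] at h'; linarith
      nlinarith [mul_le_mul_of_nonneg_left (show σ * z ≤ p' - p by linarith) hp0,
        sq_nonneg (p' - p)]
  have h2 : (iteratedDeriv 2 ψ b - m) * z ^ 2 ≤ c * z ^ 2 := by
    have := (abs_le.mp (hψ2 b)).2
    exact mul_le_mul_of_nonneg_right (by linarith) (sq_nonneg z)
  unfold curvature
  nlinarith [mul_le_mul_of_nonneg_left h1 hc]

theorem continuous_curvature (hψ : ContDiff ℝ 3 ψ) :
    Continuous fun p : ℝ × ℝ => curvature ψ c m T p.1 p.2 := by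
  have := continuous_iteratedDeriv_two hψ
  unfold curvature
  fun_prop

end Curvature

section Restricted

variable {d d₃ n k : ℕ} {ψ : ℝ → ℝ} {c m T : ℝ}

/-- The empirical average of the curvature bound in direction `v`. -/
def empiricalCurvature (ψ : ℝ → ℝ) (c m T : ℝ) (X : Fin n → Tensor d d₃) (B₀ v : Tensor d d₃) : ℝ :=
  (1 / (n : ℝ)) * ∑ i, curvature ψ c m T (inner ℝ (X i) B₀) (inner ℝ (X i) v)

/-- The empirical second moment in direction `v`. -/
def empiricalSquare (X : Fin n → Tensor d d₃) (v : Tensor d d₃) : ℝ :=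
  (1 / (n : ℝ)) * ∑ i, inner ℝ (X i) v ^ 2

theorem empiricalSquare_smul (X : Fin n → Tensor d d₃) (t : ℝ) (v : Tensor d d₃) :
    empiricalSquare X (t • v) = t ^ 2 * empiricalSquare X v := by
  simp only [empiricalSquare, inner_smul_right, mul_pow, ← Finset.mul_sum]
  ring

theorem empiricalSquare_sub_le (X : Fin n → Tensor d d₃) (u v : Tensor d d₃) :
    empiricalSquare X (u - v) ≤ 2 * empiricalSquare X u + 2 * empiricalSquare X v := by
  have h : ∑ i, inner ℝ (X i) (u - v) ^ 2 ≤
      2 * ∑ i, inner ℝ (X i) u ^ 2 + 2 * ∑ i, inner ℝ (X i) v ^ 2 := by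
    rw [Finset.mul_sum, Finset.mul_sum, ← Finset.sum_add_distrib]
    refine Finset.sum_le_sum fun i _ => ?_
    rw [inner_sub_right]
    nlinarith [sq_nonneg (inner ℝ (X i) u + inner ℝ (X i) v)]
  calc _ ≤ (1 / (n : ℝ)) * (2 * ∑ i, inner ℝ (X i) u ^ 2 + 2 * ∑ i, inner ℝ (X i) v ^ 2) :=
        mul_le_mul_of_nonneg_left h (by positivity)
    _ = _ := by unfold empiricalSquare; ring

theorem convexOn_empiricalSquare (X : Fin n → Tensor d d₃) :
    ConvexOn ℝ Set.univ (empiricalSquare X) := by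
  refine ⟨convex_univ, fun u _ v _ a b ha hb hab => ?_⟩
  simp only [empiricalSquare, smul_eq_mul]
  rw [mul_left_comm a, mul_left_comm b, ← mul_add, Finset.mul_sum _ _ a, Finset.mul_sum _ _ b,
    ← Finset.sum_add_distrib]
  refine mul_le_mul_of_nonneg_left (Finset.sum_le_sum fun i _ => ?_) (by positivity)
  rw [inner_add_right, inner_smul_right, inner_smul_right]
  have := (even_two.convexOn_pow (𝕜 := ℝ)).2 (Set.mem_univ (inner ℝ (X i) u))
    (Set.mem_univ (inner ℝ (X i) v)) ha hb hab
  simpa using this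

theorem empiricalCurvature_ge (hc : 0 ≤ c) (hm : 0 ≤ m) (hT : 0 ≤ T)
    (hψ2 : ∀ s, |iteratedDeriv 2 ψ s| ≤ c) (X : Fin n → Tensor d d₃) (B₀ v : Tensor d d₃) :
    -((9 * c + m) * empiricalSquare X v) ≤ empiricalCurvature ψ c m T X B₀ v := by
  have h : -((9 * c + m) * ∑ i, inner ℝ (X i) v ^ 2) ≤
      ∑ i, curvature ψ c m T (inner ℝ (X i) B₀) (inner ℝ (X i) v) := by
    rw [Finset.mul_sum, ← Finset.sum_neg_distrib]
    exact Finset.sum_le_sum fun i _ => (abs_le.mp (abs_curvature_le hc hm hT hψ2 _ _)).1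
  calc _ = (1 / (n : ℝ)) * -((9 * c + m) * ∑ i, inner ℝ (X i) v ^ 2) := by
        unfold empiricalSquare; ring
    _ ≤ _ := mul_le_mul_of_nonneg_left h (by positivity)

theorem exists_empiricalCurvature_add_le (hc : 0 ≤ c) (hm : 0 ≤ m)
    (hψ2 : ∀ s, |iteratedDeriv 2 ψ s| ≤ c) (X : Fin n → Tensor d d₃) (B₀ v : Tensor d d₃) :
    ∃ g : Tensor d d₃, ∀ z, empiricalCurvature ψ c m T X B₀ (v + z) ≤
      empiricalCurvature ψ c m T X B₀ v + inner ℝ g z + c * empiricalSquare X z := by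
  choose l hl using fun i => exists_curvature_add_le (T := T) hc hm hψ2 (inner ℝ (X i) B₀)
    (inner ℝ (X i) v)
  refine ⟨(1 / (n : ℝ)) • ∑ i, l i • X i, fun z => ?_⟩
  have h : ∑ i, curvature ψ c m T (inner ℝ (X i) B₀) (inner ℝ (X i) (v + z)) ≤
      ∑ i, curvature ψ c m T (inner ℝ (X i) B₀) (inner ℝ (X i) v) +
      ∑ i, l i * inner ℝ (X i) z + c * ∑ i, inner ℝ (X i) z ^ 2 := by
    rw [Finset.mul_sum, ← Finset.sum_add_distrib, ← Finset.sum_add_distrib]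
    refine Finset.sum_le_sum fun i _ => ?_
    rw [inner_add_right]
    exact hl i _
  have h2 : inner ℝ ((1 / (n : ℝ)) • ∑ i, l i • X i) z =
      (1 / (n : ℝ)) * ∑ i, l i * inner ℝ (X i) z := by
    rw [inner_smul_left, sum_inner]
    simp [inner_smul_left]
  rw [h2]
  calc _ ≤ (1 / (n : ℝ)) * _ := mul_le_mul_of_nonneg_left h (by positivity)
    _ = _ := by unfold empiricalCurvature empiricalSquare; ring

/-- From averages of `k` atoms to all directions in a multiple of the convex hull of the atoms. -/
theorem le_empiricalCurvature_of_forall_average {Λ Λ₀ κ R : ℝ} (hc : 0 ≤ c) (hm : 0 ≤ m)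
    (hT : 0 ≤ T) (hψ2 : ∀ s, |iteratedDeriv 2 ψ s| ≤ c) (hκ : 0 ≤ κ) (hR : 0 < R) (hk : 0 < k)
    (hΛ0 : 0 ≤ Λ) (hΛ : Λ ≤ c * κ)
    (hRk : 1024 * (24 * (9 * c + m) * κ * d₃) * R ^ 2 ≤ k * Λ₀)
    (X : Fin n → Tensor d d₃) (B₀ : Tensor d d₃) (𝒜 : Finset (Tensor d d₃))
    (h𝒜 : ∀ a ∈ 𝒜, ‖a‖ ^ 2 ≤ d₃) (hsq : ∀ a ∈ 𝒜, empiricalSquare X a ≤ 4 * κ * ‖a‖ ^ 2)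
    (hav : ∀ f : Fin k → Tensor d d₃, (∀ i, f i ∈ 𝒜) →
      (‖(4 * R / k) • ∑ i, f i‖ ≤ 2 → Λ * ‖(4 * R / k) • ∑ i, f i‖ ^ 2 - 3 * Λ₀ / 16 ≤
        empiricalCurvature ψ c m T X B₀ ((4 * R / k) • ∑ i, f i)) ∧
      empiricalSquare X ((4 * R / k) • ∑ i, f i) ≤ 4 * κ * ‖(4 * R / k) • ∑ i, f i‖ ^ 2)
    {u : Tensor d d₃} (hu : ‖u‖ = 1)
    (huA : (4 * R)⁻¹ • u ∈ convexHull ℝ (𝒜 : Set (Tensor d d₃))) (hΛ₀ : 0 ≤ Λ₀) :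
    Λ - Λ₀ / 4 ≤ empiricalCurvature ψ c m T X B₀ u := by
  set c' := 9 * c + m with hc'
  have hc'0 : 0 ≤ c' := by positivity
  have hcc' : c ≤ c' := by linarith
  set C₃ := 20 * c' * κ with hC₃
  have hC₃0 : 0 ≤ C₃ := by positivity
  set t : ℝ := 4 * R / k with ht
  have hk' : (0 : ℝ) < k := by exact_mod_cast hk
  have ht0 : 0 ≤ t := by positivity
  -- The term `C₃ ‖v - u‖²` keeps the sparse substitute near `u`: when `‖v‖ > 2`, it is at least `5
  -- c' κ ‖v‖²`, which covers the loss `4 c' κ ‖v‖²` in the curvature and the `Λ ‖v‖²`.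
  set Ψ : Tensor d d₃ → ℝ := fun v =>
    empiricalCurvature ψ c m T X B₀ v - Λ * ‖v‖ ^ 2 + C₃ * ‖v - u‖ ^ 2 with hΨ
  set q : Tensor d d₃ → ℝ := fun z => c * empiricalSquare X z + C₃ * ‖z‖ ^ 2 with hq
  set Q : ℝ := 24 * c' * κ * d₃ with hQ
  have hqA : ∀ a ∈ 𝒜, q a ≤ Q := by
    intro a ha
    have h1 := hsq a ha
    have h2 := h𝒜 a ha
    calc q a ≤ c * (4 * κ * ‖a‖ ^ 2) + C₃ * ‖a‖ ^ 2 := by simp only [hq]; gcongr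
      _ ≤ c' * (4 * κ * ‖a‖ ^ 2) + C₃ * ‖a‖ ^ 2 := by gcongr
      _ = 24 * c' * κ * ‖a‖ ^ 2 := by rw [hC₃]; ring
      _ ≤ Q := by rw [hQ]; gcongr
  have hqconv : ConvexOn ℝ Set.univ q := by
    refine ((convexOn_empiricalSquare X).smul hc).add (ConvexOn.smul hC₃0 ?_)
    exact convexOn_univ_norm.pow (fun _ _ => norm_nonneg _) 2
  have hqm : q ((4 * R)⁻¹ • u) ≤ Q := by
    obtain ⟨a, ha, h⟩ := hqconv.exists_ge_of_mem_convexHull (Set.subset_univ _) huA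
    exact h.trans (hqA a ha)
  have htangent : ∀ x, ∃ g, ∀ z, Ψ (x + z) ≤ Ψ x + inner ℝ g z + q z := by
    intro x
    obtain ⟨g, hg⟩ := exists_empiricalCurvature_add_le (T := T) hc hm hψ2 X B₀ x
    refine ⟨g - (2 * Λ) • x + (2 * C₃) • (x - u), fun z => ?_⟩
    have h1 := hg z
    have h2 : ‖x + z‖ ^ 2 = ‖x‖ ^ 2 + 2 * inner ℝ x z + ‖z‖ ^ 2 := norm_add_sq_real x z
    have h3 : ‖x + z - u‖ ^ 2 = ‖x - u‖ ^ 2 + 2 * inner ℝ (x - u) z + ‖z‖ ^ 2 := by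
      rw [← norm_add_sq_real]; congr 2; abel
    have h4 : inner ℝ (g - (2 * Λ) • x + (2 * C₃) • (x - u)) z =
        inner ℝ g z - 2 * Λ * inner ℝ x z + 2 * C₃ * inner ℝ (x - u) z := by
      rw [inner_add_left, inner_sub_left, inner_smul_left, inner_smul_left]; simp
    simp only [hΨ, hq]
    rw [h2, h3, h4]
    have h5 : 0 ≤ Λ * ‖z‖ ^ 2 := by positivity
    linarith
  have hB : ∀ a ∈ (𝒜 : Set (Tensor d d₃)), q (t • (a - (4 * R)⁻¹ • u)) ≤ t ^ 2 * (4 * Q) := by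
    intro a ha
    have h1 := hqA a ha
    have h2 : q (t • (a - (4 * R)⁻¹ • u)) = t ^ 2 * q (a - (4 * R)⁻¹ • u) := by
      simp only [hq]
      rw [empiricalSquare_smul, norm_smul, mul_pow, Real.norm_eq_abs, sq_abs]; ring
    rw [h2]
    refine mul_le_mul_of_nonneg_left ?_ (sq_nonneg t)
    have h3 := empiricalSquare_sub_le X a ((4 * R)⁻¹ • u)
    have h4 : ‖a - (4 * R)⁻¹ • u‖ ^ 2 ≤ 2 * ‖a‖ ^ 2 + 2 * ‖(4 * R)⁻¹ • u‖ ^ 2 := by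
      have := parallelogram_law_with_norm ℝ a ((4 * R)⁻¹ • u)
      nlinarith [sq_nonneg ‖a + (4 * R)⁻¹ • u‖]
    calc q (a - (4 * R)⁻¹ • u) ≤ 2 * q a + 2 * q ((4 * R)⁻¹ • u) := by
          simp only [hq]
          nlinarith [mul_le_mul_of_nonneg_left h3 hc, mul_le_mul_of_nonneg_left h4 hC₃0]
      _ ≤ _ := by linarith
  obtain ⟨f, hf, hle⟩ := exists_sum_le_of_mem_convexHull huA htangent ht0 hB u k
  -- With `t = 4R/k` the `k` subtracted copies of the hull point add up to `u` and cancel the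
  -- starting point.
  have hpt : u + t • ∑ i, (f i - (4 * R)⁻¹ • u) = t • ∑ i, f i := by
    have h1 : t * k * (4 * R)⁻¹ = 1 := by rw [ht]; field_simp
    rw [Finset.sum_sub_distrib, Finset.sum_const, Finset.card_univ, Fintype.card_fin, smul_sub,
      ← Nat.cast_smul_eq_nsmul ℝ, smul_smul, smul_smul, h1, one_smul]
    abel
  rw [hpt] at hle
  have hkB : k * (t ^ 2 * (4 * Q)) ≤ Λ₀ / 16 := by
    have : k * (t ^ 2 * (4 * Q)) = 64 * Q * R ^ 2 / k := by rw [ht]; field_simp; ring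
    rw [this, div_le_iff₀ hk']
    linarith
  have hΨu : Ψ u = empiricalCurvature ψ c m T X B₀ u - Λ := by
    simp only [hΨ]; rw [hu]; simp
  obtain ⟨hv1, hv2⟩ := hav f hf
  set v := t • ∑ i, f i with hv
  have hlow : -(3 * Λ₀ / 16) ≤ Ψ v := by
    simp only [hΨ]
    rcases le_or_gt ‖v‖ 2 with h2 | h2
    · have := hv1 h2
      have : 0 ≤ C₃ * ‖v - u‖ ^ 2 := by positivity
      linarith
    · have h3 := empiricalCurvature_ge hc hm hT hψ2 X B₀ v
      rw [← hc'] at h3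
      have h4 : c' * empiricalSquare X v ≤ c' * (4 * κ * ‖v‖ ^ 2) := by gcongr
      have h5 : Λ * ‖v‖ ^ 2 ≤ c' * κ * ‖v‖ ^ 2 := by
        refine mul_le_mul_of_nonneg_right (hΛ.trans ?_) (sq_nonneg _)
        gcongr
      have h6 : ‖v‖ / 2 ≤ ‖v - u‖ := by
        have := norm_sub_norm_le v u
        linarith
      have h7 : C₃ * (‖v‖ / 2) ^ 2 ≤ C₃ * ‖v - u‖ ^ 2 := by gcongr
      rw [hC₃] at h7 ⊢
      have h8 : 20 * c' * κ * (‖v‖ / 2) ^ 2 = 5 * (c' * κ * ‖v‖ ^ 2) := by ring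
      linarith
  rw [hΨu] at hle
  linarith

end Restricted

/-! ### Concentration in a fixed direction -/

section Concentration

variable {d d₃ n : ℕ} {ψ : ℝ → ℝ} {w c m T K : ℝ} {ν : Measure ℝ} [SigmaFinite ν]
  {P : Measure (Tensor d d₃)} [IsProbabilityMeasure P] {B₀ : Tensor d d₃}
  {Ω : Type*} [MeasurableSpace Ω] {Pr : Measure Ω}
  {X : Fin n → Ω → Tensor d d₃} {y : Fin n → Ω → ℝ}

theorem measure_gradient_le (hψ : ContDiff ℝ 3 ψ) (hw : 0 < w)
    (hfam : IsExponentialFamily ψ w ν) (hc : 0 < c) (hψ2 : ∀ s, |iteratedDeriv 2 ψ s| ≤ c)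
    (hK : 0 < K) (hP : IsSubGaussian P K)
    (hind : iIndepFun (fun i ω => (X i ω, y i ω)) Pr)
    (hlaw : ∀ i, HasLaw (fun ω => (X i ω, y i ω)) (glmLaw P ν ψ w B₀) Pr)
    (hd₃ : 1 ≤ d₃) (hn : 0 < n) (hnd : c * w * (2 * K) ^ 2 * d ≤ n) (q : ℝ)
    {a : Tensor d d₃} (ha : ‖a‖ ^ 2 ≤ d₃) :
    Pr {ω | q * Real.sqrt ((d : ℝ) * d₃ / n) ≤ (1 / (n : ℝ)) *
        ∑ i, (y i ω - deriv ψ (inner ℝ (X i ω) B₀)) * inner ℝ (X i ω) a} ≤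
      ENNReal.ofReal (Real.exp ((c * w * (2 * K) ^ 2 - q) * d)) := by
  have hdc := continuous_deriv_cumulant hψ
  have hn' : (0 : ℝ) < n := by exact_mod_cast hn
  have hd₃' : (0 : ℝ) < d₃ := by exact_mod_cast hd₃
  -- With this `t` the threshold becomes `q d` while the total log-moment is only `c w (2K)² d`, so
  -- `q` controls the rate in `d`.
  set t : ℝ := Real.sqrt ((d : ℝ) / (n * d₃)) with ht
  have ht0 : 0 ≤ t := Real.sqrt_nonneg _
  have ht2 : t ^ 2 = (d : ℝ) / (n * d₃) := Real.sq_sqrt (by positivity)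
  set s : ℝ := c * w * (2 * K) ^ 2 * d / n with hs
  have hs1 : s ≤ 1 := by rw [hs, div_le_one hn']; exact hnd
  have hs0 : 0 ≤ s := by positivity
  have hb : ∫⁻ p, ENNReal.ofReal (Real.exp (t * ((p.2 - deriv ψ (inner ℝ p.1 B₀)) *
      inner ℝ p.1 a))) ∂(glmLaw P ν ψ w B₀) ≤ ENNReal.ofReal (Real.exp s) := by
    refine (lintegral_glmLaw_exp_le hψ hw hc hfam hψ2 a t).trans ?_
    have hnorm : ‖a‖ ≤ Real.sqrt d₃ := Real.le_sqrt_of_sq_le ha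
    refine le_trans (le_of_eq ?_) (hP.lintegral_exp_mul_le hK (Real.sqrt_pos.mpr hd₃') hnorm hs0 hs1)
    refine lintegral_congr fun x => ?_
    rw [Real.sq_sqrt hd₃'.le, ht2, hs]
    congr 2
    field_simp
  have h1 := measure_sum_ge_le hind hlaw (f := fun p => t * ((p.2 - deriv ψ (inner ℝ p.1 B₀)) *
      inner ℝ p.1 a)) (by fun_prop) hb (q * d)
  have htq : t * n * Real.sqrt ((d : ℝ) * d₃ / n) = d := by
    have : t * Real.sqrt ((d : ℝ) * d₃ / n) = d / n := by
      rw [ht, ← Real.sqrt_mul (by positivity)]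
      have h2 : (d : ℝ) / (n * d₃) * (d * d₃ / n) = ((d : ℝ) / n) ^ 2 := by field_simp
      rw [h2, Real.sqrt_sq (by positivity)]
    rw [mul_right_comm, this]; field_simp
  refine (measure_mono fun ω hω => ?_).trans (h1.trans (le_of_eq ?_))
  · simp only [Set.mem_ofPred_eq] at hω ⊢
    rw [← Finset.mul_sum]
    calc q * d = t * n * (q * Real.sqrt ((d : ℝ) * d₃ / n)) := by rw [mul_left_comm, htq]
      _ ≤ t * n * _ := mul_le_mul_of_nonneg_left hω (by positivity)
      _ = _ := by field_simp
  · congr 2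
    rw [hs]; field_simp

theorem measure_empiricalSquare_le (hψ : Continuous ψ) (hfam : IsExponentialFamily ψ w ν)
    (hK : 0 < K) (hP : IsSubGaussian P K)
    (hind : iIndepFun (fun i ω => (X i ω, y i ω)) Pr)
    (hlaw : ∀ i, HasLaw (fun ω => (X i ω, y i ω)) (glmLaw P ν ψ w B₀) Pr) (hn : 0 < n)
    (v : Tensor d d₃) :
    Pr {ω | 4 * (2 * K) ^ 2 * ‖v‖ ^ 2 < empiricalSquare (fun i => X i ω) v} ≤
      ENNReal.ofReal (Real.exp (-(3 * n))) := by
  have hn' : (0 : ℝ) < n := by exact_mod_cast hn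
  rcases eq_or_ne v 0 with rfl | hv
  · simp [empiricalSquare]
  have hv' : 0 < ‖v‖ := norm_pos_iff.mpr hv
  have hb : ∫⁻ p : Tensor d d₃ × ℝ, ENNReal.ofReal (Real.exp
      (inner ℝ p.1 v ^ 2 / ((2 * K) ^ 2 * ‖v‖ ^ 2))) ∂(glmLaw P ν ψ w B₀) ≤
      ENNReal.ofReal (Real.exp 1) := by
    rw [lintegral_glmLaw_fst (f := fun x => ENNReal.ofReal (Real.exp
      (inner ℝ x v ^ 2 / ((2 * K) ^ 2 * ‖v‖ ^ 2)))) hψ hfam (by fun_prop)]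
    simpa using hP.lintegral_exp_mul_le hK hv' le_rfl zero_le_one le_rfl
  have h1 := measure_sum_ge_le hind hlaw (f := fun p => inner ℝ p.1 v ^ 2 /
    ((2 * K) ^ 2 * ‖v‖ ^ 2)) (by fun_prop) hb (4 * n)
  refine (measure_mono fun ω hω => ?_).trans (h1.trans (le_of_eq ?_))
  · simp only [Set.mem_ofPred_eq] at hω ⊢
    rw [← Finset.sum_div, le_div_iff₀ (by positivity)]
    unfold empiricalSquare at hω
    rw [one_div, ← div_eq_inv_mul, lt_div_iff₀ hn'] at hω
    linarith
  · congr 2; ring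

/-- The hinge is dominated by `4 h⁴ / T²`, so second and fourth moments suffice. For `‖v‖ ≤ 2` the
terms with `m` and with `T` each cost at most `Λ₀/16`. -/
theorem le_integral_curvature (hψ : ContDiff ℝ 3 ψ) (hc : 0 < c)
    (hψ2 : ∀ s, |iteratedDeriv 2 ψ s| ≤ c) (hK : 0 < K) (hP : IsSubGaussian P K) (hm : 0 ≤ m)
    (hT : 0 < T) {Λ₀ : ℝ} (hmΛ : 64 * (m * (2 * K) ^ 2) ≤ Λ₀)
    (hTΛ : 16384 * (c * ((2 * K) ^ 2) ^ 2) ≤ Λ₀ * T ^ 2) {v : Tensor d d₃} (hv : ‖v‖ ≤ 2) :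
    smallestEigenvalue (expectedHessian P ψ B₀) * ‖v‖ ^ 2 - Λ₀ / 8 ≤
      ∫ x, curvature ψ c m T (inner ℝ x B₀) (inner ℝ x v) ∂P := by
  have hc2 := continuous_iteratedDeriv_two hψ
  have hcc := continuous_curvature (c := c) (m := m) (T := T) hψ
  obtain ⟨i2, i4, b2, b4⟩ := hP.moments hK (by norm_num : (0 : ℝ) < 2) hv
  set κ := (2 * K) ^ 2 with hκ
  have hpt : ∀ x : Tensor d d₃, iteratedDeriv 2 ψ (inner ℝ x B₀) * inner ℝ x v ^ 2
      - m * inner ℝ x v ^ 2 - 8 * c * (4 / T ^ 2) * inner ℝ x v ^ 4 ≤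
      curvature ψ c m T (inner ℝ x B₀) (inner ℝ x v) := by
    intro x
    set h : ℝ := inner ℝ x v with hh
    have h1 : max (|h| - T / 2) 0 ^ 2 ≤ 4 / T ^ 2 * h ^ 4 := by
      rcases le_or_gt (|h| - T / 2) 0 with h0 | h0
      · rw [max_eq_right h0, zero_pow two_ne_zero]; positivity
      · rw [max_eq_left h0.le]
        have h2 : T ≤ 2 * |h| := by linarith
        have h3 : (|h| - T / 2) ^ 2 ≤ |h| ^ 2 := pow_le_pow_left₀ h0.le (by linarith) 2
        have h4 : T ^ 2 ≤ 4 * |h| ^ 2 := by nlinarith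
        rw [div_mul_eq_mul_div, le_div_iff₀ (by positivity)]
        calc (|h| - T / 2) ^ 2 * T ^ 2 ≤ |h| ^ 2 * (4 * |h| ^ 2) := by gcongr
          _ = 4 * (|h| ^ 2) ^ 2 := by ring
          _ = _ := by rw [sq_abs]; ring
    unfold curvature
    have := mul_le_mul_of_nonneg_left h1 (show 0 ≤ 8 * c by positivity)
    linarith
  have iH : Integrable (fun x : Tensor d d₃ =>
      iteratedDeriv 2 ψ (inner ℝ x B₀) * inner ℝ x v ^ 2) P := by
    refine (i2.const_mul c).mono' (Continuous.aestronglyMeasurable (by fun_prop))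
      (ae_of_all _ fun x => ?_)
    rw [Real.norm_eq_abs, abs_mul, abs_of_nonneg (sq_nonneg (inner ℝ x v))]
    exact mul_le_mul_of_nonneg_right (hψ2 _) (sq_nonneg _)
  have iC : Integrable (fun x : Tensor d d₃ =>
      curvature ψ c m T (inner ℝ x B₀) (inner ℝ x v)) P := by
    refine (i2.const_mul (9 * c + m)).mono' (Continuous.aestronglyMeasurable
      (hcc.comp (f := fun x : Tensor d d₃ => (inner ℝ x B₀, inner ℝ x v)) (by fun_prop)))
      (ae_of_all _ fun x => ?_)
    rw [Real.norm_eq_abs]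
    exact abs_curvature_le hc.le hm hT.le hψ2 _ _
  have i1 : Integrable (fun x : Tensor d d₃ => iteratedDeriv 2 ψ (inner ℝ x B₀) * inner ℝ x v ^ 2
      - m * inner ℝ x v ^ 2) P := iH.sub (i2.const_mul m)
  have h1 := integral_mono (i1.sub (i4.const_mul (8 * c * (4 / T ^ 2)))) iC hpt
  refine le_trans ?_ h1
  have h2 : ∫ x, (iteratedDeriv 2 ψ (inner ℝ x B₀) * inner ℝ x v ^ 2
      - m * inner ℝ x v ^ 2 - 8 * c * (4 / T ^ 2) * inner ℝ x v ^ 4) ∂P =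
      ∫ x, iteratedDeriv 2 ψ (inner ℝ x B₀) * inner ℝ x v ^ 2 ∂P -
      m * ∫ x, inner ℝ x v ^ 2 ∂P - 8 * c * (4 / T ^ 2) * ∫ x, inner ℝ x v ^ 4 ∂P := by
    rw [integral_sub i1 (i4.const_mul _), integral_sub iH (i2.const_mul m), integral_const_mul,
      integral_const_mul]
  refine le_trans ?_ h2.ge
  have h3 := smallestEigenvalue_expectedHessian_mul_le hP hK hψ hψ2 B₀ v
  have h4 : m * ∫ x, inner ℝ x v ^ 2 ∂P ≤ Λ₀ / 16 := by
    have := mul_le_mul_of_nonneg_left b2 hm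
    linarith
  have h5 : 8 * c * (4 / T ^ 2) * ∫ x, inner ℝ x v ^ 4 ∂P ≤ Λ₀ / 16 := by
    calc _ ≤ 8 * c * (4 / T ^ 2) * (2 * (κ * 2 ^ 2) ^ 2) := by gcongr
      _ = 1024 * (c * κ ^ 2) / T ^ 2 := by ring
      _ ≤ _ := by
        rw [div_le_div_iff₀ (by positivity) (by norm_num)]
        linarith
  linarith

/-- The slack `3Λ₀/16` splits into `Λ₀/8` of bias and `Λ₀/16` of random deviation. -/
theorem measure_empiricalCurvature_le (hψ : ContDiff ℝ 3 ψ) (hc : 0 < c)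
    (hfam : IsExponentialFamily ψ w ν)
    (hψ2 : ∀ s, |iteratedDeriv 2 ψ s| ≤ c) (hK : 0 < K) (hP : IsSubGaussian P K) (hm : 0 ≤ m)
    (hT : 0 < T) {Λ₀ : ℝ} (hmΛ : 64 * (m * (2 * K) ^ 2) ≤ Λ₀)
    (hTΛ : 16384 * (c * ((2 * K) ^ 2) ^ 2) ≤ Λ₀ * T ^ 2)
    (hind : iIndepFun (fun i ω => (X i ω, y i ω)) Pr)
    (hlaw : ∀ i, HasLaw (fun ω => (X i ω, y i ω)) (glmLaw P ν ψ w B₀) Pr) (hn : 0 < n)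
    {η : ℝ} (hη0 : 0 ≤ η) (hη1 : η ≤ 1) (hη : η * (64 * (9 * c + m) * (2 * K) ^ 2) ≤ Λ₀)
    {v : Tensor d d₃} (hv : ‖v‖ ≤ 2) :
    Pr {ω | empiricalCurvature ψ c m T (fun i => X i ω) B₀ v <
        smallestEigenvalue (expectedHessian P ψ B₀) * ‖v‖ ^ 2 - 3 * Λ₀ / 16} ≤
      ENNReal.ofReal (Real.exp (-(n * (η ^ 2 / 64)))) := by
  have hn' : (0 : ℝ) < n := by exact_mod_cast hn
  have hcc := continuous_curvature (c := c) (m := m) (T := T) hψ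
  set Λ := smallestEigenvalue (expectedHessian P ψ B₀) with hΛ
  set D : ℝ := 4 * (9 * c + m) * (2 * K) ^ 2 with hD
  have hD0 : 0 < D := by positivity
  set Z : Tensor d d₃ → ℝ := fun x => curvature ψ c m T (inner ℝ x B₀) (inner ℝ x v) / D with hZ
  have hZm : Measurable Z := (Continuous.measurable
    (hcc.comp (f := fun x : Tensor d d₃ => (inner ℝ x B₀, inner ℝ x v)) (by fun_prop))).div_const D
  set e : ℝ := (Λ * ‖v‖ ^ 2 - Λ₀ / 8) / D with he
  have hmean : e ≤ ∫ x, Z x ∂P := by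
    rw [hZ, integral_div]
    exact div_le_div_of_nonneg_right
      (le_integral_curvature hψ hc hψ2 hK hP hm hT hmΛ hTΛ hv) hD0.le
  have hZY : ∀ x, |Z x| ≤ inner ℝ x v ^ 2 / ((2 * K) ^ 2 * 2 ^ 2) := by
    intro x
    simp only [hZ]
    rw [abs_div, abs_of_pos hD0, div_le_div_iff₀ hD0 (by positivity)]
    have := abs_curvature_le hc.le hm hT.le hψ2 (inner ℝ x B₀) (inner ℝ x v)
    calc _ ≤ (9 * c + m) * inner ℝ x v ^ 2 * ((2 * K) ^ 2 * 2 ^ 2) := by gcongr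
      _ = _ := by rw [hD]; ring
  -- This minimises the Chernoff exponent `16 θ² - θ η`, with value `-η²/64`.
  set θ := η / 32 with hθ
  have hexp := lintegral_exp_neg_mul_le hZm (by fun_prop) hZY
    (hP.lintegral_exp_le hK (by norm_num : (0 : ℝ) < 2) hv) hmean (θ := θ) (by positivity)
    (by rw [hθ]; linarith)
  have hb : ∫⁻ p : Tensor d d₃ × ℝ, ENNReal.ofReal (Real.exp (-(θ * Z p.1)))
      ∂(glmLaw P ν ψ w B₀) ≤ ENNReal.ofReal (Real.exp (-(θ * e) + 16 * θ ^ 2)) := by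
    rw [lintegral_glmLaw_fst (f := fun x => ENNReal.ofReal (Real.exp (-(θ * Z x))))
      hψ.continuous hfam (by fun_prop)]
    exact hexp
  have h1 := measure_sum_ge_le hind hlaw (f := fun p => -(θ * Z p.1)) (by fun_prop) hb
    (-(θ * (n * (e - η))))
  refine (measure_mono fun ω hω => ?_).trans (h1.trans (le_of_eq ?_))
  · simp only [Set.mem_ofPred_eq] at hω ⊢
    rw [Finset.sum_neg_distrib, ← Finset.mul_sum]
    refine neg_le_neg (mul_le_mul_of_nonneg_left ?_ (by positivity))
    unfold empiricalCurvature at hω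
    rw [one_div, ← div_eq_inv_mul, div_lt_iff₀ hn'] at hω
    have hη' : η ≤ Λ₀ / 16 / D := by
      rw [le_div_iff₀ hD0, hD]; linarith
    calc ∑ i, Z (X i ω) = (∑ i, curvature ψ c m T (inner ℝ (X i ω) B₀) (inner ℝ (X i ω) v)) / D := by
          simp only [hZ]; rw [Finset.sum_div]
      _ ≤ (Λ * ‖v‖ ^ 2 - 3 * Λ₀ / 16) * n / D := div_le_div_of_nonneg_right hω.le hD0.le
      _ = n * (e - Λ₀ / 16 / D) := by rw [he]; ring
      _ ≤ _ := by gcongr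
  · congr 2
    rw [hθ]; ring

end Concentration

/-! ### Error bounds on the good event -/

section Deterministic

variable {d d₃ n k r : ℕ} {ψ : ℝ → ℝ} {c m T M κ Λ Λ₀ R α β lam Cρ μ : ℝ} {ρ : ℝ → ℝ}

/-- Restricted strong convexity of the empirical risk, up to a multiple of the nuclear norm. -/
theorem le_predictionError (hψ : ContDiff ℝ 3 ψ) (hmono : Monotone (deriv ψ)) (hc : 0 ≤ c)
    (hψ2 : ∀ s, |iteratedDeriv 2 ψ s| ≤ c) (hM : 0 ≤ M) (hψ3 : ∀ s, |iteratedDeriv 3 ψ s| ≤ M)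
    (hm : 0 ≤ m) (hT : 0 ≤ T) (hMT : M * β * T ≤ m) (hκ : 0 ≤ κ)
    (hΛ₀ : 0 ≤ Λ₀) (hΛ : Λ ≤ c * κ) {τ : ℝ} (hβR : c * κ * β ≤ R * τ)
    (X : Fin n → Tensor d d₃) (y : Fin n → ℝ) (B B₀ : Tensor d d₃) (hB : ‖B - B₀‖ ≤ β)
    (hcurv : ∀ u : Tensor d d₃, 0 < ‖B - B₀‖ → ‖u‖ = 1 → nuclearNorm (‖B - B₀‖ • u) ≤ R * ‖B - B₀‖ →
      Λ - Λ₀ / 4 ≤ empiricalCurvature ψ c m T X B₀ u) (hτ : 0 ≤ τ) :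
    (Λ - Λ₀ / 4) * ‖B - B₀‖ ^ 2 - τ * nuclearNorm (B - B₀) ≤
      predictionError (empiricalRisk ψ X y) B B₀ := by
  rw [predictionError_eq hψ X y B B₀]
  set Δ := B - B₀ with hΔ
  set s := ‖Δ‖ with hs
  have hs0 : 0 ≤ s := norm_nonneg _
  have hN0 := nuclearNorm_nonneg Δ
  have hPE : 0 ≤ (1 / (n : ℝ)) * ∑ i,
      (deriv ψ (inner ℝ (X i) B₀ + inner ℝ (X i) Δ) - deriv ψ (inner ℝ (X i) B₀)) *
        inner ℝ (X i) Δ := by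
    refine mul_nonneg (by positivity) (Finset.sum_nonneg fun i _ => ?_)
    rcases le_total 0 (inner ℝ (X i) Δ) with h | h
    · exact mul_nonneg (sub_nonneg.mpr (hmono (by linarith))) h
    · exact mul_nonneg_of_nonpos_of_nonpos (sub_nonpos.mpr (hmono (by linarith))) h
  rcases hs0.eq_or_lt with h0 | h0
  · rw [← h0]
    have := mul_nonneg hτ hN0
    simpa using le_trans (by linarith) hPE
  rcases le_or_gt (nuclearNorm Δ) (R * s) with hle | hgt
  · set u := s⁻¹ • Δ with hu
    have hsu : s • u = Δ := by rw [hu, smul_smul, mul_inv_cancel₀ h0.ne', one_smul]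
    have hu1 : ‖u‖ = 1 := by
      rw [hu, norm_smul, norm_inv, Real.norm_of_nonneg hs0, ← hs, inv_mul_cancel₀ h0.ne']
    have h1 := hcurv u h0 hu1 (by rwa [hsu])
    have h2 : s ^ 2 * empiricalCurvature ψ c m T X B₀ u ≤ (1 / (n : ℝ)) * ∑ i,
        (deriv ψ (inner ℝ (X i) B₀ + inner ℝ (X i) Δ) - deriv ψ (inner ℝ (X i) B₀)) *
        inner ℝ (X i) Δ := by
      unfold empiricalCurvature
      rw [mul_left_comm, Finset.mul_sum]
      refine mul_le_mul_of_nonneg_left (Finset.sum_le_sum fun i _ => ?_) (by positivity)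
      have h3 : inner ℝ (X i) Δ = s * inner ℝ (X i) u := by rw [← hsu, inner_smul_right]
      rw [h3]
      refine sq_mul_curvature_le hψ hc hψ2 hM hψ3 hm hs0 (le_trans ?_ hMT) _ _
      gcongr
    have h3 := mul_le_mul_of_nonneg_left h1 (sq_nonneg s)
    have := mul_nonneg hτ hN0
    linarith
  -- Outside the cone the nuclear norm term dominates the curvature, because `s ≤ β` and `c κ β ≤ R
  -- τ`.
  · have h1 : Λ * s ^ 2 ≤ τ * nuclearNorm Δ := by
      calc Λ * s ^ 2 ≤ c * κ * s ^ 2 := by gcongr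
        _ = c * κ * s * s := by ring
        _ ≤ c * κ * β * s := by gcongr
        _ ≤ R * τ * s := by gcongr
        _ = τ * (R * s) := by ring
        _ ≤ _ := by gcongr
    have h2 : 0 ≤ Λ₀ / 4 * s ^ 2 := by positivity
    linarith

/-- A stationary point almost minimises the risk in the sense of the basic inequality. -/
theorem predictionError_le_of_isStationaryPoint (hd₃ : 1 ≤ d₃) (hψ : ContDiff ℝ 3 ψ)
    (hpen : IsPenalty ρ lam Cρ μ) (hμ : 0 ≤ μ) {X : Fin n → Tensor d d₃} {y : Fin n → ℝ}
    {B B₀ : Tensor d d₃}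
    (hB : IsStationaryPoint (fun B => empiricalRisk ψ X y B + regularizer ρ B) B)
    {𝒜 : Finset (Tensor d d₃)} (h𝒜 : ∀ (G D : Tensor d d₃) (α : ℝ),
      (∀ a ∈ 𝒜, inner ℝ G a ≤ α) → inner ℝ G D ≤ 4 * α * nuclearNorm D)
    (hgrad : ∀ a ∈ 𝒜, (1 / (n : ℝ)) *
      ∑ i, (y i - deriv ψ (inner ℝ (X i) B₀)) * inner ℝ (X i) a ≤ α) :
    predictionError (empiricalRisk ψ X y) B B₀ ≤ regularizer ρ B₀ - regularizer ρ B +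
      μ / 2 * ‖B - B₀‖ ^ 2 + 4 * α * nuclearNorm (B - B₀) := by
  have hdc := continuous_deriv_cumulant hψ
  have h1 := inner_gradient_le_of_isStationaryPoint (hasGradientAt_empiricalRisk hψ X y)
    (by fun_prop) (convexOn_regularizer hd₃ hpen.even hpen.weakly_convex) hB hμ B₀
  have h2 := h𝒜 (-((1 / (n : ℝ)) • ∑ i, (deriv ψ (inner ℝ (X i) B₀) - y i) • X i)) (B - B₀) α
    fun a ha => by
      refine le_trans (le_of_eq ?_) (hgrad a ha)
      rw [inner_neg_left, inner_smul_left, sum_inner, conj_trivial, ← mul_neg,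
        ← Finset.sum_neg_distrib]
      congr 1
      refine Finset.sum_congr rfl fun i _ => ?_
      rw [inner_smul_left, conj_trivial]; ring
  rw [inner_neg_left] at h2
  rw [predictionError, (hasGradientAt_empiricalRisk hψ X y B).gradient,
    (hasGradientAt_empiricalRisk hψ X y B₀).gradient, inner_sub_left]
  linarith

end Deterministic

/-! ### The exceptional event -/

theorem measure_biUnion_le_exp {Ω ι : Type*} [MeasurableSpace Ω] {Pr : Measure Ω} {I : Finset ι}
    {s : ι → Set Ω} {p q e : ℝ} (hI : (I.card : ℝ) ≤ Real.exp q)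
    (h : ∀ i ∈ I, Pr (s i) ≤ ENNReal.ofReal (Real.exp p)) (he : q + p ≤ -e) :
    Pr (⋃ i ∈ I, s i) ≤ ENNReal.ofReal (Real.exp (-e)) := by
  refine (measure_biUnion_finset_le I s).trans ((Finset.sum_le_card_nsmul I _ _ h).trans ?_)
  rw [nsmul_eq_mul, ← ENNReal.ofReal_natCast, ← ENNReal.ofReal_mul (Nat.cast_nonneg _)]
  refine ENNReal.ofReal_le_ofReal ?_
  calc (I.card : ℝ) * Real.exp p ≤ Real.exp q * Real.exp p := by gcongr
    _ = Real.exp (q + p) := (Real.exp_add _ _).symm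
    _ ≤ _ := Real.exp_le_exp.mpr he

theorem card_piFinset_le_exp {ι : Type*} (I : Finset ι) (k : ℕ) {q : ℝ}
    (hI : (I.card : ℝ) ≤ Real.exp q) :
    ((Fintype.piFinset fun _ : Fin k => I).card : ℝ) ≤ Real.exp (k * q) := by
  rw [Fintype.card_piFinset_const, Nat.cast_pow, Real.exp_nat_mul]
  exact pow_le_pow_left₀ (Nat.cast_nonneg _) hI k

/-- Obtained by testing on a coordinate tensor. The bound serves where curvature is not available:
outside the nuclear norm cone and for sparse substitutes of norm above 2. -/
theorem smallestEigenvalue_expectedHessian_le {d d₃ : ℕ} {ψ : ℝ → ℝ} {c K : ℝ} (hd : 1 ≤ d)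
    (hd₃ : 1 ≤ d₃) {P : Measure (Tensor d d₃)} [IsProbabilityMeasure P] (hP : IsSubGaussian P K)
    (hK : 0 < K) (hψ : ContDiff ℝ 3 ψ) (hc : 0 ≤ c) (hψ2 : ∀ s, |iteratedDeriv 2 ψ s| ≤ c)
    (B₀ : Tensor d d₃) :
    smallestEigenvalue (expectedHessian P ψ B₀) ≤ c * (2 * K) ^ 2 := by
  have hc2 := continuous_iteratedDeriv_two hψ
  set v : Tensor d d₃ := EuclideanSpace.single (⟨0, hd⟩, ⟨0, hd⟩, ⟨0, hd₃⟩) 1 with hv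
  have hv1 : ‖v‖ = 1 := by simp [hv]
  obtain ⟨i2, -, b2, -⟩ := hP.moments hK one_pos hv1.le
  have h1 := smallestEigenvalue_expectedHessian_mul_le hP hK hψ hψ2 B₀ v
  have hpt : ∀ x : Tensor d d₃, |iteratedDeriv 2 ψ (inner ℝ x B₀) * inner ℝ x v ^ 2| ≤
      c * inner ℝ x v ^ 2 := fun x => by
    rw [abs_mul, abs_of_nonneg (sq_nonneg (inner ℝ x v))]
    exact mul_le_mul_of_nonneg_right (hψ2 _) (sq_nonneg _)
  have h2 : ∫ x, iteratedDeriv 2 ψ (inner ℝ x B₀) * inner ℝ x v ^ 2 ∂P ≤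
      ∫ x, c * inner ℝ x v ^ 2 ∂P :=
    integral_mono ((i2.const_mul c).mono' (Continuous.aestronglyMeasurable (by fun_prop))
      (ae_of_all _ hpt)) (i2.const_mul c) fun x => (le_abs_self _).trans (hpt x)
  rw [integral_const_mul] at h2
  have h3 := mul_le_mul_of_nonneg_left b2 hc
  rw [hv1] at h1
  linarith

section Exceptional

variable {d d₃ n k r : ℕ} {ψ ρ : ℝ → ℝ} {w c m T M K Λ₀ R β η D q e lam Cρ μ : ℝ}
  {ν : Measure ℝ} [SigmaFinite ν]
  {P : Measure (Tensor d d₃)} [IsProbabilityMeasure P] {B₀ : Tensor d d₃}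
  {Ω : Type*} [MeasurableSpace Ω] {Pr : Measure Ω}
  {X : Fin n → Ω → Tensor d d₃} {y : Fin n → Ω → ℝ}

theorem measure_exists_isStationaryPoint_le (hψ : ContDiff ℝ 3 ψ) (hw : 0 < w)
    (hfam : IsExponentialFamily ψ w ν) (hc : 0 < c) (hψ2 : ∀ s, |iteratedDeriv 2 ψ s| ≤ c)
    (hM : 0 ≤ M) (hψ3 : ∀ s, |iteratedDeriv 3 ψ s| ≤ M) (hK : 0 < K) (hμ : 0 < μ) (hCρ : 0 < Cρ)
    (hμΛ : 3 * μ < 4 * Λ₀) (hd : 1 ≤ d) (hd₃ : 1 ≤ d₃) (hn : 0 < n)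
    (hind : iIndepFun (fun i ω => (X i ω, y i ω)) Pr)
    (hlaw : ∀ i, HasLaw (fun ω => (X i ω, y i ω)) (glmLaw P ν ψ w B₀) Pr)
    (hP : IsSubGaussian P K) (hr : tubalRank B₀ = r)
    (hΛ : Λ₀ ≤ smallestEigenvalue (expectedHessian P ψ B₀)) (hpen : IsPenalty ρ lam Cρ μ)
    (hlam : 0 < lam) (hm : 0 < m) (hT : 0 < T) (hmΛ : 64 * (m * (2 * K) ^ 2) ≤ Λ₀)
    (hTΛ : 16384 * (c * ((2 * K) ^ 2) ^ 2) ≤ Λ₀ * T ^ 2) (hMT : M * β * T ≤ m)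
    (hη0 : 0 ≤ η) (hη1 : η ≤ 1) (hη : η * (64 * (9 * c + m) * (2 * K) ^ 2) ≤ Λ₀)
    (hR : 0 < R) (hk : 0 < k)
    (hRk : 1024 * (24 * (9 * c + m) * (2 * K) ^ 2 * d₃) * R ^ 2 ≤ k * Λ₀)
    (hβR : c * (2 * K) ^ 2 * β ≤ R * (1 / 16 * (lam * Cρ)))
    (hq : 4 * (q * Real.sqrt ((d : ℝ) * d₃ / n)) ≤ 1 / 16 * (lam * Cρ))
    (hcard : (d₃ * 625 ^ d : ℝ) ≤ Real.exp (D * d)) (hnd : c * w * (2 * K) ^ 2 * d ≤ n)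
    (he₁ : D * d + (c * w * (2 * K) ^ 2 - q) * d ≤ -e) (he₂ : D * d + -(3 * n) ≤ -e)
    (he₃ : k * (D * d) + -(n * (η ^ 2 / 64)) ≤ -e) :
    Pr {ω | ∃ Bh : Tensor d d₃, ‖Bh - B₀‖ ≤ β ∧
      IsStationaryPoint (fun B => empiricalRisk ψ (fun i => X i ω) (fun i => y i ω) B
        + regularizer ρ B) Bh ∧
      ¬ (‖Bh - B₀‖ ≤ 100 * (Cρ * lam * Real.sqrt r) /
            (4 * smallestEigenvalue (expectedHessian P ψ B₀) - 3 * μ) ∧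
          nuclearNorm (Bh - B₀) ≤ 100 * (Cρ * lam * r) /
            (4 * smallestEigenvalue (expectedHessian P ψ B₀) - 3 * μ) ∧
          predictionError (empiricalRisk ψ (fun i => X i ω) (fun i => y i ω)) Bh B₀ ≤
            Cρ ^ 2 * lam ^ 2 * r *
              (100 / (4 * smallestEigenvalue (expectedHessian P ψ B₀) - 3 * μ) +
                100 * μ / (4 * smallestEigenvalue (expectedHessian P ψ B₀) - 3 * μ) ^ 2))} ≤
      ENNReal.ofReal (4 * Real.exp (-e)) := by
  obtain ⟨𝒜, hne, h𝒜card, h𝒜norm, h𝒜⟩ := exists_dictionary d d₃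
  have hΛ₀ : 0 < Λ₀ := by linarith
  have hcard' : (𝒜.card : ℝ) ≤ Real.exp (D * d) := by
    refine le_trans ?_ hcard
    exact_mod_cast h𝒜card
  have hcardk := card_piFinset_le_exp 𝒜 k hcard'
  set Λ := smallestEigenvalue (expectedHessian P ψ B₀) with hΛdef
  have hΛc : Λ ≤ c * (2 * K) ^ 2 :=
    smallestEigenvalue_expectedHessian_le hd hd₃ hP hK hψ hc.le hψ2 B₀
  set v : (Fin k → Tensor d d₃) → Tensor d d₃ := fun f => (4 * R / k) • ∑ i, f i with hv
  -- Four bad events: a large gradient on an atom, a large second moment on an atom, and too small a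
  -- curvature or too large a second moment at an average of `k` atoms.
  set S₁ : Set Ω := ⋃ a ∈ 𝒜, {ω | q * Real.sqrt ((d : ℝ) * d₃ / n) ≤ (1 / (n : ℝ)) *
    ∑ i, (y i ω - deriv ψ (inner ℝ (X i ω) B₀)) * inner ℝ (X i ω) a} with hS₁
  set S₂ : Set Ω := ⋃ a ∈ 𝒜,
    {ω | 4 * (2 * K) ^ 2 * ‖a‖ ^ 2 < empiricalSquare (fun i => X i ω) a} with hS₂
  set S₃ : Set Ω := ⋃ f ∈ Fintype.piFinset fun _ : Fin k => 𝒜, {ω | ‖v f‖ ≤ 2 ∧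
    empiricalCurvature ψ c m T (fun i => X i ω) B₀ (v f) < Λ * ‖v f‖ ^ 2 - 3 * Λ₀ / 16} with hS₃
  set S₄ : Set Ω := ⋃ f ∈ Fintype.piFinset fun _ : Fin k => 𝒜,
    {ω | 4 * (2 * K) ^ 2 * ‖v f‖ ^ 2 < empiricalSquare (fun i => X i ω) (v f)} with hS₄
  have m₁ : Pr S₁ ≤ ENNReal.ofReal (Real.exp (-e)) :=
    measure_biUnion_le_exp hcard' (fun a ha => measure_gradient_le hψ hw hfam hc hψ2 hK hP hind
      hlaw hd₃ hn hnd q (h𝒜norm a ha)) he₁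
  have m₂ : Pr S₂ ≤ ENNReal.ofReal (Real.exp (-e)) :=
    measure_biUnion_le_exp hcard' (fun a _ => measure_empiricalSquare_le hψ.continuous hfam hK hP
      hind hlaw hn a) he₂
  have m₃ : Pr S₃ ≤ ENNReal.ofReal (Real.exp (-e)) := by
    refine measure_biUnion_le_exp hcardk (fun f _ => ?_) he₃
    by_cases hf : ‖v f‖ ≤ 2
    · refine (measure_mono fun ω hω => ?_).trans (measure_empiricalCurvature_le hψ hc hfam hψ2 hK hP
        hm.le hT hmΛ hTΛ hind hlaw hn hη0 hη1 hη hf)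
      exact hω.2
    · simp [hf]
  have m₄ : Pr S₄ ≤ ENNReal.ofReal (Real.exp (-e)) := by
    refine measure_biUnion_le_exp hcardk (fun f _ => measure_empiricalSquare_le hψ.continuous hfam
      hK hP hind hlaw hn (v f)) (le_trans ?_ he₃)
    have h1 : η ^ 2 ≤ 1 := pow_le_one₀ hη0 hη1
    have h2 : (n : ℝ) * (η ^ 2 / 64) ≤ n * 3 := by gcongr; linarith
    linarith
  have hsub : ∀ {s : Set Ω}, s ⊆ (S₁ ∪ S₂) ∪ (S₃ ∪ S₄) →
      Pr s ≤ ENNReal.ofReal (4 * Real.exp (-e)) := by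
    intro s hs
    refine (measure_mono hs).trans ((measure_union_le _ _).trans ((add_le_add
      ((measure_union_le _ _).trans (add_le_add m₁ m₂))
      ((measure_union_le _ _).trans (add_le_add m₃ m₄))).trans (le_of_eq ?_)))
    have := (Real.exp_pos (-e)).le
    rw [← ENNReal.ofReal_add this this, ← ENNReal.ofReal_add (by positivity) (by positivity)]
    congr 1; ring
  refine hsub ?_
  rintro ω ⟨Bh, hBβ, hst, hnot⟩
  by_contra hω
  refine hnot ?_
  simp only [Set.mem_union, not_or] at hω
  obtain ⟨⟨g₁, g₂⟩, g₃, g₄⟩ := hω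
  simp only [hS₁, hS₂, hS₃, hS₄, Set.mem_iUnion, Set.mem_ofPred_eq, not_exists, not_and, not_le, not_lt,
    Fintype.mem_piFinset] at g₁ g₂ g₃ g₄
  have hτ : 0 ≤ 1 / 16 * (lam * Cρ) := by positivity
  refine error_bounds hd₃ hpen hlam hCρ hμ hμΛ hΛ Bh B₀ hr ?_ ?_
  · refine (predictionError_le_of_isStationaryPoint hd₃ hψ hpen hμ.le hst h𝒜
      (fun a ha => (g₁ a ha).le)).trans ?_
    have := mul_le_mul_of_nonneg_right hq (nuclearNorm_nonneg (Bh - B₀))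
    linarith
  · refine le_predictionError hψ (hfam.deriv_mono hw hψ) hc.le hψ2 hM hψ3 hm.le hT.le hMT
      (sq_nonneg _) hΛ₀.le hΛc hβR _ _ Bh B₀ hBβ (fun u h0 hu hnuc => ?_) hτ
    refine le_empiricalCurvature_of_forall_average hc.le hm.le hT.le hψ2 (sq_nonneg _) hR hk
      (hΛ₀.le.trans hΛ) hΛc hRk _ B₀ 𝒜 h𝒜norm g₂ (fun f hf => ⟨g₃ f hf, g₄ f hf⟩) hu ?_ hΛ₀.le
    have h1 := mem_convexHull_of_nuclearNorm_le h𝒜 (mul_pos hR h0) hnuc (hne hd₃)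
    rw [smul_smul] at h1
    convert h1 using 2
    field_simp

end Exceptional

end TubalGLM

end

/-! ### Choice of the constants and the main theorem -/

set_option maxHeartbeats 1000000 in
theorem mainTheorem8 :
    -- a numerical constant
    ∃ C : ℝ, 0 < C ∧
    -- the exponential family, the problem constants and the level of confidence
    ∀ (ψ : ℝ → ℝ) (w : ℝ) (ν : Measure ℝ) [SigmaFinite ν] (c K μ Cρ Λ₀ A : ℝ),
      ContDiff ℝ 3 ψ → 0 < w → TubalGLM.IsExponentialFamily ψ w ν →
      0 < c → (∀ s : ℝ, |iteratedDeriv 2 ψ s| ≤ c) →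
      (∀ s : ℝ, 1 < |s| → |iteratedDeriv 3 ψ s| ≤ |s|⁻¹) →
      0 < K → 0 < μ → 0 < Cρ → 3 * μ < 4 * Λ₀ → 0 < A →
    ∃ κ₀ β₀ N : ℝ, 0 < κ₀ ∧ 0 < β₀ ∧ 0 < N ∧
    ∀ (d d₃ n r : ℕ) (β lam : ℝ) (ρ : ℝ → ℝ)
      (P : Measure (TubalGLM.Tensor d d₃)) [IsProbabilityMeasure P]
      (B₀ : TubalGLM.Tensor d d₃)
      (Ω : Type*) [MeasurableSpace Ω] (Pr : Measure Ω) [IsProbabilityMeasure Pr]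
      (X : Fin n → Ω → TubalGLM.Tensor d d₃) (y : Fin n → Ω → ℝ),
      1 ≤ d → 1 ≤ d₃ →
      -- the sample is i.i.d. from the generalized linear model with true parameter `B₀`
      iIndepFun (fun i ω => (X i ω, y i ω)) Pr →
      (∀ i, HasLaw (fun ω => (X i ω, y i ω)) (TubalGLM.glmLaw P ν ψ w B₀) Pr) →
      TubalGLM.IsSubGaussian P K →
      TubalGLM.tubalRank B₀ = r →
      Λ₀ ≤ TubalGLM.smallestEigenvalue (TubalGLM.expectedHessian P ψ B₀) →
      -- tuning parameter, penalty, radius and sample size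
      κ₀ * Real.sqrt ((d : ℝ) * d₃ / n) ≤ lam →
      TubalGLM.IsPenalty ρ lam Cρ μ →
      0 < β → β ≤ β₀ →
      N * (max r 1 : ℕ) * d * d₃ / β ^ 2 ≤ n →
      -- the probability that some stationary point in the ball violates one of the bounds
      Pr {ω | ∃ Bh : TubalGLM.Tensor d d₃, ‖Bh - B₀‖ ≤ β ∧
          TubalGLM.IsStationaryPoint
            (fun B => TubalGLM.empiricalRisk ψ (fun i => X i ω) (fun i => y i ω) B
              + TubalGLM.regularizer ρ B) Bh ∧
          ¬ (‖Bh - B₀‖ ≤ C * (Cρ * lam * Real.sqrt r) /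
                (4 * TubalGLM.smallestEigenvalue (TubalGLM.expectedHessian P ψ B₀) - 3 * μ) ∧
             TubalGLM.nuclearNorm (Bh - B₀) ≤ C * (Cρ * lam * r) /
                (4 * TubalGLM.smallestEigenvalue (TubalGLM.expectedHessian P ψ B₀) - 3 * μ) ∧
             TubalGLM.predictionError
                (TubalGLM.empiricalRisk ψ (fun i => X i ω) (fun i => y i ω)) Bh B₀ ≤
              Cρ ^ 2 * lam ^ 2 * r *
                (C / (4 * TubalGLM.smallestEigenvalue (TubalGLM.expectedHessian P ψ B₀) - 3 * μ) +
                 C * μ / (4 * TubalGLM.smallestEigenvalue (TubalGLM.expectedHessian P ψ B₀)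
                    - 3 * μ) ^ 2))}
        ≤ ENNReal.ofReal (d₃ * Real.exp (-A * d)) := by
  refine ⟨100, by norm_num, ?_⟩
  intro ψ w ν _ c K μ Cρ Λ₀ A hψ hw hfam hc hψ2 h3 hK hμ hCρ hμΛ hA
  obtain ⟨M, hM, hψ3⟩ := TubalGLM.exists_bound_iteratedDeriv_three hψ h3
  have hΛ₀ : 0 < Λ₀ := by linarith
  have hκ : 0 < (2 * K) ^ 2 := by positivity
  set κ := (2 * K) ^ 2 with hκ_def
  obtain ⟨m, hm_def⟩ : ∃ m, m = Λ₀ / (64 * κ) := ⟨_, rfl⟩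
  have hm : 0 < m := by rw [hm_def]; positivity
  obtain ⟨T, hT, hT2⟩ : ∃ T : ℝ, 0 < T ∧ T ^ 2 = 16384 * (c * κ ^ 2) / Λ₀ :=
    ⟨Real.sqrt (16384 * (c * κ ^ 2) / Λ₀), Real.sqrt_pos.mpr (by positivity),
      Real.sq_sqrt (by positivity)⟩
  obtain ⟨η, hη_def⟩ : ∃ η, η = min 1 (Λ₀ / (64 * (9 * c + m) * κ)) := ⟨_, rfl⟩
  have hη : 0 < η := by rw [hη_def]; exact lt_min one_pos (by positivity)
  obtain ⟨γ, hγ_def⟩ : ∃ γ, γ = η ^ 2 / 64 := ⟨_, rfl⟩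
  have hγ : 0 < γ := by rw [hγ_def]; positivity
  obtain ⟨D, hD_def⟩ : ∃ D, D = A + 7 := ⟨_, rfl⟩
  have hD : 0 < D := by linarith
  obtain ⟨Q, hQ_def⟩ : ∃ Q, Q = 1024 * (24 * (9 * c + m) * κ) := ⟨_, rfl⟩
  have hQ : 0 < Q := by rw [hQ_def]; positivity
  obtain ⟨q, hq_def⟩ : ∃ q, q = c * w * κ + D + (A + 3) := ⟨_, rfl⟩
  have hq : 0 < q := by rw [hq_def]; positivity
  obtain ⟨θ, hθ_def⟩ : ∃ θ, θ = Real.sqrt (γ * Λ₀ / (4 * D * Q)) := ⟨_, rfl⟩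
  have hθ : 0 < θ := by rw [hθ_def]; exact Real.sqrt_pos.mpr (by positivity)
  -- The first entry of `κ₀` dominates the gradient noise, the second secures the cone condition
  -- through `R √(d d₃/n) ≥ θ`. The radius `m/(M T)` controls the Taylor remainder.
  refine ⟨max (64 * q / Cρ) (16 * (c * κ) / (θ * Cρ)), min 1 (m / (M * T)),
    c * w * κ + (4 * A + 20) / γ + (2 * A + 10), lt_max_of_lt_left (by positivity),
    lt_min one_pos (by positivity), by positivity, ?_⟩
  intro d d₃ n r β lam ρ P _ B₀ Ω _ Pr _ X y hd hd₃ hind hlaw hP hr hΛ hlam hpen hβ hβ₀ hN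
  have hd' : (1 : ℝ) ≤ d := by exact_mod_cast hd
  have hd₃' : (1 : ℝ) ≤ d₃ := by exact_mod_cast hd₃
  -- If the claimed bound is at least `1` it is trivial; otherwise `d₃ < exp (A d)`, so the
  -- logarithm of the dictionary size is at most `(A + 7) d`.
  rcases le_or_gt 1 ((d₃ : ℝ) * Real.exp (-A * d)) with hbig | hsmall
  · exact prob_le_one.trans (by simpa using ENNReal.ofReal_le_ofReal hbig)
  have hβ1 : β ≤ 1 := hβ₀.trans (min_le_left _ _)
  have hnd : (c * w * κ + (4 * A + 20) / γ + (2 * A + 10)) * d ≤ n := by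
    refine le_trans ?_ hN
    rw [le_div_iff₀ (by positivity)]
    have h1 : (1 : ℝ) ≤ (max r 1 : ℕ) := by exact_mod_cast le_max_right r 1
    have h2 : β ^ 2 ≤ 1 := pow_le_one₀ hβ.le hβ1
    have h4 : 0 ≤ (c * w * κ + (4 * A + 20) / γ + (2 * A + 10)) * d := by positivity
    calc (c * w * κ + (4 * A + 20) / γ + (2 * A + 10)) * d * β ^ 2
        ≤ (c * w * κ + (4 * A + 20) / γ + (2 * A + 10)) * d * (1 : ℝ) := by gcongr
      _ ≤ (c * w * κ + (4 * A + 20) / γ + (2 * A + 10)) * d * ((max r 1 : ℕ) * d₃) := by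
        gcongr; nlinarith
      _ = _ := by ring
  have hn₁ : c * w * κ * d ≤ n := by
    refine le_trans ?_ hnd
    gcongr
    have : 0 ≤ (4 * A + 20) / γ := by positivity
    linarith
  have hn₂ : (2 * A + 10) * d ≤ n := by
    refine le_trans (mul_le_mul_of_nonneg_right ?_ (by linarith)) hnd
    have : 0 ≤ (4 * A + 20) / γ := by positivity
    have : 0 ≤ c * w * κ := by positivity
    linarith
  have hn₃ : (4 * A + 20) * d ≤ γ * n := by
    have h1 : (4 * A + 20) / γ * d ≤ n := by
      refine le_trans ?_ hnd
      gcongr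
      have : 0 ≤ c * w * κ := by positivity
      linarith
    rw [div_mul_eq_mul_div, div_le_iff₀ hγ] at h1
    linarith
  have hn : (0 : ℝ) < n := lt_of_lt_of_le (by positivity) hn₂
  -- As large as possible while the union bound over `k`-tuples, of log-size `k D d`, uses at most
  -- half of the exponent `γ n`. Rounding down loses at most a factor 2 because the quotient is at
  -- least `1`.
  obtain ⟨k, hk_def⟩ : ∃ k, k = ⌊γ * n / (2 * D * d)⌋₊ := ⟨_, rfl⟩
  have hx : 1 ≤ γ * n / (2 * D * d) := by
    rw [le_div_iff₀ (by positivity), hD_def]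
    nlinarith
  have hk : 0 < k := by rw [hk_def]; exact Nat.floor_pos.mpr hx
  have hk' : (1 : ℝ) ≤ k := by exact_mod_cast hk
  have hk_le : k * (2 * D * d) ≤ γ * n := by
    rw [← le_div_iff₀ (by positivity), hk_def]
    exact Nat.floor_le (by positivity)
  have hk_ge : γ * n ≤ k * (4 * D * d) := by
    have h1 : γ * n / (2 * D * d) < k + 1 := by rw [hk_def]; exact Nat.lt_floor_add_one _
    rw [div_lt_iff₀ (by positivity)] at h1
    have h2 : (k + 1) * (2 * D * d) ≤ (k + k) * (2 * D * d) := by gcongr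
    linarith
  -- The largest cone aperture for which the Maurey error stays within `Λ₀/16`.
  obtain ⟨R, hR_def⟩ : ∃ R, R = Real.sqrt (k * Λ₀ / (Q * d₃)) := ⟨_, rfl⟩
  have hR : 0 < R := by rw [hR_def]; exact Real.sqrt_pos.mpr (by positivity)
  have hR2 : R ^ 2 = k * Λ₀ / (Q * d₃) := by rw [hR_def]; exact Real.sq_sqrt (by positivity)
  obtain ⟨δ, hδ_def⟩ : ∃ δ, δ = Real.sqrt ((d : ℝ) * d₃ / n) := ⟨_, rfl⟩
  have hδ : 0 < δ := by rw [hδ_def]; exact Real.sqrt_pos.mpr (by positivity)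
  have hθR : θ ≤ R * δ := by
    rw [hθ_def, hR_def, hδ_def, ← Real.sqrt_mul (by positivity)]
    refine Real.sqrt_le_sqrt ?_
    have h1 : k * Λ₀ / (Q * d₃) * (d * d₃ / n) = k * Λ₀ * d / (Q * n) := by field_simp
    rw [h1, div_le_div_iff₀ (by positivity) (by positivity)]
    calc γ * Λ₀ * (Q * n) = γ * n * (Λ₀ * Q) := by ring
      _ ≤ k * (4 * D * d) * (Λ₀ * Q) := by gcongr
      _ = _ := by ring
  rw [← hδ_def] at hlam
  have hlam₁ : 64 * q * δ ≤ lam * Cρ := by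
    have h1 := (mul_le_mul_of_nonneg_right (le_max_left (64 * q / Cρ) (16 * (c * κ) / (θ * Cρ)))
      hδ.le).trans hlam
    rwa [div_mul_eq_mul_div, div_le_iff₀ hCρ] at h1
  have hlam₂ : 16 * (c * κ) * δ ≤ lam * (θ * Cρ) := by
    have h1 := (mul_le_mul_of_nonneg_right (le_max_right (64 * q / Cρ) (16 * (c * κ) / (θ * Cρ)))
      hδ.le).trans hlam
    rwa [div_mul_eq_mul_div, div_le_iff₀ (by positivity)] at h1
  have hlam0 : 0 < lam := lt_of_lt_of_le (mul_pos (lt_max_of_lt_left (by positivity)) hδ) hlam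
  have hcard : (d₃ * 625 ^ d : ℝ) ≤ Real.exp (D * d) := by
    have h1 : (625 : ℝ) ≤ Real.exp 7 := by
      have h2 : Real.exp 7 = Real.exp 1 ^ 7 := by rw [← Real.exp_nat_mul]; norm_num
      have h3 := Real.exp_one_gt_d9
      rw [h2]
      calc (625 : ℝ) ≤ 2.7 ^ 7 := by norm_num
        _ ≤ _ := by gcongr; linarith
    have h2 : (d₃ : ℝ) ≤ Real.exp (A * d) := by
      rw [neg_mul, Real.exp_neg, ← div_eq_mul_inv, div_lt_one (Real.exp_pos _)] at hsmall
      exact hsmall.le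
    calc (d₃ * 625 ^ d : ℝ) ≤ Real.exp (A * d) * Real.exp 7 ^ d := by gcongr
      _ = _ := by rw [← Real.exp_nat_mul, ← Real.exp_add, hD_def]; congr 1; ring
  refine (TubalGLM.measure_exists_isStationaryPoint_le (M := M) (η := η) (D := D) (q := q) (m := m)
    (T := T) (R := R) (k := k) (e := (A + 3) * d) hψ hw hfam hc hψ2 hM.le hψ3 hK hμ hCρ hμΛ hd hd₃
    (by exact_mod_cast hn) hind hlaw hP hr hΛ hpen hlam0 hm hT ?_ ?_ ?_ hη.le ?_ ?_ hR hk ?_ ?_ ?_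
    hcard hn₁ ?_ ?_ ?_).trans (ENNReal.ofReal_le_ofReal ?_)
  · rw [← hκ_def, hm_def]; exact le_of_eq (by field_simp)
  · rw [← hκ_def, hT2]; exact le_of_eq (by field_simp)
  · have h1 := hβ₀.trans (min_le_right _ _)
    rw [le_div_iff₀ (by positivity)] at h1
    linarith
  · rw [hη_def]; exact min_le_left _ _
  · have h1 : η ≤ Λ₀ / (64 * (9 * c + m) * κ) := by rw [hη_def]; exact min_le_right _ _
    rwa [le_div_iff₀ (by positivity)] at h1
  · rw [← hκ_def, hR2, hQ_def]; exact le_of_eq (by field_simp)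
  · rw [← hκ_def]
    have h1 : 16 * (c * κ) * δ ≤ R * (lam * Cρ) * δ := by
      calc _ ≤ lam * Cρ * θ := by linarith
        _ ≤ lam * Cρ * (R * δ) := by gcongr
        _ = _ := by ring
    have h2 := le_of_mul_le_mul_right h1 hδ
    calc c * κ * β ≤ c * κ * 1 := by gcongr
      _ ≤ _ := by linarith
  · rw [← hδ_def]; linarith
  · rw [← hκ_def, hq_def]; exact le_of_eq (by ring)
  · rw [hD_def]; nlinarith
  · rw [← hγ_def]; nlinarith
  -- The surplus `3 d` in the exponent `e = (A + 3) d` pays for the four bad events.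
  · have h4 : (4 : ℝ) ≤ Real.exp 3 := by linarith [Real.add_one_le_exp (3 : ℝ)]
    have h5 : Real.exp 3 ≤ Real.exp (3 * d) := Real.exp_le_exp.mpr (by linarith)
    calc 4 * Real.exp (-((A + 3) * d)) ≤ Real.exp (3 * d) * Real.exp (-((A + 3) * d)) := by
          gcongr; linarith
      _ = 1 * Real.exp (-A * d) := by rw [← Real.exp_add, one_mul]; congr 1; ring
      _ ≤ _ := by gcongr
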